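/- Let $\mathbb T^d=\mathbb R^d/\mathbb Z^d$ and let $\mathcal P(\mathbb T^d)$ be the set of Borel probability measures on $\mathbb T^d$, with the Monge–Kantorovich distance $\mathbf d_1(m,m')=\sup\{\int f\,d(m-m') : f \text{ is 1-Lipschitz}\}$. For $F:\mathbb T^d\times\mathcal P(\mathbb T^d)\to\mathbb R^d$ put $$\mathrm{Lip}(F)=\sup_{x,y,m}\frac{|F(x,m)-F(y,m)|}{|x-y|}+\sup_{x,m,m'}\frac{|F(x,m)-F(x,m')|}{\mathbf d_1(m,m')}\in[0,\infty].$$ Let $\sigma,\sigma'>0$ and let $(\beta_s)_{s\ge 0}$ be a $d$-dimensional Brownian motion on a probability space. Let $H:\mathbb T^d\times\mathbb R^d\times\mathcal P(\mathbb T^d)\to\mathbb R$, $(x,p,m)\mapsto H(x,p,m)$, be differentiable in $x$ and in $p$ with $D_xH$ and $D_pH$ globally Lipschitz in $(x,p,m)$; let $B:\mathbb T^d\times\mathbb R^d\times\mathcal P(\mathbb T^d)\to\mathbb R^d$ be globally Lipschitz; and let $U_0:\mathbb T^d\times\mathcal P(\mathbb T^d)\to\mathbb R$ be differentiable in $x$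 with $\nabla_xU_0$ Lipschitz in $(x,m)$. Consider the equation for $W=W(t,x,m)\in\mathbb R^d$ $$\partial_tW+D_pH(x,W,m)\cdot\nabla_xW-\sigma\Delta_xW+\int B(y,W(t,y,m),m)\cdot D_mW(t,x,m,y)\,m(dy)-\sigma'\int\mathrm{div}_y(D_mW(t,x,m,y))\,m(dy)=-D_xH(x,W,m),$$ with $W(0,\cdot,\cdot)=\nabla_xU_0$. For $T\in(0,\infty]$, a *Lipschitz solution on $[0,T)$* is a function $W:[0,T)\times\mathbb T^d\times\mathcal P(\mathbb T^d)\to\mathbb R^d$, measurable in $t$, such that $\sup_{s\in[0,t]}\mathrm{Lip}(W(s,\cdot,\cdot))<\infty$ for every $t<T$, and such that for all $t\in[0,T)$, $x\in\mathbb T^d$, $\mu\in\mathcal P(\mathbb T^d)$, $$W(t,x,\mu)=\mathbb E\Big[\int_0^t-D_xH\big(X_s,W(t-s,X_s,m(s)),m(s)\big)\,ds+\nabla_xU_0(X_t,m(t))\Big],$$ where $(X,m)$ solves on $[0,t]$ $$dX_s=-D_pH\big(X_s,W(t-s,X_s,m(s)),m(s)\big)ds+\sqrt{2\sigma}\,d\beta_s,\qquad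 X_0=x,$$ $$\partial_sm=\mathrm{div}\big(B(\cdot,W(t-s,\cdot,m(s)),m(s))\,m(s)\big)+\sigma'\Delta m,\qquad m(0)=\mu,$$ the second equation being understood in the weak sense (tested against smooth functions, with $s\mapsto m(s)$ continuous). Then: 1. There is $T>0$ such that there exists a unique Lipschitz solution on $[0,T)$. 2. There are $T^c\in(0,\infty]$ and a Lipschitz solution $W$ on $[0,T^c)$ such that, for every Lipschitz solution $V$ on an interval $[0,T)$, one has $T\le T^c$ and $V$ is the restriction of $W$ to $[0,T)$. 3. If $T^c<\infty$, then $\mathrm{Lip}(W(t,\cdot,\cdot))\to\infty$ as $t\uparrow T^c$. -/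

import Mathlib

open MeasureTheory ProbabilityTheory Set Filter Topology
open scoped NNReal ENNReal

noncomputable section

namespace MFG

/-- Euclidean space `ℝ^d`. -/
abbrev E (d : ℕ) : Type := EuclideanSpace ℝ (Fin d)

/-- The flat torus `ℝ^d / ℤ^d`, with its Euclidean quotient distance. -/
abbrev Torus (d : ℕ) : Type := PiLp 2 (fun _ : Fin d => UnitAddCircle)

/-- Borel probability measures on the torus. -/
abbrev PT (d : ℕ) : Type := ProbabilityMeasure (Torus d)

/-- The canonical projection `ℝ^d → 𝕋^d`. -/
def proj {d : ℕ} (y : E d) : Torus d := WithLp.toLp 2 (fun i => (y i : UnitAddCircle))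

/-- The Monge-Kantorovich distance, as a supremum over 1-Lipschitz functions. -/
def d1 {d : ℕ} (m m' : PT d) : ℝ :=
  ⨆ f : {f : Torus d → ℝ // LipschitzWith 1 f},
    ((∫ y, f.1 y ∂(m : Measure (Torus d))) - ∫ y, f.1 y ∂(m' : Measure (Torus d)))

/-- `φ : 𝕋^d → ℝ` is differentiable at `x`, with gradient `g`. -/
def HasTorusGradientAt {d : ℕ} (φ : Torus d → ℝ) (g : E d) (x : Torus d) : Prop :=
  HasGradientAt (fun y : E d => φ (x + proj y)) g 0

/-- `φ : 𝕋^d → ℝ` is smooth: its periodic lift to `ℝ^d` is. -/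
def IsSmooth {d : ℕ} (φ : Torus d → ℝ) : Prop :=
  ContDiff ℝ ((⊤ : ℕ∞) : WithTop ℕ∞) (fun y : E d => φ (proj y))

/-- The gradient of a (smooth) function on the torus. -/
def torusGradient {d : ℕ} (φ : Torus d → ℝ) (x : Torus d) : E d :=
  gradient (fun y : E d => φ (x + proj y)) 0

/-- The Laplacian of a (smooth) function on the torus. -/
def torusLaplacian {d : ℕ} (φ : Torus d → ℝ) (x : Torus d) : ℝ :=
  Laplacian.laplacian (fun y : E d => φ (x + proj y)) 0

/-- `Lip(F)`: the Lipschitz constant in `x` plus the Lipschitz constant in `m`, in `[0, ∞]`. -/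
def Lip {d : ℕ} (F : Torus d → PT d → E d) : ℝ≥0∞ :=
  (⨆ (x : Torus d) (y : Torus d) (m : PT d), ENNReal.ofReal (‖F x m - F y m‖ / dist x y)) +
  (⨆ (x : Torus d) (m : PT d) (m' : PT d), ENNReal.ofReal (‖F x m - F x m'‖ / d1 m m'))

/-- `F : 𝕋^d × 𝒫(𝕋^d) → ℝ^d` is globally Lipschitz. -/
def IsLipschitzXM {d : ℕ} (F : Torus d → PT d → E d) : Prop :=
  ∃ C : ℝ, ∀ x x' m m', ‖F x m - F x' m'‖ ≤ C * (dist x x' + d1 m m')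

/-- `G : 𝕋^d × ℝ^d × 𝒫(𝕋^d) → ℝ^d` is globally Lipschitz. -/
def IsLipschitzXPM {d : ℕ} (G : Torus d → E d → PT d → E d) : Prop :=
  ∃ C : ℝ, ∀ x x' p p' m m', ‖G x p m - G x' p' m'‖ ≤ C * (dist x x' + ‖p - p'‖ + d1 m m')

/-- The components `β i` form a `d`-dimensional Brownian motion under `P`. -/
structure IsBrownian {Ω : Type*} [MeasurableSpace Ω] {d : ℕ}
    (β : Fin d → ℝ≥0 → Ω → ℝ) (P : Measure Ω) : Prop where
  isBrownianReal : ∀ i, IsBrownianReal (β i) P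
  indep : iIndepFun (fun (i : Fin d) (ω : Ω) (t : ℝ≥0) => β i t ω) P

/-- The curve `m` is a weak solution on `[0, t] × 𝕋^d` of
`∂_s m = -div (F(t - s, y, m(s)) m(s)) + σ' Δ m`, `m(0) = μ`. -/
structure IsFokkerPlanckSolution {d : ℕ} (σ' : ℝ) (F : ℝ → Torus d → PT d → E d)
    (t : ℝ) (μ : PT d) (m : ℝ → PT d) : Prop where
  continuousOn : ContinuousOn m (Icc 0 t)
  initial : m 0 = μ
  integrable : ∀ᵐ r ∂(volume.restrict (Ioc 0 t)),
    Integrable (fun y => F (t - r) y (m r)) (m r : Measure (Torus d))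
  integrable_pairing : ∀ φ : Torus d → ℝ, IsSmooth φ →
    IntervalIntegrable
      (fun r => ∫ y, inner ℝ (F (t - r) y (m r)) (torusGradient φ y) ∂(m r : Measure (Torus d)))
      volume 0 t
  weak : ∀ φ : Torus d → ℝ, IsSmooth φ → ∀ s ∈ Icc 0 t,
    ∫ y, φ y ∂(m s : Measure (Torus d)) =
      (∫ y, φ y ∂(μ : Measure (Torus d))) +
      ∫ r in (0 : ℝ)..s,
        ((∫ y, inner ℝ (F (t - r) y (m r)) (torusGradient φ y) ∂(m r : Measure (Torus d))) +
          σ' * ∫ y, torusLaplacian φ y ∂(m r : Measure (Torus d)))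

/-- Along the curve `m`, the `𝕋^d`-valued process `X` solves on `[0, t]` the equation
`dX_s = b(t - s, X_s, m(s)) ds + √(2σ) dβ_s`, `X_0 = x`. As the noise is additive this is an
integral equation for almost every path, and no stochastic integral is needed. -/
structure IsSDESolution {Ω : Type*} [MeasurableSpace Ω] {d : ℕ} (P : Measure Ω)
    (β : Fin d → ℝ≥0 → Ω → ℝ) (σ : ℝ) (b : ℝ → Torus d → PT d → E d)
    (t : ℝ) (x : Torus d) (m : ℝ → PT d) (X : ℝ → Ω → Torus d) : Prop where
  aemeasurable : ∀ s ∈ Icc 0 t, AEMeasurable (X s) P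
  integrable : ∀ᵐ ω ∂P, IntervalIntegrable (fun r => b (t - r) (X r ω) (m r)) volume 0 t
  equation : ∀ᵐ ω ∂P, ∀ s ∈ Icc 0 t,
    X s ω = x + proj ((∫ r in (0 : ℝ)..s, b (t - r) (X r ω) (m r)) +
      Real.sqrt (2 * σ) • WithLp.toLp 2 (fun i => β i s.toNNReal ω))

/-- `V = Ψ(T, b, F, A, V₀)` on `[0, T)`: for all `0 ≤ t < T`, `x` and `μ`,
`V(t, x, μ) = 𝔼[∫₀ᵗ A(t - s, X_s, m(s)) ds + V₀(X_t, m(t))]`, where `(X, m)` solves the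
SDE-Fokker-Planck system started from `(x, μ)`. -/
def IsRepresented {Ω : Type*} [MeasurableSpace Ω] {d : ℕ} (P : Measure Ω)
    (β : Fin d → ℝ≥0 → Ω → ℝ) (σ σ' : ℝ) (T : EReal) (b F A : ℝ → Torus d → PT d → E d)
    (V₀ : Torus d → PT d → E d) (V : ℝ → Torus d → PT d → E d) : Prop :=
  ∀ t : ℝ, 0 ≤ t → (t : EReal) < T → ∀ (x : Torus d) (μ : PT d),
    ∃ (X : ℝ → Ω → Torus d) (m : ℝ → PT d),
      IsFokkerPlanckSolution σ' F t μ m ∧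
      IsSDESolution P β σ b t x m X ∧
      Integrable (fun z : ℝ × Ω => A (t - z.1) (X z.1 z.2) (m z.1))
        ((volume.restrict (Ioc 0 t)).prod P) ∧
      Integrable (fun ω => V₀ (X t ω) (m t)) P ∧
      V t x μ = ∫ ω, ((∫ s in (0 : ℝ)..t, A (t - s) (X s ω) (m s)) + V₀ (X t ω) (m t)) ∂P

/-- Lipschitz solutions on `[0, T)`, with initial datum `W₀`, of
`∂_t W + D_pH(x,W,m)·∇_x W - σ Δ_x W + ∫ B(y,W(t,y,m),m)·D_m W m(dy) - σ' ∫ div_y (D_m W) m(dy)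
  = -D_xH(x,W,m)`. -/
structure IsLipschitzSolution {Ω : Type*} [MeasurableSpace Ω] {d : ℕ} (P : Measure Ω)
    (β : Fin d → ℝ≥0 → Ω → ℝ) (σ σ' : ℝ) (DxH DpH B : Torus d → E d → PT d → E d)
    (W₀ : Torus d → PT d → E d) (T : EReal) (W : ℝ → Torus d → PT d → E d) : Prop where
  measurable : ∀ x m, Measurable (fun t : {t : ℝ // 0 ≤ t ∧ (t : EReal) < T} => W t x m)
  lipschitz : ∀ t : ℝ, 0 ≤ t → (t : EReal) < T →
    ∃ C : ℝ≥0, ∀ s ∈ Icc 0 t, Lip (W s) ≤ C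
  represented : IsRepresented P β σ σ' T
    (fun t x m => -DpH x (W t x m) m)
    (fun t x m => -B x (W t x m) m)
    (fun t x m => -DxH x (W t x m) m) W₀ W

end MFG

end

/-!
Write `b = -D_pH`, `F = -B` and `A = -D_xH`. A field `V` is a solution if `V t x μ` is the expected
payoff, with running payoff `A` and terminal payoff `∇U₀`, along the characteristics of `V` that
start from `(x, μ)` with time to go `t`. A solution is thus a fixed point, and the theorem follows
from one stability estimate for characteristics.

**Stability.** The Fokker–Planck equation is stable for the Monge–Kantorovich distance, with respect
to the initial measure and to the drift (`exists_fokkerPlanck_stability`). The proof is by duality: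
the difference of two solutions is tested against `u(r) = e^{σ'(s-r)Δ} ψ` with `ψ` a `1`-Lipschitz
function. The Laplacian drops out, `∇u` is bounded by `1`, and it is Lipschitz with constant
`O((s-r)^{-1/2})`, by Gaussian integration by parts (`norm_torusGradient_torusHeat_sub_le`). The
singularity is integrable, so a Gronwall argument in a weighted norm closes the estimate. Solutions
of the stochastic equation are compared path by path, because the noise is additive and cancels
(`path_stability`). Together these give `exists_payoff_stability`: the payoffs of two fields differ
by little, as soon as one of the fields is Lipschitz.

**Existence of characteristics.** A McKean–Vlasov equation with additive noise is solved by Picard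
iteration in a supremum norm over all paths (`exists_flow_lawOf`). The laws of its solution satisfy
the Fokker–Planck equation (`IsFlow.isFokkerPlanckSolution`). Instead of Itô's formula, the
generator is computed by averaging out one increment of the noise, which is independent of the past.

**Short-time existence and uniqueness.** By the stability estimate the map sending a field to its
payoff is a contraction, on fields with a fixed Lipschitz constant and on a time interval which
depends only on the Lipschitz constant and the supremum of the initial datum (`exists_isRegular`).
The same estimate gives uniqueness on any interval (`eqOn_of_isRep`). It requires solutions to be
bounded, which is derived from measurability in time in `exists_bound_of_isRep`.

**Continuation and blow-up.** Two solutions can be concatenated, by dynamic programming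
(`isRep_add`, `IsRegular.concat`). The payoff after an intermediate time depends only on the laws of
the flow, and these are determined by the Fokker–Planck equation (`IsFlow.lawOf_restart`). The
supremum of a solution is bounded on bounded time intervals independently of its Lipschitz constant
(`norm_le_of_isRep`). Hence, if the Lipschitz constant stayed below some bound at times arbitrarily
close to a finite maximal time, then the short-time existence theorem would apply from such a time
with a uniform time step, and the solution could be continued (`exists_maximal_isLipSol`).
-/

noncomputable section

namespace MFG

/-! ### The torus and the Monge–Kantorovich distance -/

lemma proj_add {d : ℕ} (a b : E d) : proj (a + b) = proj a + proj b := by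
  ext i; simp [proj]

lemma proj_sub {d : ℕ} (a b : E d) : proj (a - b) = proj a - proj b := by
  ext i; simp [proj]

@[simp] lemma proj_zero {d : ℕ} : proj (0 : E d) = 0 := by
  ext i; simp [proj]

lemma norm_proj_le {d : ℕ} (a : E d) : ‖proj a‖ ≤ ‖a‖ := by
  rw [PiLp.norm_eq_of_L2, EuclideanSpace.norm_eq]
  refine Real.sqrt_le_sqrt (Finset.sum_le_sum fun i _ => ?_)
  gcongr
  exact QuotientAddGroup.norm_mk_le_norm (S := AddSubgroup.zmultiples (1 : ℝ)) (m := a i)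

/-- Every point of the torus has a representative in `ℝ^d` of the same norm. -/
lemma exists_proj_eq {d : ℕ} (w : Torus d) : ∃ z : E d, proj z = w ∧ ‖z‖ = ‖w‖ := by
  have h : ∀ a : UnitAddCircle, ∃ r : ℝ, (r : UnitAddCircle) = a ∧ |r| = ‖a‖ := by
    intro a
    obtain ⟨x, rfl⟩ := QuotientAddGroup.mk_surjective a
    refine ⟨x - round x, ?_, ?_⟩
    · have : ((round x : ℝ) : UnitAddCircle) = 0 := by
        rw [AddCircle.coe_eq_zero_iff]; exact ⟨round x, by simp⟩
      change ((x - round x : ℝ) : UnitAddCircle) = (x : UnitAddCircle)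
      rw [AddCircle.coe_sub, this, sub_zero]
    · exact (UnitAddCircle.norm_eq (x := x)).symm
  choose r hr hr' using h
  refine ⟨WithLp.toLp 2 (fun i => r (w i)), ?_, ?_⟩
  · ext i; simp [proj, hr]
  · rw [PiLp.norm_eq_of_L2 w, EuclideanSpace.norm_eq]
    simp [hr']

lemma proj_surjective {d : ℕ} : Function.Surjective (proj : E d → Torus d) := fun w =>
  (exists_proj_eq w).imp fun _ h => h.1

lemma norm_torus_le {d : ℕ} (w : Torus d) : ‖w‖ ≤ √d := by
  rw [PiLp.norm_eq_of_L2]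
  refine Real.sqrt_le_sqrt ?_
  have : ∀ i, ‖w i‖ ^ 2 ≤ 1 := by
    intro i
    have h := AddCircle.norm_le_half_period (1 : ℝ) (x := w i) one_ne_zero
    have : ‖w i‖ ≤ 1 := by
      refine h.trans ?_; norm_num
    exact pow_le_one₀ (norm_nonneg _) this
  calc ∑ i, ‖w i‖ ^ 2 ≤ ∑ _i : Fin d, (1 : ℝ) := Finset.sum_le_sum fun i _ => this i
    _ = d := by simp

lemma dist_torus_le {d : ℕ} (x y : Torus d) : dist x y ≤ √d := by
  rw [dist_eq_norm]; exact norm_torus_le _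

lemma lipschitzWith_proj {d : ℕ} : LipschitzWith 1 (proj : E d → Torus d) :=
  LipschitzWith.of_dist_le_mul fun a b => by
    rw [dist_eq_norm, dist_eq_norm, ← proj_sub]; simpa using norm_proj_le (a - b)

@[fun_prop]
lemma continuous_proj {d : ℕ} : Continuous (proj : E d → Torus d) := lipschitzWith_proj.continuous

@[fun_prop]
lemma measurable_proj {d : ℕ} : Measurable (proj : E d → Torus d) := continuous_proj.measurable

instance {d : ℕ} : CompactSpace (Torus d) := by
  have : Torus d = WithLp 2 (Fin d → UnitAddCircle) := rfl
  exact (PiLp.homeomorph 2 (fun _ : Fin d => UnitAddCircle)).symm.compactSpace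

lemma dist_add_proj_le {d : ℕ} (x y : Torus d) (a b : E d) :
    dist (x + proj a) (y + proj b) ≤ dist x y + ‖a - b‖ := by
  refine (dist_add_add_le _ _ _ _).trans ?_
  gcongr
  rw [dist_eq_norm, ← proj_sub]
  exact norm_proj_le _

/-- A continuous function on the torus is integrable against any probability measure. -/
lemma integrable_torus {d : ℕ} {F : Type*} [NormedAddCommGroup F] {f : Torus d → F}
    (hf : Continuous f) (m : Measure (Torus d)) [IsFiniteMeasure m] : Integrable f m := by
  obtain ⟨C, hC⟩ := (isCompact_range hf).isBounded.exists_norm_le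
  have : StronglyMeasurable f := hf.stronglyMeasurable_of_hasCompactSupport
    (HasCompactSupport.of_compactSpace f)
  exact Integrable.of_bound this.aestronglyMeasurable C
    (Eventually.of_forall fun x => hC _ (mem_range_self x))

/-- Two probability measures integrate a `1`-Lipschitz function to values at most twice the
diameter apart; in particular the supremum defining `d1` is finite. -/
lemma integral_sub_le_of_lipschitz {d : ℕ} {f : Torus d → ℝ} (hf : LipschitzWith 1 f)
    (m m' : PT d) :
    (∫ y, f y ∂(m : Measure (Torus d))) - ∫ y, f y ∂(m' : Measure (Torus d)) ≤ 2 * √d := by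
  have key : ∀ m : PT d, |∫ y, f y ∂(m : Measure (Torus d)) - f 0| ≤ √d := by
    intro m
    have : ∫ y, f y ∂(m : Measure (Torus d)) - f 0 = ∫ y, (f y - f 0) ∂(m : Measure (Torus d)) := by
      rw [integral_sub (integrable_torus hf.continuous _) (integrable_const _)]; simp
    rw [this, ← Real.norm_eq_abs]
    refine (norm_integral_le_of_norm_le_const (C := √d) (Eventually.of_forall fun y => ?_)).trans
      (by simp)
    rw [← dist_eq_norm]
    exact (hf.dist_le_mul y 0).trans (by simpa using dist_torus_le y 0)
  have h1 := abs_le.1 (key m)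
  have h2 := abs_le.1 (key m')
  linarith [h1.2, h2.1]

lemma bddAbove_d1 {d : ℕ} (m m' : PT d) :
    BddAbove (range fun f : {f : Torus d → ℝ // LipschitzWith 1 f} =>
      ((∫ y, f.1 y ∂(m : Measure (Torus d))) - ∫ y, f.1 y ∂(m' : Measure (Torus d)))) :=
  ⟨2 * √d, by rintro _ ⟨f, rfl⟩; exact integral_sub_le_of_lipschitz f.2 m m'⟩

instance {d : ℕ} : Nonempty {f : Torus d → ℝ // LipschitzWith 1 f} :=
  ⟨⟨fun _ => 0, LipschitzWith.const' 0⟩⟩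

lemma integral_sub_le_d1 {d : ℕ} {f : Torus d → ℝ} (hf : LipschitzWith 1 f) (m m' : PT d) :
    (∫ y, f y ∂(m : Measure (Torus d))) - ∫ y, f y ∂(m' : Measure (Torus d)) ≤ d1 m m' :=
  le_ciSup (bddAbove_d1 m m') ⟨f, hf⟩

lemma d1_le {d : ℕ} {m m' : PT d} {c : ℝ} (h : ∀ f : Torus d → ℝ, LipschitzWith 1 f →
    (∫ y, f y ∂(m : Measure (Torus d))) - ∫ y, f y ∂(m' : Measure (Torus d)) ≤ c) : d1 m m' ≤ c :=
  ciSup_le fun f => h f.1 f.2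

lemma d1_nonneg {d : ℕ} (m m' : PT d) : 0 ≤ d1 m m' := by
  simpa using integral_sub_le_d1 (LipschitzWith.const' (0 : ℝ)) m m'

@[simp] lemma d1_self {d : ℕ} (m : PT d) : d1 m m = 0 :=
  le_antisymm (d1_le fun f _ => by simp) (d1_nonneg _ _)

lemma d1_le_two_sqrt {d : ℕ} (m m' : PT d) : d1 m m' ≤ 2 * √d :=
  d1_le fun _ hf => integral_sub_le_of_lipschitz hf m m'

/-- Kantorovich duality bound for functions with an arbitrary Lipschitz constant. -/
lemma integral_sub_le_mul_d1 {d : ℕ} {f : Torus d → ℝ} {K : ℝ} (hK : 0 ≤ K)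
    (hf : ∀ x y, |f x - f y| ≤ K * dist x y) (m m' : PT d) :
    (∫ y, f y ∂(m : Measure (Torus d))) - ∫ y, f y ∂(m' : Measure (Torus d)) ≤ K * d1 m m' := by
  rcases hK.eq_or_lt with rfl | hK'
  · have : f = fun _ => f 0 := by
      ext x; have := hf x 0; simp at this; linarith [sub_eq_zero.1 this]
    rw [this]; simp
  have h1 : LipschitzWith 1 (fun x => K⁻¹ * f x) := LipschitzWith.of_dist_le_mul fun x y => by
    rw [Real.dist_eq, ← mul_sub, abs_mul, abs_of_pos (inv_pos.2 hK'), inv_mul_le_iff₀ hK']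
    simpa using hf x y
  have := integral_sub_le_d1 h1 m m'
  rw [integral_const_mul, integral_const_mul, ← mul_sub, inv_mul_le_iff₀ hK'] at this
  exact this

lemma d1_comm {d : ℕ} (m m' : PT d) : d1 m m' = d1 m' m := by
  have : ∀ m m' : PT d, d1 m m' ≤ d1 m' m := fun m m' => d1_le fun f hf => by
    have h1 : LipschitzWith 1 (fun x => - f x) := hf.neg
    have := integral_sub_le_d1 h1 m' m
    rw [integral_neg, integral_neg] at this
    linarith
  exact le_antisymm (this _ _) (this _ _)

/-- Convergence for `d1` implies weak convergence. -/
lemma tendsto_of_d1 {d : ℕ} {ι : Type*} {l : Filter ι} [l.IsCountablyGenerated]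
    {m : ι → PT d} {m₀ : PT d}
    (h : Tendsto (fun i => d1 (m i) m₀) l (𝓝 0)) : Tendsto m l (𝓝 m₀) := by
  rw [tendsto_iff_forall_lipschitz_integral_tendsto]
  rintro f ⟨C, hC⟩ ⟨K, hK⟩
  have h1 : ∀ x y, |f x - f y| ≤ K * dist x y := fun x y => by
    simpa [Real.dist_eq] using hK.dist_le_mul x y
  have h2 : ∀ i, dist (∫ ω, f ω ∂(m i : Measure (Torus d))) (∫ ω, f ω ∂(m₀ : Measure (Torus d)))
      ≤ K * d1 (m i) m₀ := fun i => by
    rw [Real.dist_eq, abs_le]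
    have a := integral_sub_le_mul_d1 K.2 h1 (m i) m₀
    have b := integral_sub_le_mul_d1 K.2 h1 m₀ (m i)
    rw [d1_comm] at b
    constructor <;> simp only [NNReal.val_eq_coe] at a b <;> linarith
  rw [tendsto_iff_dist_tendsto_zero]
  refine squeeze_zero (fun _ => dist_nonneg) h2 ?_
  simpa using h.const_mul (K : ℝ)

lemma eq_of_d1_eq_zero {d : ℕ} {m m' : PT d} (h : d1 m m' = 0) : m = m' :=
  tendsto_nhds_unique (tendsto_const_nhds (f := (atTop : Filter ℕ)))
    (tendsto_of_d1 (by simp [h]))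

/-- The law of a torus-valued random variable (a Dirac mass if the variable is not measurable). -/
def lawOf {d : ℕ} {Ω : Type*} [MeasurableSpace Ω] (Q : Measure Ω) [IsProbabilityMeasure Q]
    (X : Ω → Torus d) : PT d :=
  open Classical in
  ⟨if AEMeasurable X Q then Q.map X else Measure.dirac 0, by
    split_ifs with h
    · exact Measure.isProbabilityMeasure_map h
    · infer_instance⟩

section lawOf
variable {d : ℕ} {Ω : Type*} [MeasurableSpace Ω] {Q : Measure Ω} [IsProbabilityMeasure Q]

lemma coe_lawOf {X : Ω → Torus d} (hX : AEMeasurable X Q) :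
    (lawOf Q X : Measure (Torus d)) = Q.map X := if_pos hX

lemma integral_lawOf {F : Type*} [NormedAddCommGroup F] [NormedSpace ℝ F] {X : Ω → Torus d}
    (hX : AEMeasurable X Q) {f : Torus d → F} (hf : Continuous f) :
    ∫ y, f y ∂(lawOf Q X : Measure (Torus d)) = ∫ ω, f (X ω) ∂Q := by
  have : StronglyMeasurable f := hf.stronglyMeasurable_of_hasCompactSupport
    (HasCompactSupport.of_compactSpace f)
  rw [coe_lawOf hX]
  exact integral_map hX this.aestronglyMeasurable

lemma integrable_comp_torus {F : Type*} [NormedAddCommGroup F] {X : Ω → Torus d}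
    (hX : AEMeasurable X Q) {f : Torus d → F} (hf : Continuous f) :
    Integrable (fun ω => f (X ω)) Q := by
  have h := integrable_torus hf (Q.map X)
  exact h.comp_aemeasurable hX

lemma d1_lawOf_le_integral {X Y : Ω → Torus d} (hX : AEMeasurable X Q) (hY : AEMeasurable Y Q) :
    d1 (lawOf Q X) (lawOf Q Y) ≤ ∫ ω, dist (X ω) (Y ω) ∂Q := by
  refine d1_le fun f hf => ?_
  rw [integral_lawOf hX hf.continuous, integral_lawOf hY hf.continuous,
    ← integral_sub (integrable_comp_torus hX hf.continuous)
      (integrable_comp_torus hY hf.continuous)]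
  refine integral_mono ((integrable_comp_torus hX hf.continuous).sub
    (integrable_comp_torus hY hf.continuous)) ?_ fun ω => ?_
  · refine Integrable.of_bound (C := √d) ?_ (Eventually.of_forall fun ω => ?_)
    · exact (hX.dist hY).aestronglyMeasurable
    · rw [Real.norm_of_nonneg dist_nonneg]; exact dist_torus_le _ _
  · have := hf.dist_le_mul (X ω) (Y ω)
    rw [Real.dist_eq] at this
    simpa using (le_abs_self _).trans this

lemma d1_lawOf_le {X Y : Ω → Torus d} (hX : AEMeasurable X Q) (hY : AEMeasurable Y Q) {c : ℝ}
    (h : ∀ᵐ ω ∂Q, dist (X ω) (Y ω) ≤ c) : d1 (lawOf Q X) (lawOf Q Y) ≤ c := by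
  refine (d1_lawOf_le_integral hX hY).trans ?_
  have : ∫ ω, dist (X ω) (Y ω) ∂Q ≤ ∫ _ω, c ∂Q := by
    refine integral_mono_ae ?_ (integrable_const _) h
    refine Integrable.of_bound (C := √d) ?_ (Eventually.of_forall fun ω => ?_)
    · exact (hX.dist hY).aestronglyMeasurable
    · rw [Real.norm_of_nonneg dist_nonneg]; exact dist_torus_le _ _
  simpa using this

end lawOf

/-! ### Smooth periodic functions -/

/-- `f : ℝ^d → F` is the lift of a function on the torus. -/
def IsPeriodic {d : ℕ} {F : Type*} (f : E d → F) : Prop := ∀ a b, proj a = proj b → f a = f b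

/-- `f : ℝ^d → F` is the lift of a smooth function on the torus. -/
structure SmoothPer {d : ℕ} {F : Type*} [NormedAddCommGroup F] [NormedSpace ℝ F]
    (f : E d → F) : Prop where
  contDiff : ContDiff ℝ ((⊤ : ℕ∞) : WithTop ℕ∞) f
  periodic : IsPeriodic f

section SmoothPer
variable {d : ℕ} {F : Type*} [NormedAddCommGroup F] [NormedSpace ℝ F] {f : E d → F}

omit [NormedSpace ℝ F] in
lemma IsPeriodic.exists_bound (hf : IsPeriodic f) (hc : Continuous f) :
    ∃ C, 0 ≤ C ∧ ∀ y, ‖f y‖ ≤ C := by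
  obtain ⟨C, hC⟩ := ((isCompact_closedBall (0 : E d) (√d)).image hc).isBounded.exists_norm_le
  have h : ∀ y, ‖f y‖ ≤ C := fun y => by
    obtain ⟨z, hz, hz'⟩ := exists_proj_eq (proj y)
    rw [← hf z y hz]
    exact hC _ (mem_image_of_mem _ (by simpa [hz'] using norm_torus_le (proj y)))
  exact ⟨C, (norm_nonneg _).trans (h 0), h⟩

lemma SmoothPer.continuous (hf : SmoothPer f) : Continuous f := hf.contDiff.continuous

lemma SmoothPer.differentiable (hf : SmoothPer f) : Differentiable ℝ f :=
  hf.contDiff.differentiable (by simp)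

lemma SmoothPer.exists_bound (hf : SmoothPer f) : ∃ C, 0 ≤ C ∧ ∀ y, ‖f y‖ ≤ C :=
  hf.periodic.exists_bound hf.continuous

lemma SmoothPer.fderiv (hf : SmoothPer f) : SmoothPer (fderiv ℝ f) where
  contDiff := (contDiff_infty_iff_fderiv.1 hf.contDiff).2
  periodic a b hab := by
    have hk : ∀ y, f (y + (b - a)) = f y := fun y => hf.periodic _ _ (by
      rw [proj_add, proj_sub, hab]; simp)
    have h := fderiv_comp_add_right (𝕜 := ℝ) (f := f) (x := a) (b - a)
    rw [funext hk] at h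
    simpa using h

lemma IsSmooth.smoothPer {φ : Torus d → ℝ} (hφ : IsSmooth φ) : SmoothPer (fun y => φ (proj y)) :=
  ⟨hφ, fun a b hab => by simp [hab]⟩

lemma SmoothPer.hasFDerivAt (hf : SmoothPer f) (y : E d) : HasFDerivAt f (_root_.fderiv ℝ f y) y :=
  (hf.differentiable y).hasFDerivAt

lemma norm_sub_le_of_fderiv_le {C : ℝ} (hf : Differentiable ℝ f) (hC : ∀ y, ‖fderiv ℝ f y‖ ≤ C)
    (x y : E d) : ‖f y - f x‖ ≤ C * ‖y - x‖ :=
  Convex.norm_image_sub_le_of_norm_hasFDerivWithin_le (s := univ) (f' := fderiv ℝ f)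
    (fun x _ => (hf x).hasFDerivAt.hasFDerivWithinAt) (fun x _ => hC x) convex_univ
    (mem_univ _) (mem_univ _)

lemma SmoothPer.exists_lipschitz (hf : SmoothPer f) :
    ∃ C, 0 ≤ C ∧ ∀ x y, ‖f y - f x‖ ≤ C * ‖y - x‖ := by
  obtain ⟨C, h0, hC⟩ := hf.fderiv.exists_bound
  exact ⟨C, h0, norm_sub_le_of_fderiv_le hf.differentiable hC⟩

/-- First order Taylor estimate. -/
lemma norm_taylor_one_le {C : ℝ} (hf : Differentiable ℝ f)
    (hC : ∀ x y, ‖fderiv ℝ f y - fderiv ℝ f x‖ ≤ C * ‖y - x‖) (hC0 : 0 ≤ C) (y z : E d) :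
    ‖f (y + z) - f y - fderiv ℝ f y z‖ ≤ C * ‖z‖ ^ 2 := by
  have h := norm_image_sub_le_of_norm_deriv_le_segment_01' (E := F)
    (f := fun t : ℝ => f (y + t • z) - t • fderiv ℝ f y z)
    (f' := fun t => fderiv ℝ f (y + t • z) z - fderiv ℝ f y z) (C := C * ‖z‖ ^ 2) ?_ ?_
  · have e : f (y + z) - f y - fderiv ℝ f y z
        = f (y + (1 : ℝ) • z) - (1 : ℝ) • fderiv ℝ f y z
          - (f (y + (0 : ℝ) • z) - (0 : ℝ) • fderiv ℝ f y z) := by simp; abel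
    rw [e]; exact h
  · intro t _
    have h1 : HasDerivAt (fun t : ℝ => y + t • z) z t := by
      simpa using ((hasDerivAt_id t).smul_const z).const_add y
    have h2 := (hf (y + t • z)).hasFDerivAt.comp_hasDerivAt t h1
    have h3 : HasDerivAt (fun t : ℝ => t • fderiv ℝ f y z) (fderiv ℝ f y z) t := by
      simpa using (hasDerivAt_id t).smul_const (fderiv ℝ f y z)
    exact (h2.sub h3).hasDerivWithinAt
  · intro t ht
    rw [← sub_apply]
    refine (ContinuousLinearMap.le_opNorm _ _).trans ?_
    have := hC y (y + t • z)
    rw [add_sub_cancel_left, norm_smul, Real.norm_of_nonneg ht.1] at this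
    calc _ ≤ (C * (t * ‖z‖)) * ‖z‖ := by gcongr
      _ = t * (C * ‖z‖ ^ 2) := by ring
      _ ≤ 1 * (C * ‖z‖ ^ 2) := by gcongr; exact ht.2.le
      _ = _ := one_mul _

/-- Second order Taylor estimate. -/
lemma norm_taylor_two_le {C : ℝ} (hf : SmoothPer f) (hC0 : 0 ≤ C)
    (hC : ∀ x y, ‖fderiv ℝ (fderiv ℝ f) y - fderiv ℝ (fderiv ℝ f) x‖ ≤ C * ‖y - x‖) (y z : E d) :
    ‖f (y + z) - f y - fderiv ℝ f y z - (1 / 2 : ℝ) • fderiv ℝ (fderiv ℝ f) y z z‖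
      ≤ C * ‖z‖ ^ 3 := by
  have hk : ∀ w, ‖fderiv ℝ f (y + w) - fderiv ℝ f y - fderiv ℝ (fderiv ℝ f) y w‖ ≤ C * ‖w‖ ^ 2 :=
    fun w => norm_taylor_one_le hf.fderiv.differentiable hC hC0 y w
  have h := norm_image_sub_le_of_norm_deriv_le_segment_01' (E := F)
    (f := fun t : ℝ => f (y + t • z) - t • fderiv ℝ f y z
      - (t ^ 2 / 2) • fderiv ℝ (fderiv ℝ f) y z z)
    (f' := fun t => fderiv ℝ f (y + t • z) z - fderiv ℝ f y z - t • fderiv ℝ (fderiv ℝ f) y z z)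
    (C := C * ‖z‖ ^ 3) ?_ ?_
  · have e : f (y + z) - f y - fderiv ℝ f y z - (1 / 2 : ℝ) • fderiv ℝ (fderiv ℝ f) y z z
        = f (y + (1 : ℝ) • z) - (1 : ℝ) • fderiv ℝ f y z
            - ((1 : ℝ) ^ 2 / 2) • fderiv ℝ (fderiv ℝ f) y z z
          - (f (y + (0 : ℝ) • z) - (0 : ℝ) • fderiv ℝ f y z
            - ((0 : ℝ) ^ 2 / 2) • fderiv ℝ (fderiv ℝ f) y z z) := by simp; abel
    rw [e]; exact h
  · intro t _
    have h1 : HasDerivAt (fun t : ℝ => y + t • z) z t := by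
      simpa using ((hasDerivAt_id t).smul_const z).const_add y
    have h2 := (hf.hasFDerivAt (y + t • z)).comp_hasDerivAt t h1
    have h3 : HasDerivAt (fun t : ℝ => t • fderiv ℝ f y z) (fderiv ℝ f y z) t := by
      simpa using (hasDerivAt_id t).smul_const (fderiv ℝ f y z)
    have h4 : HasDerivAt (fun t : ℝ => (t ^ 2 / 2) • fderiv ℝ (fderiv ℝ f) y z z)
        (t • fderiv ℝ (fderiv ℝ f) y z z) t := by
      have : HasDerivAt (fun t : ℝ => t ^ 2 / 2) t t := by
        simpa using (hasDerivAt_pow 2 t).div_const 2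
      exact this.smul_const _
    exact ((h2.sub h3).sub h4).hasDerivWithinAt
  · intro t ht
    have e : fderiv ℝ f (y + t • z) z - fderiv ℝ f y z - t • fderiv ℝ (fderiv ℝ f) y z z
        = (fderiv ℝ f (y + t • z) - fderiv ℝ f y - fderiv ℝ (fderiv ℝ f) y (t • z)) z := by
      simp
    rw [e]
    refine (ContinuousLinearMap.le_opNorm _ _).trans ?_
    have := hk (t • z)
    rw [norm_smul, Real.norm_of_nonneg ht.1] at this
    have ht2 : t ^ 2 ≤ 1 := pow_le_one₀ ht.1 ht.2.le
    calc _ ≤ (C * (t * ‖z‖) ^ 2) * ‖z‖ := by gcongr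
      _ = t ^ 2 * (C * ‖z‖ ^ 3) := by ring
      _ ≤ 1 * (C * ‖z‖ ^ 3) := by gcongr
      _ = _ := one_mul _

end SmoothPer

/-! ### Gaussian averages -/

/-- The trace of a bilinear form on `ℝ^d`. -/
def trE {d : ℕ} (B : E d →L[ℝ] E d →L[ℝ] ℝ) : ℝ :=
  ∑ i, B (EuclideanSpace.single i 1) (EuclideanSpace.single i 1)

lemma abs_trE_le {d : ℕ} (B : E d →L[ℝ] E d →L[ℝ] ℝ) : |trE B| ≤ d * ‖B‖ := by
  refine (Finset.abs_sum_le_sum_abs _ _).trans ?_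
  calc _ ≤ ∑ _i : Fin d, ‖B‖ := Finset.sum_le_sum fun i _ => by
        have := B.le_opNorm₂ (EuclideanSpace.single i 1) (EuclideanSpace.single i 1)
        simpa using this
    _ = _ := by simp

lemma trE_sub {d : ℕ} (A B : E d →L[ℝ] E d →L[ℝ] ℝ) : trE (A - B) = trE A - trE B := by
  simp [trE]

lemma integrable_norm_pow_stdGaussian {d : ℕ} (n : ℕ) :
    Integrable (fun z : E d => ‖z‖ ^ n) (stdGaussian (E d)) := by
  have := (IsGaussian.memLp_id (stdGaussian (E d)) n (by simp)).integrable_norm_pow'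
  simpa using this

/-- The covariance of a standard normal vector is the identity. -/
lemma integral_apply_apply_stdGaussian {d : ℕ} (B : E d →L[ℝ] E d →L[ℝ] ℝ) :
    ∫ z, B z z ∂(stdGaussian (E d)) = trE B := by
  have hexp : ∀ z : E d, B z z = ∑ i, ∑ j, (z i * z j) *
      B (EuclideanSpace.single i 1) (EuclideanSpace.single j 1) := by
    intro z
    have hz : z = ∑ i, z i • EuclideanSpace.single i (1 : ℝ) := by
      have := (EuclideanSpace.basisFun (Fin d) ℝ).sum_repr z
      simpa using this.symm
    conv_lhs => rw [hz]
    simp only [map_sum, sum_apply, map_smul, smul_apply,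
      smul_eq_mul, Finset.mul_sum]
    rw [Finset.sum_comm]
    exact Finset.sum_congr rfl fun i _ => Finset.sum_congr rfl fun j _ => by ring
  have h2 : MemLp id 2 (stdGaussian (E d)) := IsGaussian.memLp_id _ 2 (by simp)
  have hij : ∀ i j, ∫ z : E d, z i * z j ∂(stdGaussian (E d)) = if i = j then 1 else 0 := by
    intro i j
    have := covarianceBilin_apply h2 (EuclideanSpace.single i (1 : ℝ)) (EuclideanSpace.single j 1)
    rw [covarianceBilin_stdGaussian] at this
    simp [EuclideanSpace.inner_single_left] at this
    rw [← this, innerSL_apply_apply]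
    simp [EuclideanSpace.inner_single_left]
  have hint : ∀ i j, Integrable (fun z : E d => z i * z j) (stdGaussian (E d)) := by
    intro i j
    refine (integrable_norm_pow_stdGaussian 2).mono' (by fun_prop)
      (Eventually.of_forall fun z => ?_)
    rw [norm_mul, sq]
    exact mul_le_mul (PiLp.norm_apply_le z i) (PiLp.norm_apply_le z j) (norm_nonneg _)
      (norm_nonneg _)
  simp_rw [hexp]
  rw [integral_finsetSum _ fun i _ => integrable_finsetSum _ fun j _ => (hint i j).mul_const _]
  refine Finset.sum_congr rfl fun i _ => ?_
  rw [integral_finsetSum _ fun j _ => (hint i j).mul_const _]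
  simp [integral_mul_const, hij]

/-- The Gaussian average `y ↦ 𝔼 f(y + a Z)`, with `Z` a standard normal vector. -/
def gaussAvg {d : ℕ} {F : Type*} [NormedAddCommGroup F] [NormedSpace ℝ F] (a : ℝ) (f : E d → F)
    (y : E d) : F := ∫ z, f (y + a • z) ∂(stdGaussian (E d))

section gaussAvg
variable {d : ℕ} {F : Type*} [NormedAddCommGroup F] [NormedSpace ℝ F] {f : E d → F}

omit [NormedSpace ℝ F] in
lemma integrable_gaussAvg (hf : Continuous f) {C : ℝ} (hC : ∀ y, ‖f y‖ ≤ C) (a : ℝ) (y : E d) :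
    Integrable (fun z => f (y + a • z)) (stdGaussian (E d)) :=
  Integrable.of_bound (by
    have : Continuous fun z => f (y + a • z) := by fun_prop
    exact this.aestronglyMeasurable) C (Eventually.of_forall fun _ => hC _)

lemma IsPeriodic.gaussAvg (hf : IsPeriodic f) (a : ℝ) : IsPeriodic (gaussAvg a f) :=
  fun x y hxy => by
    unfold MFG.gaussAvg
    congr 1; ext z
    exact hf _ _ (by rw [proj_add, proj_add, hxy])

lemma SmoothPer.hasFDerivAt_gaussAvg (hf : SmoothPer f) (a : ℝ) (y : E d) :
    HasFDerivAt (gaussAvg a f) (gaussAvg a (_root_.fderiv ℝ f) y) y := by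
  obtain ⟨C, -, hC⟩ := hf.exists_bound
  obtain ⟨C', -, hC'⟩ := hf.fderiv.exists_bound
  refine hasFDerivAt_integral_of_dominated_of_fderiv_le (s := univ) (bound := fun _ => C')
    (F' := fun y z => _root_.fderiv ℝ f (y + a • z)) univ_mem
    (Eventually.of_forall fun y => (integrable_gaussAvg hf.continuous hC a y).aestronglyMeasurable)
    (integrable_gaussAvg hf.continuous hC a y)
    (integrable_gaussAvg hf.fderiv.continuous hC' a y).aestronglyMeasurable
    (Eventually.of_forall fun z y _ => hC' _) (integrable_const _)
    (Eventually.of_forall fun z y _ => ?_)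
  have := (hf.hasFDerivAt (y + a • z)).comp y ((hasFDerivAt_id y).add_const (a • z))
  simpa [Function.comp_def] using this

lemma SmoothPer.fderiv_gaussAvg (hf : SmoothPer f) (a : ℝ) :
    _root_.fderiv ℝ (MFG.gaussAvg a f) = MFG.gaussAvg a (_root_.fderiv ℝ f) :=
  funext fun y => (hf.hasFDerivAt_gaussAvg a y).fderiv

end gaussAvg

/-- The target space is quantified inside the induction because the step replaces `f : E d → F` by
its derivative, which has values in `E d →L[ℝ] F`. -/
lemma contDiff_gaussAvg {d : ℕ} (n : ℕ) : ∀ {F : Type} [NormedAddCommGroup F] [NormedSpace ℝ F]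
    {f : E d → F}, SmoothPer f → ∀ a : ℝ, ContDiff ℝ n (gaussAvg a f) := by
  induction n with
  | zero =>
    intro F _ _ f hf a
    exact contDiff_zero.2
      (continuous_iff_continuousAt.2 fun y => (hf.hasFDerivAt_gaussAvg a y).continuousAt)
  | succ n ih =>
    intro F _ _ f hf a
    exact_mod_cast contDiff_succ_iff_hasFDerivAt.2
      ⟨_, ih hf.fderiv a, fun y => hf.hasFDerivAt_gaussAvg a y⟩

lemma SmoothPer.gaussAvg {d : ℕ} {F : Type} [NormedAddCommGroup F] [NormedSpace ℝ F]
    {f : E d → F} (hf : SmoothPer f) (a : ℝ) : SmoothPer (gaussAvg a f) :=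
  ⟨contDiff_infty.2 fun n => contDiff_gaussAvg n hf a, hf.periodic.gaussAvg a⟩

lemma lipschitz_gaussAvg {d : ℕ} {f : E d → ℝ} (hf : LipschitzWith 1 f) {C : ℝ}
    (hC : ∀ y, ‖f y‖ ≤ C) (a : ℝ) : LipschitzWith 1 (gaussAvg a f) :=
  LipschitzWith.of_dist_le_mul fun x y => by
    rw [dist_eq_norm, gaussAvg, gaussAvg, ← integral_sub (integrable_gaussAvg hf.continuous hC a x)
      (integrable_gaussAvg hf.continuous hC a y)]
    refine (norm_integral_le_of_norm_le_const (C := ‖x - y‖)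
      (Eventually.of_forall fun z => ?_)).trans (by simp [dist_eq_norm])
    have := hf.dist_le_mul (x + a • z) (y + a • z)
    simpa [dist_eq_norm] using this

/-- The moment of order `n` of the norm of a standard normal vector in `ℝ^d`. -/
def gaussMoment (d n : ℕ) : ℝ := ∫ z : E d, ‖z‖ ^ n ∂(stdGaussian (E d))

lemma gaussMoment_nonneg (d n : ℕ) : 0 ≤ gaussMoment d n :=
  integral_nonneg fun _ => by positivity

lemma norm_gaussAvg_sub_le {d : ℕ} {F : Type*} [NormedAddCommGroup F] [NormedSpace ℝ F]
    {f : E d → F} (hf : Continuous f) {C K : ℝ}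
    (hC : ∀ y, ‖f y‖ ≤ C) (hK : ∀ x y, ‖f x - f y‖ ≤ K * ‖x - y‖) (a b : ℝ) (y : E d) :
    ‖gaussAvg a f y - gaussAvg b f y‖ ≤ K * |a - b| * gaussMoment d 1 := by
  rw [gaussAvg, gaussAvg, ← integral_sub (integrable_gaussAvg hf hC a y)
    (integrable_gaussAvg hf hC b y), gaussMoment, ← integral_const_mul]
  refine norm_integral_le_of_norm_le ((integrable_norm_pow_stdGaussian 1).const_mul _)
    (Eventually.of_forall fun z => ?_)
  refine (hK _ _).trans (le_of_eq ?_)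
  rw [add_sub_add_left_eq_sub, ← sub_smul, norm_smul, Real.norm_eq_abs]
  ring

/-- The generator of Brownian motion: `𝔼 f(y + aZ) = f(y) + (a²/2) Δf(y) + O(a³)`. -/
lemma abs_gaussAvg_sub_le {d : ℕ} {f : E d → ℝ} (hf : SmoothPer f) {C : ℝ} (hC0 : 0 ≤ C)
    (hC : ∀ x y, ‖fderiv ℝ (fderiv ℝ f) y - fderiv ℝ (fderiv ℝ f) x‖ ≤ C * ‖y - x‖) {a : ℝ}
    (ha : 0 ≤ a) (y : E d) :
    |gaussAvg a f y - f y - a ^ 2 / 2 * trE (fderiv ℝ (fderiv ℝ f) y)|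
      ≤ C * a ^ 3 * gaussMoment d 3 := by
  obtain ⟨C₁, -, hC₁⟩ := hf.exists_bound
  have i1 := integrable_gaussAvg hf.continuous hC₁ a y
  have i2 : Integrable (fun z : E d => fderiv ℝ f y (a • z)) (stdGaussian (E d)) :=
    ContinuousLinearMap.integrable_comp _ ((IsGaussian.integrable_id).smul a)
  have i3 : Integrable (fun z : E d => fderiv ℝ (fderiv ℝ f) y (a • z) (a • z))
      (stdGaussian (E d)) := by
    refine ((integrable_norm_pow_stdGaussian 2).const_mul
      (‖fderiv ℝ (fderiv ℝ f) y‖ * a ^ 2)).mono' (by fun_prop) (Eventually.of_forall fun z => ?_)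
    refine (ContinuousLinearMap.le_opNorm₂ _ _ _).trans (le_of_eq ?_)
    rw [norm_smul, Real.norm_of_nonneg ha]; ring
  have e : gaussAvg a f y - f y - a ^ 2 / 2 * trE (fderiv ℝ (fderiv ℝ f) y)
      = ∫ z, (f (y + a • z) - f y - fderiv ℝ f y (a • z)
          - (1 / 2 : ℝ) • fderiv ℝ (fderiv ℝ f) y (a • z) (a • z)) ∂(stdGaussian (E d)) := by
    have i4 : Integrable (fun z : E d => f (y + a • z) - f y) (stdGaussian (E d)) :=
      i1.sub (integrable_const _)
    have i5 : Integrable (fun z : E d => f (y + a • z) - f y - fderiv ℝ f y (a • z))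
      (stdGaussian (E d)) := i4.sub i2
    have i6 : Integrable (fun z : E d => (1 / 2 : ℝ) • fderiv ℝ (fderiv ℝ f) y (a • z) (a • z))
      (stdGaussian (E d)) := i3.smul (1 / 2 : ℝ)
    rw [integral_sub i5 i6, integral_sub i4 i2, integral_sub i1 (integrable_const _),
      integral_smul]
    have h1 : ∫ z : E d, fderiv ℝ f y (a • z) ∂(stdGaussian (E d)) = 0 := by
      simp_rw [map_smul]
      rw [integral_smul, integral_strongDual_stdGaussian, smul_zero]
    have h2 : ∫ z : E d, fderiv ℝ (fderiv ℝ f) y (a • z) (a • z) ∂(stdGaussian (E d))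
        = a ^ 2 * trE (fderiv ℝ (fderiv ℝ f) y) := by
      rw [← integral_apply_apply_stdGaussian, ← integral_const_mul]
      congr 1; ext z; simp; ring
    rw [h1, h2]
    simp [gaussAvg]; ring
  rw [e, ← Real.norm_eq_abs, gaussMoment, ← integral_const_mul]
  refine norm_integral_le_of_norm_le ((integrable_norm_pow_stdGaussian 3).const_mul _)
    (Eventually.of_forall fun z => ?_)
  refine (norm_taylor_two_le hf hC0 hC y (a • z)).trans (le_of_eq ?_)
  rw [norm_smul, Real.norm_of_nonneg ha]; ring

/-- The semigroup property of Gaussian averages. -/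
lemma gaussAvg_gaussAvg {d : ℕ} {F : Type*} [NormedAddCommGroup F] [NormedSpace ℝ F]
    {f : E d → F} (hf : Continuous f) {C : ℝ}
    (hC : ∀ y, ‖f y‖ ≤ C) {a b c : ℝ} (h : c ^ 2 = a ^ 2 + b ^ 2) :
    gaussAvg a (gaussAvg b f) = gaussAvg c f := by
  -- independent centred normal vectors of scales `a` and `b` have a sum of scale `c`
  have hmap : ((stdGaussian (E d)).map (fun z => a • z)) ∗
      ((stdGaussian (E d)).map (fun z => b • z)) = (stdGaussian (E d)).map (fun z => c • z) := by
    have : ∀ r : ℝ, IsProbabilityMeasure ((stdGaussian (E d)).map (fun z => r • z)) := fun r =>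
      Measure.isProbabilityMeasure_map (by fun_prop)
    refine Measure.ext_of_charFun (funext fun t => ?_)
    rw [charFun_conv, charFun_map_smul, charFun_map_smul, charFun_map_smul, charFun_stdGaussian,
      charFun_stdGaussian, charFun_stdGaussian, ← Complex.exp_add]
    congr 1
    simp only [norm_smul]
    push_cast
    have h' : ∀ r : ℝ, ((‖r‖ : ℝ) : ℂ) ^ 2 = (r : ℂ) ^ 2 := fun r => by
      rw [← Complex.ofReal_pow, ← Complex.ofReal_pow]; simp
    have h'' : (c : ℂ) ^ 2 = (a : ℂ) ^ 2 + (b : ℂ) ^ 2 := by exact_mod_cast h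
    rw [mul_pow, mul_pow, mul_pow, h', h', h', h'']; ring
  ext y
  have hsm : ∀ r : ℝ, AEMeasurable (fun z : E d => r • z) (stdGaussian (E d)) :=
    fun r => by fun_prop
  have hcont : Continuous fun w => f (y + w) := by fun_prop
  have e1 : gaussAvg c f y = ∫ w, f (y + w) ∂((stdGaussian (E d)).map (fun z => c • z)) :=
    (integral_map (hsm c) hcont.aestronglyMeasurable).symm
  have : ∀ r : ℝ, IsProbabilityMeasure ((stdGaussian (E d)).map (fun z => r • z)) := fun r =>
      Measure.isProbabilityMeasure_map (by fun_prop)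
  rw [e1, ← hmap, integral_conv (Integrable.of_bound hcont.aestronglyMeasurable C
    (Eventually.of_forall fun _ => hC _)), integral_map (hsm a)]
  · unfold gaussAvg
    congr 1; ext z
    rw [integral_map (hsm b)]
    · simp [add_assoc]
    · have : Continuous fun w => f (y + (a • z + w)) := by fun_prop
      exact this.aestronglyMeasurable
  · have : StronglyMeasurable (fun w : E d => ∫ w', f (y + (w + w'))
        ∂((stdGaussian (E d)).map (fun z => b • z))) := by
      refine StronglyMeasurable.integral_prod_right'
        (f := fun p : E d × E d => f (y + (p.1 + p.2))) ?_
      have : Continuous fun p : E d × E d => f (y + (p.1 + p.2)) := by fun_prop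
      exact this.stronglyMeasurable
    exact this.aestronglyMeasurable

/-! ### Gaussian integration by parts and the smoothing estimate -/

lemma hasDerivAt_gaussianPDFReal (t : ℝ) :
    HasDerivAt (gaussianPDFReal 0 1) (-t * gaussianPDFReal 0 1 t) t := by
  have h1 : HasDerivAt (fun x : ℝ => -x ^ 2 / 2) (-t) t := by
    have := ((hasDerivAt_pow 2 t).neg).div_const 2
    refine this.congr_deriv ?_
    simp
    ring
  have h2 := (h1.exp).const_mul ((√(2 * Real.pi))⁻¹)
  have e : gaussianPDFReal 0 1 = fun x : ℝ => (√(2 * Real.pi))⁻¹ * Real.exp (-x ^ 2 / 2) := by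
    rw [gaussianPDFReal_def]; simp
  rw [e]
  refine h2.congr_deriv ?_
  ring

/-- Stein's identity on the line. -/
lemma integral_deriv_gaussianReal {g g' : ℝ → ℝ} (hg : ∀ t, HasDerivAt g (g' t) t)
    (hg' : Continuous g') {C C' : ℝ} (hC : ∀ t, |g t| ≤ C) (hC' : ∀ t, |g' t| ≤ C') :
    ∫ t, g' t ∂(gaussianReal 0 1) = ∫ t, g t * t ∂(gaussianReal 0 1) := by
  have hgc : Continuous g := continuous_iff_continuousAt.2 fun t => (hg t).continuousAt
  have hpi := integrable_gaussianPDFReal 0 1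
  have htp : Integrable (fun t : ℝ => -t * gaussianPDFReal 0 1 t) := by
    have h := (integrable_mul_exp_neg_mul_sq (b := 1 / 2) (by norm_num)).const_mul
      (-(√(2 * Real.pi * ((1 : ℝ≥0) : ℝ)))⁻¹)
    refine h.congr (Eventually.of_forall fun t => ?_)
    simp only [gaussianPDFReal]
    have : -(t - 0) ^ 2 / (2 * ((1 : ℝ≥0) : ℝ)) = -(1 / 2) * t ^ 2 := by simp; ring
    rw [this]; ring
  have h := integral_mul_deriv_eq_deriv_mul_of_integrable (u := gaussianPDFReal 0 1) (v := g)
    (u' := fun t => -t * gaussianPDFReal 0 1 t) (v' := g')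
    (fun t _ => hasDerivAt_gaussianPDFReal t) (fun t _ => hg t)
    (hpi.mul_bdd hg'.aestronglyMeasurable (Eventually.of_forall hC'))
    (htp.mul_bdd hgc.aestronglyMeasurable (Eventually.of_forall hC))
    (hpi.mul_bdd hgc.aestronglyMeasurable (Eventually.of_forall hC))
  rw [integral_gaussianReal_eq_integral_smul one_ne_zero,
    integral_gaussianReal_eq_integral_smul one_ne_zero]
  simp only [smul_eq_mul]
  rw [h, ← integral_neg]
  congr 1; ext t; ring

/-- Stein's identity in `ℝ^d`. -/
lemma integral_fderiv_stdGaussian {d : ℕ} {g : E d → ℝ} (hg : ContDiff ℝ 1 g) {C C' : ℝ}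
    (hC : ∀ z, |g z| ≤ C) (hC' : ∀ z, ‖fderiv ℝ g z‖ ≤ C') (i : Fin d) :
    ∫ z, fderiv ℝ g z (EuclideanSpace.single i 1) ∂(stdGaussian (E d))
      = ∫ z, g z * z i ∂(stdGaussian (E d)) := by
  -- `d` is positive, so that the `i`-th coordinate can be split off and integrated first
  obtain ⟨n, rfl⟩ : ∃ n, d = n + 1 := ⟨d - 1, by have := i.pos; omega⟩
  have hgd : Continuous (fderiv ℝ g) := hg.continuous_fderiv one_ne_zero
  have hc1 : Continuous fun z => fderiv ℝ g z (EuclideanSpace.single i 1) := by fun_prop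
  have hc2 : Continuous fun z : E (n + 1) => g z * z i := by have := hg.continuous; fun_prop
  have hb1 : ∀ z, |fderiv ℝ g z (EuclideanSpace.single i 1)| ≤ C' := fun z => by
    have := (fderiv ℝ g z).le_opNorm (EuclideanSpace.single i 1)
    simp only [PiLp.norm_single, norm_one, mul_one] at this
    exact this.trans (hC' z)
  have hm : AEMeasurable (WithLp.toLp 2 : (Fin (n + 1) → ℝ) → E (n + 1))
    (Measure.pi fun _ => gaussianReal 0 1) := by fun_prop
  have hI2 : Integrable (fun z : E (n + 1) => g z * z i) (stdGaussian (E (n + 1))) := by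
    refine ((integrable_norm_pow_stdGaussian 1).const_mul C).mono' hc2.aestronglyMeasurable
      (Eventually.of_forall fun z => ?_)
    rw [norm_mul, pow_one]
    exact mul_le_mul (hC z) (PiLp.norm_apply_le z i) (norm_nonneg _) ((abs_nonneg _).trans (hC z))
  have hmp := (measurePreserving_piFinSuccAbove (fun _ : Fin (n + 1) => gaussianReal 0 1) i).symm
  have key : ∀ h : E (n + 1) → ℝ, Continuous h → Integrable h (stdGaussian (E (n + 1))) →
      ∫ z, h z ∂(stdGaussian (E (n + 1))) = ∫ r, ∫ t, h (WithLp.toLp 2 (i.insertNth 0 r) +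
        t • EuclideanSpace.single i (1 : ℝ)) ∂(gaussianReal 0 1)
        ∂(Measure.pi fun _ : Fin n => gaussianReal 0 1) := by
    intro h hh hi
    rw [← map_pi_eq_stdGaussian] at hi ⊢
    have hi' := hi.comp_aemeasurable hm
    rw [integral_map hm hh.aestronglyMeasurable, ← hmp.integral_comp
      (MeasurableEquiv.measurableEmbedding _), integral_prod_symm]
    · refine integral_congr_ae (Eventually.of_forall fun r => integral_congr_ae
        (Eventually.of_forall fun t => ?_))
      refine congrArg h ?_
      ext j
      refine Fin.succAboveCases i ?_ (fun k => ?_) j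
      · simp [MeasurableEquiv.piFinSuccAbove, Fin.insertNthEquiv]
      · simp [MeasurableEquiv.piFinSuccAbove, Fin.insertNthEquiv]
    · exact (hmp.integrable_comp_emb (MeasurableEquiv.measurableEmbedding _)).2 hi'
  rw [key _ hc1 (Integrable.of_bound hc1.aestronglyMeasurable C' (Eventually.of_forall hb1)),
    key _ hc2 hI2]
  refine integral_congr_ae (Eventually.of_forall fun r => ?_)
  set w : E (n + 1) := WithLp.toLp 2 (i.insertNth 0 r)
  have hline : ∀ t : ℝ, HasDerivAt (fun t : ℝ => w + t • EuclideanSpace.single i (1 : ℝ))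
      (EuclideanSpace.single i (1 : ℝ)) t := fun t => by
    simpa using ((hasDerivAt_id t).smul_const (EuclideanSpace.single i (1 : ℝ))).const_add w
  have h1 := integral_deriv_gaussianReal
    (g := fun t => g (w + t • EuclideanSpace.single i (1 : ℝ)))
    (g' := fun t => fderiv ℝ g (w + t • EuclideanSpace.single i (1 : ℝ))
      (EuclideanSpace.single i 1))
    (fun t => ((hg.differentiable one_ne_zero _).hasFDerivAt.comp_hasDerivAt t (hline t)))
    (by fun_prop) (fun t => hC _) (fun t => hb1 _)
  simp only at h1 ⊢
  rw [h1]
  congr 1; ext t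
  simp [w]

lemma opNorm_le_sum_single {d : ℕ} (L : E d →L[ℝ] ℝ) :
    ‖L‖ ≤ ∑ i, |L (EuclideanSpace.single i 1)| := by
  refine L.opNorm_le_bound (Finset.sum_nonneg fun _ _ => abs_nonneg _) fun z => ?_
  have hz : z = ∑ i, z i • EuclideanSpace.single i (1 : ℝ) := by
    have := (EuclideanSpace.basisFun (Fin d) ℝ).sum_repr z
    simpa using this.symm
  conv_lhs => rw [hz]
  rw [map_sum, Finset.sum_mul]
  refine (norm_sum_le _ _).trans (Finset.sum_le_sum fun i _ => ?_)
  rw [map_smul, norm_smul, mul_comm]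
  gcongr
  · exact le_rfl
  · exact PiLp.norm_apply_le z i

/-- The gradient of the Gaussian average at scale `a` of a `1`-Lipschitz function is
Lipschitz, with constant `O(1/a)`. -/
lemma norm_fderiv_gaussAvg_sub_le {d : ℕ} {f : E d → ℝ} (hf : SmoothPer f) (hl : LipschitzWith 1 f)
    {a : ℝ} (ha : 0 < a) (x y : E d) :
    ‖gaussAvg a (fderiv ℝ f) y - gaussAvg a (fderiv ℝ f) x‖
      ≤ d * gaussMoment d 1 / a * ‖y - x‖ := by
  obtain ⟨C, -, hC⟩ := hf.exists_bound
  obtain ⟨C', -, hC'⟩ := hf.fderiv.exists_bound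
  -- integration by parts moves the derivative from `f` to the Gaussian weight
  have key : ∀ y i, a * gaussAvg a (fderiv ℝ f) y (EuclideanSpace.single i 1)
      = ∫ z, f (y + a • z) * z i ∂(stdGaussian (E d)) := by
    intro y i
    have hder : ∀ z, HasFDerivAt (fun z => f (y + a • z)) (a • fderiv ℝ f (y + a • z)) z := by
      intro z
      have h1 : HasFDerivAt (fun z : E d => y + a • z) (a • ContinuousLinearMap.id ℝ (E d)) z :=
        ((hasFDerivAt_id z).const_smul a).const_add y
      have h2 := (hf.hasFDerivAt (y + a • z)).comp z h1
      refine h2.congr_fderiv ?_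
      ext w; simp
    have hcd : ContDiff ℝ 1 (fun z => f (y + a • z)) := by
      have := hf.contDiff.of_le (m := 1) (by exact_mod_cast le_top)
      fun_prop
    rw [← integral_fderiv_stdGaussian hcd (fun z => hC _) (C' := |a| * C') (fun z => ?_) i]
    · simp_rw [(hder _).fderiv]
      simp only [smul_apply, smul_eq_mul]
      rw [integral_const_mul, gaussAvg, ContinuousLinearMap.integral_apply
        (integrable_gaussAvg hf.fderiv.continuous hC' a y)]
    · rw [(hder z).fderiv, norm_smul, Real.norm_eq_abs]
      gcongr
      exact hC' _
  have hi : ∀ y i, Integrable (fun z : E d => f (y + a • z) * z i) (stdGaussian (E d)) := by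
    intro y i
    refine ((integrable_norm_pow_stdGaussian 1).const_mul C).mono' ?_
      (Eventually.of_forall fun z => ?_)
    · have := hf.continuous
      have : Continuous fun z : E d => f (y + a • z) * z i := by fun_prop
      exact this.aestronglyMeasurable
    rw [norm_mul, pow_one]
    exact mul_le_mul (hC _) (PiLp.norm_apply_le z i) (norm_nonneg _) ((norm_nonneg _).trans (hC z))
  refine (opNorm_le_sum_single _).trans ?_
  have hb : ∀ i, |(gaussAvg a (fderiv ℝ f) y - gaussAvg a (fderiv ℝ f) x)
      (EuclideanSpace.single i 1)| ≤ gaussMoment d 1 / a * ‖y - x‖ := by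
    intro i
    have e : a * (gaussAvg a (fderiv ℝ f) y - gaussAvg a (fderiv ℝ f) x)
        (EuclideanSpace.single i 1)
        = ∫ z, (f (y + a • z) - f (x + a • z)) * z i ∂(stdGaussian (E d)) := by
      rw [sub_apply, mul_sub, key, key, ← integral_sub (hi y i) (hi x i)]
      congr 1; ext z; ring
    have h2 : |a * (gaussAvg a (fderiv ℝ f) y - gaussAvg a (fderiv ℝ f) x)
        (EuclideanSpace.single i 1)| ≤ ‖y - x‖ * gaussMoment d 1 := by
      rw [e, ← Real.norm_eq_abs, gaussMoment, ← integral_const_mul]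
      refine norm_integral_le_of_norm_le ((integrable_norm_pow_stdGaussian 1).const_mul _)
        (Eventually.of_forall fun z => ?_)
      rw [norm_mul, pow_one]
      refine mul_le_mul ?_ (PiLp.norm_apply_le z i) (norm_nonneg _) (norm_nonneg _)
      have := hl.dist_le_mul (y + a • z) (x + a • z)
      simpa [dist_eq_norm] using this
    rw [abs_mul, abs_of_pos ha] at h2
    rw [div_mul_eq_mul_div, le_div_iff₀ ha]
    linarith
  calc _ ≤ ∑ _i : Fin d, gaussMoment d 1 / a * ‖y - x‖ := Finset.sum_le_sum fun i _ => hb i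
    _ = _ := by simp; ring

/-! ### Calculus on the torus -/

section torus
variable {d : ℕ} {φ : Torus d → ℝ}

lemma inner_torusGradient (φ : Torus d → ℝ) (y v : E d) :
    inner ℝ (torusGradient φ (proj y)) v = fderiv ℝ (fun y => φ (proj y)) y v := by
  have : (fun z : E d => φ (proj y + proj z)) = fun z => (fun y => φ (proj y)) (z + y) := by
    ext z; simp [proj_add, add_comm]
  have h2 := fderiv_comp_add_right (𝕜 := ℝ) (f := fun y : E d => φ (proj y)) (x := 0) y
  rw [torusGradient, this, gradient, InnerProductSpace.toDual_symm_apply, h2, zero_add]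

lemma norm_torusGradient_sub (φ : Torus d → ℝ) (y x : E d) :
    ‖torusGradient φ (proj y) - torusGradient φ (proj x)‖
      = ‖fderiv ℝ (fun y => φ (proj y)) y - fderiv ℝ (fun y => φ (proj y)) x‖ := by
  rw [← (InnerProductSpace.toDual ℝ (E d)).norm_map]
  congr 1
  ext v
  simp [inner_torusGradient]

lemma norm_torusGradient (φ : Torus d → ℝ) (y : E d) :
    ‖torusGradient φ (proj y)‖ = ‖fderiv ℝ (fun y => φ (proj y)) y‖ := by
  rw [← (InnerProductSpace.toDual ℝ (E d)).norm_map]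
  congr 1
  ext v
  simp [inner_torusGradient]

lemma torusLaplacian_proj (φ : Torus d → ℝ) (y : E d) :
    torusLaplacian φ (proj y) = trE (fderiv ℝ (fderiv ℝ (fun y => φ (proj y))) y) := by
  have e : (fun z : E d => φ (proj y + proj z)) = fun z => (fun y => φ (proj y)) (z + y) := by
    ext z; simp [proj_add, add_comm]
  rw [torusLaplacian, e, InnerProductSpace.laplacian_eq_iteratedFDeriv_orthonormalBasis _
    (EuclideanSpace.basisFun (Fin d) ℝ), trE]
  refine Finset.sum_congr rfl fun i _ => ?_
  rw [iteratedFDeriv_two_apply]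
  have : fderiv ℝ (fun z => (fun y => φ (proj y)) (z + y))
      = fun z => fderiv ℝ (fun y => φ (proj y)) (z + y) :=
    funext fun z => fderiv_comp_add_right (𝕜 := ℝ) (f := fun y => φ (proj y)) y
  rw [this, fderiv_comp_add_right (𝕜 := ℝ) (f := fderiv ℝ (fun y => φ (proj y))) y]
  simp

/-- Two points of the torus have representatives at the same distance. -/
lemma exists_lifts (x x' : Torus d) : ∃ y y' : E d, proj y = x ∧ proj y' = x' ∧
    ‖y - y'‖ = dist x x' := by
  obtain ⟨y', hy'⟩ := proj_surjective x'
  obtain ⟨z, hz, hz'⟩ := exists_proj_eq (x - x')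
  exact ⟨y' + z, y', by simp [proj_add, hz, hy'], hy', by simp [hz', dist_eq_norm]⟩

lemma lipschitzWith_comp_proj (h : LipschitzWith 1 φ) :
    LipschitzWith 1 (fun y : E d => φ (proj y)) := by
  simpa [Function.comp_def] using h.comp lipschitzWith_proj

lemma lipschitzWith_of_comp_proj (h : LipschitzWith 1 (fun y : E d => φ (proj y))) :
    LipschitzWith 1 φ := LipschitzWith.of_dist_le_mul fun x x' => by
  obtain ⟨y, y', rfl, rfl, hd⟩ := exists_lifts x x'
  rw [← hd, ← dist_eq_norm]
  exact h.dist_le_mul y y'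

lemma IsSmooth.exists_torusGradient_lipschitz (hφ : IsSmooth φ) :
    ∃ C, 0 ≤ C ∧ ∀ x x', ‖torusGradient φ x - torusGradient φ x'‖ ≤ C * dist x x' := by
  obtain ⟨C, h0, hC⟩ := hφ.smoothPer.fderiv.exists_lipschitz
  refine ⟨C, h0, fun x x' => ?_⟩
  obtain ⟨y, y', rfl, rfl, hd⟩ := exists_lifts x x'
  rw [← hd, norm_torusGradient_sub]
  exact hC _ _

lemma continuous_of_dist_le {F : Type*} [NormedAddCommGroup F] {G : Torus d → F} {C : ℝ}
    (h : ∀ x x', ‖G x - G x'‖ ≤ C * dist x x') : Continuous G := by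
  have : LipschitzWith (Real.toNNReal C) G := LipschitzWith.of_dist_le_mul fun x x' => by
    rw [dist_eq_norm]
    exact (h x x').trans (by gcongr; exact Real.le_coe_toNNReal C)
  exact this.continuous

lemma IsSmooth.continuous (hφ : IsSmooth φ) : Continuous φ := by
  obtain ⟨C, h0, hC⟩ := hφ.smoothPer.exists_lipschitz
  refine continuous_of_dist_le (C := C) fun x x' => ?_
  obtain ⟨y, y', rfl, rfl, hd⟩ := exists_lifts x x'
  rw [← hd]
  exact hC _ _

lemma IsSmooth.continuous_torusGradient (hφ : IsSmooth φ) : Continuous (torusGradient φ) := by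
  obtain ⟨C, -, hC⟩ := hφ.exists_torusGradient_lipschitz
  exact continuous_of_dist_le hC

lemma IsSmooth.exists_torusGradient_bound (hφ : IsSmooth φ) :
    ∃ C, 0 ≤ C ∧ ∀ x, ‖torusGradient φ x‖ ≤ C := by
  obtain ⟨C, h0, hC⟩ := hφ.smoothPer.fderiv.exists_bound
  refine ⟨C, h0, fun x => ?_⟩
  obtain ⟨y, rfl⟩ := proj_surjective x
  rw [norm_torusGradient]
  exact hC y

lemma IsSmooth.exists_torusLaplacian_lipschitz (hφ : IsSmooth φ) :
    ∃ C, 0 ≤ C ∧ ∀ x x', ‖torusLaplacian φ x - torusLaplacian φ x'‖ ≤ C * dist x x' := by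
  obtain ⟨C, h0, hC⟩ := hφ.smoothPer.fderiv.fderiv.exists_lipschitz
  refine ⟨d * C, by positivity, fun x x' => ?_⟩
  obtain ⟨y, y', rfl, rfl, hd⟩ := exists_lifts x x'
  rw [← hd, torusLaplacian_proj, torusLaplacian_proj, ← trE_sub, Real.norm_eq_abs, mul_assoc]
  refine (abs_trE_le _).trans ?_
  gcongr
  exact hC _ _

lemma IsSmooth.continuous_torusLaplacian (hφ : IsSmooth φ) : Continuous (torusLaplacian φ) := by
  obtain ⟨C, -, hC⟩ := hφ.exists_torusLaplacian_lipschitz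
  exact continuous_of_dist_le hC

/-- First order Taylor estimate on the torus. -/
lemma IsSmooth.exists_taylor_one (hφ : IsSmooth φ) : ∃ C, 0 ≤ C ∧ ∀ (x : Torus d) (z : E d),
    |φ (x + proj z) - φ x - inner ℝ (torusGradient φ x) z| ≤ C * ‖z‖ ^ 2 := by
  obtain ⟨C, h0, hC⟩ := hφ.smoothPer.fderiv.exists_lipschitz
  refine ⟨C, h0, fun x z => ?_⟩
  obtain ⟨y, rfl⟩ := proj_surjective x
  rw [inner_torusGradient, ← proj_add]
  exact norm_taylor_one_le hφ.smoothPer.differentiable hC h0 y z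

lemma norm_torusGradient_le_one (hl : LipschitzWith 1 φ) (x : Torus d) :
    ‖torusGradient φ x‖ ≤ 1 := by
  obtain ⟨y, rfl⟩ := proj_surjective x
  rw [norm_torusGradient]
  simpa using norm_fderiv_le_of_lipschitz ℝ (x₀ := y) (lipschitzWith_comp_proj hl)

/-- The Gaussian average of a function on the torus: `φ ↦ 𝔼 φ(x + a Z)`. As a function of
`a²/2` it is the heat semigroup. -/
def torusHeat (a : ℝ) (φ : Torus d → ℝ) (x : Torus d) : ℝ :=
  ∫ z, φ (x + proj (a • z)) ∂(stdGaussian (E d))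

lemma torusHeat_proj (a : ℝ) (φ : Torus d → ℝ) :
    (fun y => torusHeat a φ (proj y)) = gaussAvg a (fun y => φ (proj y)) := by
  ext y; simp [torusHeat, gaussAvg, proj_add]

@[simp] lemma torusHeat_zero : torusHeat 0 φ = φ := by
  ext x; simp [torusHeat]

lemma IsSmooth.torusHeat (hφ : IsSmooth φ) (a : ℝ) : IsSmooth (torusHeat a φ) := by
  have := (hφ.smoothPer.gaussAvg a).contDiff
  rw [← torusHeat_proj] at this
  exact this

lemma lipschitz_torusHeat (hφ : IsSmooth φ) (hl : LipschitzWith 1 φ) (a : ℝ) :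
    LipschitzWith 1 (torusHeat a φ) := by
  obtain ⟨C, -, hC⟩ := hφ.smoothPer.exists_bound
  refine lipschitzWith_of_comp_proj ?_
  rw [torusHeat_proj]
  exact lipschitz_gaussAvg (lipschitzWith_comp_proj hl) hC a

/-- Gradient smoothing of the heat semigroup. With `a = √(2σ'(s - r))` the rate `1 / a` is an
integrable singularity at `r = s`, which is what makes the duality argument for the
Fokker–Planck equation work in the Monge–Kantorovich distance. -/
lemma norm_torusGradient_torusHeat_sub_le (hφ : IsSmooth φ) (hl : LipschitzWith 1 φ) {a : ℝ}
    (ha : 0 < a) (x x' : Torus d) :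
    ‖torusGradient (torusHeat a φ) x - torusGradient (torusHeat a φ) x'‖
      ≤ d * gaussMoment d 1 / a * dist x x' := by
  obtain ⟨y, y', rfl, rfl, hd⟩ := exists_lifts x x'
  rw [← hd, norm_torusGradient_sub, torusHeat_proj, hφ.smoothPer.fderiv_gaussAvg]
  exact norm_fderiv_gaussAvg_sub_le hφ.smoothPer (lipschitzWith_comp_proj hl) ha y' y

lemma abs_torusHeat_sub_le (hφ : IsSmooth φ) (hl : LipschitzWith 1 φ) (a b : ℝ) (x : Torus d) :
    |torusHeat a φ x - torusHeat b φ x| ≤ |a - b| * gaussMoment d 1 := by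
  obtain ⟨y, rfl⟩ := proj_surjective x
  obtain ⟨C, -, hC⟩ := hφ.smoothPer.exists_bound
  have := norm_gaussAvg_sub_le hφ.smoothPer.continuous hC (K := 1) (fun x y => by
    simpa [dist_eq_norm] using (lipschitzWith_comp_proj hl).dist_le_mul x y) a b y
  rw [← torusHeat_proj, ← torusHeat_proj, one_mul] at this
  exact this

lemma fderiv_fderiv_torusHeat (hφ : IsSmooth φ) (a : ℝ) :
    fderiv ℝ (fderiv ℝ (fun y => torusHeat a φ (proj y)))
      = gaussAvg a (fderiv ℝ (fderiv ℝ (fun y => φ (proj y)))) := by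
  rw [torusHeat_proj, hφ.smoothPer.fderiv_gaussAvg, hφ.smoothPer.fderiv.fderiv_gaussAvg]

lemma exists_abs_torusLaplacian_torusHeat_sub_le (hφ : IsSmooth φ) :
    ∃ C, 0 ≤ C ∧ ∀ a b x, |torusLaplacian (torusHeat a φ) x - torusLaplacian (torusHeat b φ) x|
      ≤ C * |a - b| := by
  obtain ⟨C, -, hC⟩ := hφ.smoothPer.fderiv.fderiv.exists_bound
  obtain ⟨K, hK0, hK⟩ := hφ.smoothPer.fderiv.fderiv.exists_lipschitz
  refine ⟨d * (K * gaussMoment d 1), by have := gaussMoment_nonneg d 1; positivity,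
    fun a b x => ?_⟩
  obtain ⟨y, rfl⟩ := proj_surjective x
  rw [torusLaplacian_proj, torusLaplacian_proj, fderiv_fderiv_torusHeat hφ,
    fderiv_fderiv_torusHeat hφ, ← trE_sub]
  refine (abs_trE_le _).trans ?_
  have := norm_gaussAvg_sub_le hφ.smoothPer.fderiv.fderiv.continuous hC
    (fun x y => hK y x) a b y
  calc _ ≤ (d : ℝ) * (K * |a - b| * gaussMoment d 1) := by gcongr
    _ = _ := by ring

/-- The heat equation for Gaussian averages, in integrated form and with a remainder which is
uniform in the scale. -/
lemma exists_abs_torusHeat_sub_le (hφ : IsSmooth φ) : ∃ C, 0 ≤ C ∧ ∀ a b v x, 0 ≤ v →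
    a ^ 2 = b ^ 2 + v ^ 2 →
    |torusHeat a φ x - torusHeat b φ x - v ^ 2 / 2 * torusLaplacian (torusHeat b φ) x|
      ≤ C * v ^ 3 := by
  obtain ⟨C, -, hC⟩ := hφ.smoothPer.exists_bound
  obtain ⟨C₂, -, hC₂⟩ := hφ.smoothPer.fderiv.fderiv.exists_bound
  obtain ⟨K, hK0, hK⟩ := hφ.smoothPer.fderiv.fderiv.exists_lipschitz
  refine ⟨K * gaussMoment d 3, by have := gaussMoment_nonneg d 3; positivity,
    fun a b v x hv hab => ?_⟩
  obtain ⟨y, rfl⟩ := proj_surjective x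
  have h1 := abs_gaussAvg_sub_le (hφ.smoothPer.gaussAvg b) hK0 (fun x y => ?_) hv y
  · rw [gaussAvg_gaussAvg hφ.smoothPer.continuous hC (c := a) (by rw [hab]; ring),
      ← torusHeat_proj, ← torusHeat_proj, ← torusLaplacian_proj] at h1
    refine h1.trans (le_of_eq ?_)
    ring
  · rw [← torusHeat_proj, fderiv_fderiv_torusHeat hφ, gaussAvg, gaussAvg, ← integral_sub
      (integrable_gaussAvg hφ.smoothPer.fderiv.fderiv.continuous hC₂ b y)
      (integrable_gaussAvg hφ.smoothPer.fderiv.fderiv.continuous hC₂ b x)]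
    refine (norm_integral_le_of_norm_le_const (C := K * ‖y - x‖)
      (Eventually.of_forall fun z => ?_)).trans (by simp)
    simpa using hK (x + b • z) (y + b • z)

/-- Lipschitz functions on the torus are uniform limits of smooth functions with the same
Lipschitz constant. -/
lemma exists_smooth_approx (hl : LipschitzWith 1 φ) {ε : ℝ} (hε : 0 < ε) :
    ∃ ψ : Torus d → ℝ, IsSmooth ψ ∧ LipschitzWith 1 ψ ∧ ∀ x, |ψ x - φ x| ≤ ε := by
  set f : E d → ℝ := fun y => φ (proj y) with hf
  have hfl := lipschitzWith_comp_proj hl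
  let ρ : ContDiffBump (0 : E d) := ⟨ε / 2, ε, by positivity, by linarith⟩
  let g : E d → ℝ := convolution (ρ.normed volume) f (ContinuousLinearMap.lsmul ℝ ℝ) volume
  have hgd : ∀ y, g y = ∫ t, ρ.normed volume t * f (y - t) := fun y => rfl
  have hgp : ∀ y y', proj y = proj y' → g y = g y' := fun y y' h => by
    rw [hgd, hgd]; congr 1; ext t; rw [hf]; simp only [proj_sub, h]
  have hint : ∀ y, Integrable (fun t => ρ.normed volume t * f (y - t)) := fun y => by
    have hc : Continuous (fun t => ρ.normed volume t * f (y - t)) := by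
      have h1 := ρ.continuous_normed (μ := (volume : Measure (E d)))
      have h2 := hfl.continuous.comp (continuous_sub_left y)
      exact h1.mul h2
    exact hc.integrable_of_hasCompactSupport (ρ.hasCompactSupport_normed.mul_right)
  have hglip : LipschitzWith 1 g := LipschitzWith.of_dist_le_mul fun y y' => by
    rw [hgd, hgd, dist_eq_norm, ← integral_sub (hint y) (hint y')]
    have h1 : ∫ t, ρ.normed volume t * dist y y' = dist y y' := by
      rw [integral_mul_const, ρ.integral_normed, one_mul]
    rw [NNReal.coe_one, one_mul, ← h1]
    refine norm_integral_le_of_norm_le (ρ.integrable_normed.mul_const _)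
      (Eventually.of_forall fun t => ?_)
    rw [← mul_sub, norm_mul, Real.norm_of_nonneg (ρ.nonneg_normed t)]
    gcongr
    · exact ρ.nonneg_normed t
    · have := hfl.dist_le_mul (y - t) (y' - t)
      simpa [dist_eq_norm] using this
  -- `g` is periodic, hence descends to the torus
  have hψ : (fun y => (fun x : Torus d => g (Function.surjInv proj_surjective x)) (proj y)) =
      g := by
    ext y; exact hgp _ _ (Function.surjInv_eq proj_surjective _)
  refine ⟨fun x => g (Function.surjInv proj_surjective x), ?_, ?_, fun x => ?_⟩
  · unfold IsSmooth
    rw [hψ]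
    exact ρ.hasCompactSupport_normed.contDiff_convolution_left _ (ρ.contDiff_normed)
      hfl.continuous.locallyIntegrable
  · exact lipschitzWith_of_comp_proj (by rw [hψ]; exact hglip)
  · obtain ⟨y, rfl⟩ := proj_surjective x
    have h1 := congrFun hψ y
    simp only at h1 ⊢
    rw [h1, ← Real.dist_eq]
    refine ContDiffBump.dist_normed_convolution_le hfl.continuous.aestronglyMeasurable
      fun w hw => ?_
    have := hfl.dist_le_mul w y
    rw [NNReal.coe_one, one_mul] at this
    exact this.trans (Metric.mem_ball.1 hw).le

end torus

/-! ### Stability of the Fokker–Planck equation -/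

/-- Gronwall's lemma in a form that needs no measurability: a bound in the weighted norm
`sup e^{-λr} u(r)` which improves itself by a factor `1/2` up to a constant. -/
lemma le_of_weighted_improvement {ι : Type*} {u : ι → ℝ → ℝ} {S lam a C : ℝ} (ha : 0 ≤ a)
    (hlam : 0 ≤ lam) (hC : ∀ i, ∀ r ∈ Icc 0 S, u i r ≤ C)
    (h : ∀ N, 0 ≤ N → (∀ i, ∀ r ∈ Icc 0 S, u i r ≤ N * Real.exp (lam * r)) →
      ∀ i, ∀ r ∈ Icc 0 S, u i r ≤ (a + N / 2) * Real.exp (lam * r)) :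
    ∀ i, ∀ r ∈ Icc 0 S, u i r ≤ 2 * a * Real.exp (lam * r) := by
  have key : ∀ n : ℕ, ∀ i, ∀ r ∈ Icc 0 S,
      u i r ≤ (2 * a + |C| * (1 / 2) ^ n) * Real.exp (lam * r) := by
    intro n
    induction n with
    | zero =>
      intro i r hr
      have h1 : 1 ≤ Real.exp (lam * r) := Real.one_le_exp (mul_nonneg hlam hr.1)
      have h2 := hC i r hr
      have h3 := le_abs_self C
      have h4 := abs_nonneg C
      simp only [pow_zero, mul_one]
      nlinarith
    | succ n ih =>
      intro i r hr
      refine (h _ (by positivity) ih i r hr).trans (le_of_eq ?_)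
      rw [pow_succ]; ring
  intro i r hr
  have h1 : Tendsto (fun n : ℕ => (2 * a + |C| * (1 / 2 : ℝ) ^ n) * Real.exp (lam * r)) atTop
      (𝓝 ((2 * a + |C| * 0) * Real.exp (lam * r))) :=
    ((tendsto_pow_atTop_nhds_zero_of_lt_one (by norm_num) (by norm_num)).const_mul _
      |>.const_add _).mul_const _
  rw [mul_zero, add_zero] at h1
  exact ge_of_tendsto' h1 fun n => key n i r hr

section FP
variable {d : ℕ} {σ' t : ℝ} {F : ℝ → Torus d → PT d → E d} {μ : PT d} {m : ℝ → PT d}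

lemma IsFokkerPlanckSolution.continuousOn_integral (hm : IsFokkerPlanckSolution σ' F t μ m)
    {f : Torus d → ℝ} (hf : Continuous f) :
    ContinuousOn (fun q => ∫ y, f y ∂(m q : Measure (Torus d))) (Icc 0 t) := by
  intro q hq
  exact (ProbabilityMeasure.tendsto_iff_forall_integral_tendsto.1 (hm.continuousOn q hq))
    (BoundedContinuousFunction.mkOfCompact ⟨f, hf⟩)

/-- The weak formulation between two arbitrary times. -/
lemma IsFokkerPlanckSolution.integral_sub (hm : IsFokkerPlanckSolution σ' F t μ m)
    {φ : Torus d → ℝ} (hφ : IsSmooth φ) {r s : ℝ} (hr : 0 ≤ r) (hrs : r ≤ s) (hs : s ≤ t) :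
    (∫ y, φ y ∂(m s : Measure (Torus d))) - ∫ y, φ y ∂(m r : Measure (Torus d)) =
      (∫ q in r..s, ∫ y, inner ℝ (F (t - q) y (m q)) (torusGradient φ y) ∂(m q : Measure (Torus d)))
      + σ' * ∫ q in r..s, ∫ y, torusLaplacian φ y ∂(m q : Measure (Torus d)) := by
  have hp := hm.integrable_pairing φ hφ
  have hl : IntervalIntegrable (fun q => σ' * ∫ y, torusLaplacian φ y ∂(m q : Measure (Torus d)))
      volume 0 t := by
    refine (ContinuousOn.intervalIntegrable ?_).const_mul _
    rw [uIcc_of_le (hr.trans (hrs.trans hs))]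
    exact hm.continuousOn_integral hφ.continuous_torusLaplacian
  have sub : ∀ {a b}, 0 ≤ a → a ≤ b → b ≤ t → uIcc a b ⊆ uIcc 0 t := fun {a b} h1 h2 h3 => by
    rw [uIcc_of_le h2, uIcc_of_le (h1.trans (h2.trans h3))]
    exact Icc_subset_Icc h1 h3
  have hpl := hp.add hl
  rw [hm.weak φ hφ s ⟨hr.trans hrs, hs⟩, hm.weak φ hφ r ⟨hr, hrs.trans hs⟩,
    add_sub_add_left_eq_sub, intervalIntegral.integral_interval_sub_left
      (hpl.mono_set (sub le_rfl (hr.trans hrs) hs)) (hpl.mono_set (sub le_rfl hr (hrs.trans hs))),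
    intervalIntegral.integral_add (hp.mono_set (sub hr hrs hs)) (hl.mono_set (sub hr hrs hs)),
    intervalIntegral.integral_const_mul]

/-- Along a solution, the increment on `[r, r + h]` of `q ↦ ∫ u(q) dm(q)`, with `u` solving the
backward heat equation with final datum `ψ` at time `s`, is the transport term up to `o(h)`: the
Laplacian in the equation of `m` cancels the time derivative of `u`. -/
lemma IsFokkerPlanckSolution.eventually_heat_increment (hσ' : 0 < σ')
    (hm : IsFokkerPlanckSolution σ' F t μ m) {ψ : Torus d → ℝ} (hψ : IsSmooth ψ) {s r ε : ℝ}
    (hr : r ∈ Ico 0 s) (hst : s ≤ t) (hε : 0 < ε) :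
    ∀ᶠ h in 𝓝[>] (0 : ℝ),
      |(∫ y, torusHeat (√(2 * σ' * (s - (r + h)))) ψ y ∂(m (r + h) : Measure (Torus d)))
        - (∫ y, torusHeat (√(2 * σ' * (s - r))) ψ y ∂(m r : Measure (Torus d)))
        - ∫ q in r..(r + h), ∫ y, inner ℝ (F (t - q) y (m q))
            (torusGradient (torusHeat (√(2 * σ' * (s - r))) ψ) y) ∂(m q : Measure (Torus d))|
        ≤ ε * h := by
  obtain ⟨C₁, hC₁0, hC₁⟩ := exists_abs_torusHeat_sub_le hψ
  obtain ⟨C₂, hC₂0, hC₂⟩ := exists_abs_torusLaplacian_torusHeat_sub_le hψ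
  set a : ℝ → ℝ := fun q => √(2 * σ' * (s - q)) with ha
  have hsm := hψ.torusHeat (a r)
  set θ : ℝ → ℝ := fun q => ∫ y, torusLaplacian (torusHeat (a r) ψ) y ∂(m q : Measure (Torus d))
  have hθ : ContinuousOn θ (Icc 0 t) := hm.continuousOn_integral hsm.continuous_torusLaplacian
  have hrt : r < t := hr.2.trans_le hst
  -- the time oscillation of `θ`
  have hη : 0 < ε / (4 * σ') := by positivity
  obtain ⟨δ, hδ0, hδ⟩ := Metric.continuousWithinAt_iff.1 (hθ r ⟨hr.1, hrt.le⟩) _ hη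
  -- the error coming from the heat equation
  have hlim : Tendsto (fun h : ℝ => C₁ * (2 * σ') * √(2 * σ' * h) +
      σ' * (C₂ * |a r - a (r + h)|)) (𝓝[>] 0) (𝓝 0) := by
    have hc : Continuous (fun h : ℝ => C₁ * (2 * σ') * √(2 * σ' * h) +
      σ' * (C₂ * |a r - a (r + h)|)) := by
      simp only [ha]; fun_prop
    have := hc.tendsto 0
    simp only [mul_zero, Real.sqrt_zero, add_zero, sub_self, abs_zero] at this
    exact this.mono_left nhdsWithin_le_nhds
  filter_upwards [hlim.eventually (gt_mem_nhds (half_pos hε)), self_mem_nhdsWithin,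
    nhdsWithin_le_nhds (gt_mem_nhds hδ0), nhdsWithin_le_nhds (gt_mem_nhds (sub_pos.2 hr.2))]
    with h h1 h2 h3 h4
  replace h2 : 0 < h := h2
  have hrh : r + h ≤ t := by linarith
  have hinc := hm.integral_sub hsm hr.1 (by linarith : r ≤ r + h) hrh
  have hv : √(2 * σ' * h) ^ 2 = 2 * σ' * h := Real.sq_sqrt (by positivity)
  have hv3 : √(2 * σ' * h) ^ 3 = 2 * σ' * h * √(2 * σ' * h) := by rw [pow_succ, hv]
  -- the time derivative of the test function
  have hT1 : |(∫ y, torusHeat (a r) ψ y ∂(m (r + h) : Measure (Torus d)))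
      - (∫ y, torusHeat (a (r + h)) ψ y ∂(m (r + h) : Measure (Torus d)))
      - σ' * h * θ (r + h)|
      ≤ (C₁ * (2 * σ') * √(2 * σ' * h) + σ' * (C₂ * |a r - a (r + h)|)) * h := by
    have i1 := integrable_torus (hψ.torusHeat (a r)).continuous (m (r + h) : Measure (Torus d))
    have i2 := integrable_torus (hψ.torusHeat (a (r + h))).continuous
      (m (r + h) : Measure (Torus d))
    have i3 := (integrable_torus hsm.continuous_torusLaplacian
      (m (r + h) : Measure (Torus d))).const_mul (σ' * h)
    have i4 : Integrable (fun y => torusHeat (a r) ψ y - torusHeat (a (r + h)) ψ y)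
      (m (r + h) : Measure (Torus d)) := i1.sub i2
    rw [← MeasureTheory.integral_sub i1 i2, ← integral_const_mul,
      ← MeasureTheory.integral_sub i4 i3, ← Real.norm_eq_abs]
    refine (norm_integral_le_of_norm_le_const (Eventually.of_forall fun y => ?_)).trans
      (by rw [probReal_univ, mul_one])
    rw [Real.norm_eq_abs]
    have e1 := hC₁ (a r) (a (r + h)) (√(2 * σ' * h)) y (Real.sqrt_nonneg _) (by
      rw [hv, ha]; simp only
      rw [Real.sq_sqrt (by nlinarith [hr.2]), Real.sq_sqrt (by nlinarith)]; ring)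
    have e2 := hC₂ (a r) (a (r + h)) y
    rw [hv3, hv] at e1
    rw [abs_le] at e1 e2 ⊢
    have hσh : 0 ≤ σ' * h := by positivity
    have e3 := mul_le_mul_of_nonneg_left e2.1 hσh
    have e4 := mul_le_mul_of_nonneg_left e2.2 hσh
    constructor <;> linarith [e1.1, e1.2]
  have hθr : ∀ q ∈ Icc r (r + h), |θ q - θ r| ≤ ε / (4 * σ') := fun q hq => by
    refine (hδ (x := q) ⟨hr.1.trans hq.1, hq.2.trans hrh⟩ ?_).le
    rw [Real.dist_eq, abs_of_nonneg (sub_nonneg.2 hq.1)]; linarith [hq.2]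
  -- the Laplacian in the equation, with the measure frozen at time `r + h`
  have hT2 : |(∫ q in r..(r + h), θ q) - h * θ (r + h)| ≤ ε / (2 * σ') * h := by
    have e : (∫ q in r..(r + h), θ q) - h * θ (r + h) = ∫ q in r..(r + h), (θ q - θ (r + h)) := by
      rw [intervalIntegral.integral_sub _ (by simp)]
      · simp
      · refine ContinuousOn.intervalIntegrable (hθ.mono ?_)
        rw [uIcc_of_le (by linarith)]
        exact Icc_subset_Icc hr.1 hrh
    rw [e, ← Real.norm_eq_abs]
    refine (intervalIntegral.norm_integral_le_of_norm_le_const (C := ε / (2 * σ'))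
      fun q hq => ?_).trans (le_of_eq ?_)
    · rw [uIoc_of_le (by linarith)] at hq
      have a1 := hθr q ⟨hq.1.le, hq.2⟩
      have a2 := hθr (r + h) ⟨by linarith, le_rfl⟩
      rw [Real.norm_eq_abs]
      calc |θ q - θ (r + h)| = |(θ q - θ r) - (θ (r + h) - θ r)| := by congr 1; ring
        _ ≤ ε / (4 * σ') + ε / (4 * σ') := (abs_sub _ _).trans (add_le_add a1 a2)
        _ = ε / (2 * σ') := by field_simp; ring
    · rw [add_sub_cancel_left, abs_of_pos h2]
  have hT2' : |σ' * (∫ q in r..(r + h), θ q) - σ' * (h * θ (r + h))| ≤ ε / 2 * h := by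
    rw [← mul_sub, abs_mul, abs_of_pos hσ']
    calc _ ≤ σ' * (ε / (2 * σ') * h) := by gcongr
      _ = _ := by field_simp
  have h1' := mul_le_mul_of_nonneg_right h1.le h2.le
  have hgoal : ∀ A B C I θ' J : ℝ, B - C = I + σ' * J → |B - A - σ' * h * θ'| ≤ ε / 2 * h →
      |σ' * J - σ' * (h * θ')| ≤ ε / 2 * h → |A - C - I| ≤ ε * h := by
    intro A B C I θ' J q1 q2 q3
    rw [abs_le] at q2 q3 ⊢
    constructor <;> nlinarith [q2.1, q2.2, q3.1, q3.2]
  exact hgoal _ _ _ _ _ _ hinc (hT1.trans h1') hT2'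

lemma IsFokkerPlanckSolution.continuousOn_heat
    (hm : IsFokkerPlanckSolution σ' F t μ m) {ψ : Torus d → ℝ} (hψ : IsSmooth ψ)
    (hl : LipschitzWith 1 ψ) {s : ℝ} (hst : s ≤ t) :
    ContinuousOn (fun r => ∫ y, torusHeat (√(2 * σ' * (s - r))) ψ y ∂(m r : Measure (Torus d)))
      (Icc 0 s) := by
  intro r hr
  set a : ℝ → ℝ := fun q => √(2 * σ' * (s - q)) with ha
  have h1 : ContinuousWithinAt (fun q => ∫ y, torusHeat (a r) ψ y ∂(m q : Measure (Torus d)))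
      (Icc 0 s) r :=
    (hm.continuousOn_integral (hψ.torusHeat (a r)).continuous r ⟨hr.1, hr.2.trans hst⟩).mono
      (Icc_subset_Icc le_rfl hst)
  have h2 : Tendsto (fun q => (∫ y, torusHeat (a q) ψ y ∂(m q : Measure (Torus d)))
      - ∫ y, torusHeat (a r) ψ y ∂(m q : Measure (Torus d))) (𝓝[Icc 0 s] r) (𝓝 0) := by
    refine squeeze_zero_norm (a := fun q => |a q - a r| * gaussMoment d 1) (fun q => ?_) ?_
    · rw [← MeasureTheory.integral_sub (integrable_torus (hψ.torusHeat _).continuous _)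
        (integrable_torus (hψ.torusHeat _).continuous _)]
      exact (norm_integral_le_of_norm_le_const (Eventually.of_forall fun y =>
        abs_torusHeat_sub_le hψ hl (a q) (a r) y)).trans (by rw [probReal_univ, mul_one])
    · have hc : Continuous fun q => |a q - a r| * gaussMoment d 1 := by simp only [ha]; fun_prop
      have := hc.tendsto r
      simp only [sub_self, abs_zero, zero_mul] at this
      exact this.mono_left nhdsWithin_le_nhds
  have h3 := h2.add h1
  simp only [sub_add_cancel, zero_add] at h3
  exact h3

end FP

section FP2
variable {d : ℕ} {σ' t₁ t₂ : ℝ} {F₁ F₂ : ℝ → Torus d → PT d → E d} {μ₁ μ₂ : PT d}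
  {m₁ m₂ : ℝ → PT d}

/-- Comparison of the transport terms of two measures and two drifts. -/
lemma integral_inner_sub_le {G₁ G₂ : Torus d → E d} (hG₁ : Continuous G₁) {e M L K D : ℝ}
    {p₁ p₂ : PT d} (he : ∀ y, ‖G₁ y - G₂ y‖ ≤ e) (hM : ∀ y, ‖G₂ y‖ ≤ M) (hM0 : 0 ≤ M) (hL0 : 0 ≤ L)
    (hL : ∀ y y', ‖G₂ y - G₂ y'‖ ≤ L * dist y y') {g : Torus d → E d} (hg : ∀ y, ‖g y‖ ≤ 1)
    (hK0 : 0 ≤ K) (hK : ∀ y y', ‖g y - g y'‖ ≤ K * dist y y') (hD : d1 p₁ p₂ ≤ D) :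
    (∫ y, inner ℝ (G₁ y) (g y) ∂(p₁ : Measure (Torus d)))
      - ∫ y, inner ℝ (G₂ y) (g y) ∂(p₂ : Measure (Torus d)) ≤ e + (L + M * K) * D := by
  have hgc := continuous_of_dist_le hK
  have hG₂ := continuous_of_dist_le hL
  have i1 := integrable_torus (hG₁.inner (𝕜 := ℝ) hgc) (p₁ : Measure (Torus d))
  have i2 := integrable_torus (hG₂.inner (𝕜 := ℝ) hgc) (p₁ : Measure (Torus d))
  have h1 : (∫ y, inner ℝ (G₁ y) (g y) ∂(p₁ : Measure (Torus d)))
      - ∫ y, inner ℝ (G₂ y) (g y) ∂(p₁ : Measure (Torus d)) ≤ e := by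
    rw [← integral_sub i1 i2]
    have : ∫ y, (inner ℝ (G₁ y) (g y) - inner ℝ (G₂ y) (g y)) ∂(p₁ : Measure (Torus d))
        ≤ ∫ _y, e ∂(p₁ : Measure (Torus d)) := by
      refine integral_mono (i1.sub i2) (integrable_const _) fun y => ?_
      simp only
      rw [← inner_sub_left]
      refine (real_inner_le_norm _ _).trans ?_
      calc _ ≤ e * 1 := mul_le_mul (he y) (hg y) (norm_nonneg _) ((norm_nonneg _).trans (he y))
        _ = e := mul_one _
    simpa using this
  have h2 := integral_sub_le_mul_d1 (f := fun y => inner ℝ (G₂ y) (g y)) (K := L + M * K)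
    (by positivity) (fun x y => by
      have e : inner ℝ (G₂ x) (g x) - inner ℝ (G₂ y) (g y)
          = inner ℝ (G₂ x - G₂ y) (g x) + inner ℝ (G₂ y) (g x - g y) := by
        rw [inner_sub_left, inner_sub_right]; ring
      rw [e]
      refine (abs_add_le _ _).trans ?_
      have a1 : |inner ℝ (G₂ x - G₂ y) (g x)| ≤ L * dist x y * 1 :=
        (abs_real_inner_le_norm _ _).trans (mul_le_mul (hL x y) (hg x) (norm_nonneg _)
          (by positivity))
      have a2 : |inner ℝ (G₂ y) (g x - g y)| ≤ M * (K * dist x y) :=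
        (abs_real_inner_le_norm _ _).trans (mul_le_mul (hM y) (hK x y) (norm_nonneg _) hM0)
      linarith) p₁ p₂
  have h3 : (L + M * K) * d1 p₁ p₂ ≤ (L + M * K) * D := by gcongr
  linarith

/-- Duality estimate: the difference of two solutions, tested against a Lipschitz function,
is controlled by any supersolution of a differential inequality. -/
lemma IsFokkerPlanckSolution.integral_sub_le (hσ' : 0 < σ')
    (h₁ : IsFokkerPlanckSolution σ' F₁ t₁ μ₁ m₁) (h₂ : IsFokkerPlanckSolution σ' F₂ t₂ μ₂ m₂)
    {s M L : ℝ} (hs : 0 ≤ s) (hs₁ : s ≤ t₁) (hs₂ : s ≤ t₂) (hM0 : 0 ≤ M) (hL0 : 0 ≤ L) {e D : ℝ → ℝ}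
    (hec : Continuous e) (hDc : Continuous D)
    (hc : ∀ q ∈ Icc 0 s, Continuous fun y => F₁ (t₁ - q) y (m₁ q))
    (he : ∀ q ∈ Icc 0 s, ∀ y, ‖F₁ (t₁ - q) y (m₁ q) - F₂ (t₂ - q) y (m₂ q)‖ ≤ e q)
    (hM : ∀ q ∈ Icc 0 s, ∀ y, ‖F₂ (t₂ - q) y (m₂ q)‖ ≤ M)
    (hL : ∀ q ∈ Icc 0 s, ∀ y y', ‖F₂ (t₂ - q) y (m₂ q) - F₂ (t₂ - q) y' (m₂ q)‖ ≤ L * dist y y')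
    (hD : ∀ q ∈ Icc 0 s, d1 (m₁ q) (m₂ q) ≤ D q) {B B' : ℝ → ℝ}
    (hB : ContinuousOn B (Icc 0 s)) (hBd : ∀ r ∈ Ico 0 s, HasDerivWithinAt B (B' r) (Ici r) r)
    (hB0 : d1 μ₁ μ₂ ≤ B 0)
    (hBe : ∀ r ∈ Ico 0 s,
      e r + (L + M * (d * gaussMoment d 1 / √(2 * σ' * (s - r)))) * D r ≤ B' r)
    {ψ : Torus d → ℝ} (hψ : IsSmooth ψ) (hl : LipschitzWith 1 ψ) :
    (∫ y, ψ y ∂(m₁ s : Measure (Torus d))) - ∫ y, ψ y ∂(m₂ s : Measure (Torus d)) ≤ B s := by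
  set a : ℝ → ℝ := fun q => √(2 * σ' * (s - q)) with ha
  set f : ℝ → ℝ := fun r => (∫ y, torusHeat (a r) ψ y ∂(m₁ r : Measure (Torus d)))
    - ∫ y, torusHeat (a r) ψ y ∂(m₂ r : Measure (Torus d)) with hf
  have hfc : ContinuousOn f (Icc 0 s) :=
    (h₁.continuousOn_heat hψ hl hs₁).sub (h₂.continuousOn_heat hψ hl hs₂)
  have hf0 : f 0 ≤ B 0 := by
    refine le_trans ?_ hB0
    simp only [hf, h₁.initial, h₂.initial]
    exact integral_sub_le_d1 (lipschitz_torusHeat hψ hl _) _ _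
  have key := image_le_of_liminf_slope_right_le_deriv_boundary hfc hf0 hB hBd ?_
    (right_mem_Icc.2 hs)
  · simpa [hf, ha] using key
  -- it remains to bound the upper right derivative of `f` at `r`
  intro r hr ρ hρ
  apply Filter.Eventually.frequently
  set K := d * gaussMoment d 1 / a r with hK
  have har : 0 < a r := Real.sqrt_pos.2 (by
    have : 0 < s - r := sub_pos.2 hr.2
    positivity)
  have hK0 : 0 ≤ K := by have := gaussMoment_nonneg d 1; positivity
  have hlt : e r + (L + M * K) * D r < ρ := (hBe r hr).trans_lt hρ
  obtain ⟨ε, hε, hερ⟩ : ∃ ε > 0, e r + (L + M * K) * D r + 4 * ε ≤ ρ - ε :=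
    ⟨(ρ - (e r + (L + M * K) * D r)) / 5, by linarith, by linarith⟩
  have hcont : Continuous fun q => e q + (L + M * K) * D q := by fun_prop
  obtain ⟨δ, hδ0, hδ⟩ := Metric.continuousAt_iff.1 (hcont.continuousAt (x := r)) ε hε
  have hev : ∀ᶠ h in 𝓝[>] (0 : ℝ), slope f r (r + h) < ρ := by
    filter_upwards [h₁.eventually_heat_increment hσ' hψ hr hs₁ hε,
      h₂.eventually_heat_increment hσ' hψ hr hs₂ hε, self_mem_nhdsWithin,
      nhdsWithin_le_nhds (gt_mem_nhds hδ0), nhdsWithin_le_nhds (gt_mem_nhds (sub_pos.2 hr.2))]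
      with h b1 b2 b3 b4 b5
    replace b3 : 0 < h := b3
    have hsm := hψ.torusHeat (a r)
    have hpair : (∫ q in r..(r + h), ∫ y, inner ℝ (F₁ (t₁ - q) y (m₁ q))
            (torusGradient (torusHeat (a r) ψ) y) ∂(m₁ q : Measure (Torus d)))
        - (∫ q in r..(r + h), ∫ y, inner ℝ (F₂ (t₂ - q) y (m₂ q))
            (torusGradient (torusHeat (a r) ψ) y) ∂(m₂ q : Measure (Torus d)))
        ≤ (e r + (L + M * K) * D r + ε) * h := by
      have sub : ∀ {t}, s ≤ t → uIcc r (r + h) ⊆ uIcc 0 t := fun {t} ht => by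
        rw [uIcc_of_le (by linarith), uIcc_of_le (by linarith)]
        exact Icc_subset_Icc hr.1 (by linarith)
      have j1 := (h₁.integrable_pairing _ hsm).mono_set (sub hs₁)
      have j2 := (h₂.integrable_pairing _ hsm).mono_set (sub hs₂)
      rw [← intervalIntegral.integral_sub j1 j2]
      have := intervalIntegral.integral_mono_on (by linarith) (j1.sub j2)
        (intervalIntegrable_const (c := e r + (L + M * K) * D r + ε)) (fun q hq => ?_)
      · rw [intervalIntegral.integral_const, add_sub_cancel_left, smul_eq_mul, mul_comm] at this
        exact this
      · have hq' : q ∈ Icc 0 s := ⟨hr.1.trans hq.1, by linarith [hq.2]⟩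
        refine (integral_inner_sub_le (hc q hq') (he q hq') (hM q hq') hM0 hL0 (hL q hq')
          (norm_torusGradient_le_one (lipschitz_torusHeat hψ hl (a r))) hK0
          (norm_torusGradient_torusHeat_sub_le hψ hl har) (hD q hq')).trans ?_
        have := hδ (x := q) (by
          rw [Real.dist_eq, abs_of_nonneg (sub_nonneg.2 hq.1)]; linarith [hq.2])
        rw [Real.dist_eq] at this
        linarith [(abs_lt.1 this).2]
    rw [slope_def_field, add_sub_cancel_left, div_lt_iff₀ b3]
    have b1' := (abs_le.1 b1).2
    have b2' := (abs_le.1 b2).1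
    simp only [hf]
    nlinarith
  have hmap : Tendsto (fun z => z - r) (𝓝[>] r) (𝓝[>] 0) := by
    refine tendsto_nhdsWithin_iff.2 ⟨?_, ?_⟩
    · have : Tendsto (fun z : ℝ => z - r) (𝓝 r) (𝓝 (r - r)) := (continuous_sub_right r).tendsto r
      rw [sub_self] at this
      exact this.mono_left nhdsWithin_le_nhds
    · filter_upwards [self_mem_nhdsWithin] with z hz
      exact sub_pos.2 (mem_Ioi.1 hz)
  filter_upwards [hmap.eventually hev] with z hz
  simpa using hz

/-- A bounded primitive of a function which dominates `e^{-λ(s - r)} / √(s - r)` and whose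
integral is `O(λ^{-1/2})`. -/
lemma hasDerivAt_arctan_sqrt {lam s r : ℝ} (hlam : 0 < lam) (hr : r < s) :
    HasDerivAt (fun r => -(2 / √lam * Real.arctan (√(lam * (s - r)))))
      (1 / (√(s - r) * (1 + lam * (s - r)))) r := by
  have hτ : 0 < s - r := by linarith
  have h1 : HasDerivAt (fun r : ℝ => lam * (s - r)) (-lam) r := by
    have := ((hasDerivAt_id r).const_sub s).const_mul lam
    simpa using this
  have h2 := (((h1.sqrt (by positivity)).arctan).const_mul (2 / √lam)).neg
  refine h2.congr_deriv ?_
  rw [Real.sq_sqrt (by positivity), Real.sqrt_mul hlam.le]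
  have hs1 : √(s - r) ≠ 0 := by positivity
  have hs2 : √lam ≠ 0 := by positivity
  have hs3 : 1 + lam * (s - r) ≠ 0 := by positivity
  field_simp
  rw [Real.sq_sqrt hlam.le]

/-- Lipschitz stability of the Fokker–Planck equation for the Monge–Kantorovich distance, with
respect to the initial measure and the drift. The rate `lam` of the exponential may be taken
arbitrarily large, so that it can be shared with other estimates. -/
theorem exists_fokkerPlanck_stability (d : ℕ) {σ' : ℝ} (hσ' : 0 < σ') {M L : ℝ} (hM0 : 0 ≤ M)
    (hL0 : 0 ≤ L) : ∃ lam₀ : ℝ, 0 < lam₀ ∧ ∀ lam, lam₀ ≤ lam →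
    ∀ {t₁ t₂ : ℝ} {F₁ F₂ : ℝ → Torus d → PT d → E d} {μ₁ μ₂ : PT d} {m₁ m₂ : ℝ → PT d},
    IsFokkerPlanckSolution σ' F₁ t₁ μ₁ m₁ → IsFokkerPlanckSolution σ' F₂ t₂ μ₂ m₂ →
    ∀ {S : ℝ}, S ≤ t₁ → S ≤ t₂ → ∀ {e : ℝ → ℝ}, Continuous e → (∀ r, 0 ≤ e r) →
    (∀ q ∈ Icc 0 S, Continuous fun y => F₁ (t₁ - q) y (m₁ q)) →
    (∀ q ∈ Icc 0 S, ∀ y, ‖F₁ (t₁ - q) y (m₁ q) - F₂ (t₂ - q) y (m₂ q)‖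
      ≤ e q + L * d1 (m₁ q) (m₂ q)) →
    (∀ q ∈ Icc 0 S, ∀ y, ‖F₂ (t₂ - q) y (m₂ q)‖ ≤ M) →
    (∀ q ∈ Icc 0 S, ∀ y y', ‖F₂ (t₂ - q) y (m₂ q) - F₂ (t₂ - q) y' (m₂ q)‖ ≤ L * dist y y') →
    ∀ r ∈ Icc 0 S, d1 (m₁ r) (m₂ r) ≤
      2 * (d1 μ₁ μ₂ + ∫ q in (0 : ℝ)..S, e q) * Real.exp (lam * r) := by
  set c : ℝ := M * (d * gaussMoment d 1 / √(2 * σ')) with hc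
  have hc0 : 0 ≤ c := by have := gaussMoment_nonneg d 1; positivity
  -- for such `lam`, both `2 L / lam` and `c π / √lam` are at most `1 / 4`
  refine ⟨8 * L + (4 * c * Real.pi) ^ 2 + 1, by positivity, ?_⟩
  intro lam hlam t₁ t₂ F₁ F₂ μ₁ μ₂ m₁ m₂ h₁ h₂ S hS₁ hS₂ e hec he0 hcont he hM hL
  have hlam0 : 0 < lam := lt_of_lt_of_le (by positivity) hlam
  intro r hr
  have hS : 0 ≤ S := hr.1.trans hr.2
  have hI : 0 ≤ ∫ q in (0 : ℝ)..S, e q := intervalIntegral.integral_nonneg hS fun q _ => he0 q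
  refine le_of_weighted_improvement (u := fun _ : Unit => fun r => d1 (m₁ r) (m₂ r))
    (a := d1 μ₁ μ₂ + ∫ q in (0 : ℝ)..S, e q) (C := 2 * √d)
    (add_nonneg (d1_nonneg _ _) hI) hlam0.le (fun _ r _ => d1_le_two_sqrt _ _) ?_ () r hr
  clear r hr
  intro N hN hu _ s hs
  replace hu := hu ()
  have hcase : 2 * L / lam ≤ 1 / 4 := by
    rw [div_le_iff₀ hlam0]; nlinarith [sq_nonneg (4 * c * Real.pi)]
  have hcase2 : c * (Real.pi / √lam) ≤ 1 / 4 := by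
    have hpi := Real.pi_pos
    have : 4 * c * Real.pi ≤ √lam := Real.le_sqrt_of_sq_le (by nlinarith)
    rw [← mul_div_assoc, div_le_iff₀ (Real.sqrt_pos.2 hlam0)]
    linarith
  -- the supersolution; its last term compensates the singularity of the smoothing estimate
  let B : ℝ → ℝ := fun r => d1 μ₁ μ₂ + (∫ q in (0 : ℝ)..r, e q)
    + 2 * L * N * (Real.exp (lam * r) / lam)
    + c * N * Real.exp (lam * s) * (Real.pi / √lam + -(2 / √lam * Real.arctan (√(lam * (s - r)))))
  let B' : ℝ → ℝ := fun r => e r + 2 * L * N * Real.exp (lam * r)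
    + c * N * Real.exp (lam * s) * (1 / (√(s - r) * (1 + lam * (s - r))))
  have hBs : B s ≤ (d1 μ₁ μ₂ + (∫ q in (0 : ℝ)..S, e q) + N / 2) * Real.exp (lam * s) := by
    have e1 : B s = d1 μ₁ μ₂ + (∫ q in (0 : ℝ)..s, e q)
      + (2 * L / lam) * (N * Real.exp (lam * s))
      + c * (Real.pi / √lam) * (N * Real.exp (lam * s)) := by
      simp [B]; ring
    have e2 : (∫ q in (0 : ℝ)..s, e q) ≤ ∫ q in (0 : ℝ)..S, e q :=
      intervalIntegral.integral_mono_interval le_rfl hs.1 hs.2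
        (Eventually.of_forall he0) (hec.intervalIntegrable _ _)
    have e3 : 1 ≤ Real.exp (lam * s) := Real.one_le_exp (mul_nonneg hlam0.le hs.1)
    have e4 : 0 ≤ N * Real.exp (lam * s) := by positivity
    have e5 := d1_nonneg μ₁ μ₂
    rw [e1]
    nlinarith [mul_le_mul_of_nonneg_right hcase e4, mul_le_mul_of_nonneg_right hcase2 e4]
  refine le_trans ?_ hBs
  -- reduction to smooth test functions
  refine d1_le fun φ hφ => le_of_forall_pos_le_add fun ε hε => ?_
  obtain ⟨ψ, hψ, hl, happ⟩ := exists_smooth_approx hφ (half_pos hε)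
  have hsub : ∀ p : PT d,
      |(∫ y, ψ y ∂(p : Measure (Torus d))) - ∫ y, φ y ∂(p : Measure (Torus d))| ≤ ε / 2 := by
    intro p
    rw [← integral_sub (integrable_torus hl.continuous _) (integrable_torus hφ.continuous _)]
    exact (norm_integral_le_of_norm_le_const (μ := (p : Measure (Torus d)))
      (f := fun y => ψ y - φ y) (Eventually.of_forall happ)).trans
      (by rw [probReal_univ, mul_one])
  have main : (∫ y, ψ y ∂(m₁ s : Measure (Torus d))) - ∫ y, ψ y ∂(m₂ s : Measure (Torus d))
      ≤ B s := by
    have sub : ∀ {q}, q ∈ Icc 0 s → q ∈ Icc 0 S := fun hq => ⟨hq.1, hq.2.trans hs.2⟩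
    refine IsFokkerPlanckSolution.integral_sub_le hσ' h₁ h₂ hs.1 (hs.2.trans hS₁) (hs.2.trans hS₂)
      hM0 hL0 (e := fun q => e q + L * (N * Real.exp (lam * q)))
      (D := fun q => N * Real.exp (lam * q)) (B := B) (B' := B') (by fun_prop) (by fun_prop)
      (fun q hq => hcont q (sub hq)) (fun q hq y => ?_) (fun q hq => hM q (sub hq))
      (fun q hq => hL q (sub hq)) (fun q hq => hu q (sub hq)) ?_ (fun r hr => ?_) ?_
      (fun r hr => ?_) hψ hl
    · refine (he q (sub hq) y).trans ?_
      gcongr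
      exact hu q (sub hq)
    · have : Continuous fun r => ∫ q in (0 : ℝ)..r, e q :=
        intervalIntegral.continuous_primitive (fun a b => hec.intervalIntegrable a b) 0
      have hB : Continuous B := by
        simp only [B]; fun_prop
      exact hB.continuousOn
    · have d1' : HasDerivAt (fun r => ∫ q in (0 : ℝ)..r, e q) (e r) r :=
        intervalIntegral.integral_hasDerivAt_right (hec.intervalIntegrable _ _)
          hec.stronglyMeasurable.stronglyMeasurableAtFilter hec.continuousAt
      have d2 : HasDerivAt (fun r => Real.exp (lam * r) / lam) (Real.exp (lam * r)) r := by
        have := (((hasDerivAt_id r).const_mul lam).exp).div_const lam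
        refine this.congr_deriv ?_
        simp only [id, mul_one]; field_simp
      have d3 := hasDerivAt_arctan_sqrt hlam0 hr.2
      have := ((d1'.const_add (d1 μ₁ μ₂)).add (d2.const_mul (2 * L * N))).add
        ((d3.const_add (Real.pi / √lam)).const_mul (c * N * Real.exp (lam * s)))
      exact this.hasDerivWithinAt
    · have h1 : 0 ≤ Real.pi / √lam + -(2 / √lam * Real.arctan (√(lam * (s - 0)))) := by
        have := Real.arctan_lt_pi_div_two (√(lam * (s - 0)))
        have h2 : 2 / √lam * Real.arctan (√(lam * (s - 0))) ≤ 2 / √lam * (Real.pi / 2) := by gcongr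
        have h3 : 2 / √lam * (Real.pi / 2) = Real.pi / √lam := by ring
        linarith
      simp only [B, intervalIntegral.integral_same]
      have h2 : 0 ≤ c * N * Real.exp (lam * s) := by positivity
      have h3 : 0 ≤ 2 * L * N * (Real.exp (lam * 0) / lam) := by positivity
      nlinarith [mul_nonneg h2 h1]
    · have hτ : 0 < s - r := by linarith [hr.2]
      have e1 : M * (d * gaussMoment d 1 / √(2 * σ' * (s - r))) = c / √(s - r) := by
        rw [hc, Real.sqrt_mul (by positivity)]
        have h1 : √(2 * σ') ≠ 0 := by positivity
        have h2 : √(s - r) ≠ 0 := by positivity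
        field_simp
      have e2 : Real.exp (lam * r) * (1 + lam * (s - r)) ≤ Real.exp (lam * s) := by
        have h1 := Real.add_one_le_exp (lam * (s - r))
        calc _ ≤ Real.exp (lam * r) * Real.exp (lam * (s - r)) := by gcongr; linarith
          _ = _ := by rw [← Real.exp_add]; ring_nf
      have e3 : c / √(s - r) * (N * Real.exp (lam * r)) ≤
          c * N * Real.exp (lam * s) * (1 / (√(s - r) * (1 + lam * (s - r)))) := by
        have hs : 0 < √(s - r) := Real.sqrt_pos.2 hτ
        have h1 : 0 < 1 + lam * (s - r) := by positivity
        rw [div_mul_eq_mul_div, mul_one_div, div_le_div_iff₀ hs (by positivity)]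
        have := mul_le_mul_of_nonneg_left e2 (by positivity : 0 ≤ c * N * √(s - r))
        linarith
      simp only [B']
      rw [e1]
      linarith
  linarith [(abs_le.1 (hsub (m₁ s))).1, (abs_le.1 (hsub (m₂ s))).2]

end FP2

/-! ### The driving noise -/

/-- `N` is a `d`-dimensional Brownian motion all of whose paths are continuous and vanish at
nonpositive times. -/
structure IsNoise {Ω : Type*} [MeasurableSpace Ω] {d : ℕ} (P : Measure Ω) (N : ℝ → Ω → E d) :
    Prop where
  cont : ∀ ω, Continuous fun s => N s ω
  zero : ∀ s ω, s ≤ 0 → N s ω = 0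
  meas : ∀ s, Measurable (N s)
  law : ∀ s h, 0 ≤ s → 0 ≤ h → P.map (fun ω => N (s + h) ω - N s ω) =
    (stdGaussian (E d)).map (fun z => √h • z)
  indep : ∀ s h, 0 ≤ s → 0 ≤ h →
    IndepFun (fun ω => N (s + h) ω - N s ω) (fun ω (r : Iic s) => N r ω) P

/-- A process which is a.s. continuous and a.e. measurable at each time agrees a.s. at all times
with a measurable process whose paths are all continuous. -/
lemma exists_measurable_continuous_version {Ω : Type*} [MeasurableSpace Ω] {ι : Type*} [Finite ι]
    {P : Measure Ω} {β : ι → ℝ≥0 → Ω → ℝ} (hm : ∀ i t, AEMeasurable (β i t) P)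
    (hc : ∀ i, ∀ᵐ ω ∂P, Continuous fun t => β i t ω) (h0 : ∀ i, ∀ᵐ ω ∂P, β i 0 ω = 0) :
    ∃ γ : ι → ℝ≥0 → Ω → ℝ, (∀ i t, Measurable (γ i t)) ∧ (∀ i ω, Continuous fun t => γ i t ω) ∧
      (∀ i ω, γ i 0 ω = 0) ∧ ∀ᵐ ω ∂P, ∀ i t, γ i t ω = β i t ω := by
  classical
  -- off a measurable null set `B` the paths are continuous and measurable at the times `q n`
  let q : ℕ → ℝ≥0 := TopologicalSpace.denseSeq ℝ≥0
  have hgood : ∀ᵐ ω ∂P, ∀ i, Continuous (fun t => β i t ω) ∧ β i 0 ω = 0 ∧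
      ∀ n, β i (q n) ω = (hm i (q n)).mk (β i (q n)) ω := by
    rw [ae_all_iff]; intro i
    filter_upwards [hc i, h0 i, ae_all_iff.2 fun n => (hm i (q n)).ae_eq_mk] with ω a b c
    exact ⟨a, b, c⟩
  obtain ⟨B, hB, hBm, hB0⟩ := exists_measurable_superset_of_null (ae_iff.1 hgood)
  have hA : ∀ ω ∉ B, ∀ i, Continuous (fun t => β i t ω) ∧ β i 0 ω = 0 ∧
      ∀ n, β i (q n) ω = (hm i (q n)).mk (β i (q n)) ω := fun ω hω => by
    by_contra h; exact hω (hB h)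
  refine ⟨fun i t ω => if ω ∈ B then 0 else β i t ω, fun i t => ?_, fun i ω => ?_,
    fun i ω => ?_, ?_⟩
  · have hq : t ∈ closure (range q) := TopologicalSpace.denseRange_denseSeq ℝ≥0 t
    obtain ⟨x, hx, hxt⟩ := mem_closure_iff_seq_limit.1 hq
    choose k hk using hx
    refine measurable_of_tendsto_metrizable (f := fun n ω => if ω ∈ B then 0 else
      (hm i (q (k n))).mk (β i (q (k n))) ω) (fun n => ?_) ?_
    · exact Measurable.ite hBm measurable_const (hm i (q (k n))).measurable_mk
    · rw [tendsto_pi_nhds]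
      intro ω
      by_cases hω : ω ∈ B
      · simp [hω]
      · simp only [hω, if_false]
        have h1 := ((hA ω hω i).1.tendsto t).comp hxt
        refine h1.congr fun n => ?_
        rw [Function.comp_apply, ← hk n, (hA ω hω i).2.2]
  · by_cases hω : ω ∈ B
    · simp [hω, continuous_const]
    · simpa [hω] using (hA ω hω i).1
  · by_cases hω : ω ∈ B
    · simp [hω]
    · simpa [hω] using (hA ω hω i).2.1
  · have : ∀ᵐ ω ∂P, ω ∉ B := by rw [ae_iff]; simpa using hB0
    filter_upwards [this] with ω hω i t
    simp [hω]

/-- Independence of two variables as independence of a family indexed by `Bool`. -/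
lemma iIndepFun_bool {Ω : Type*} [MeasurableSpace Ω] {P : Measure Ω} [IsProbabilityMeasure P]
    {S : Type*} [MeasurableSpace S] {f : Bool → Ω → S} (h : IndepFun (f true) (f false) P) :
    iIndepFun f P := by
  rw [iIndepFun_iff_measure_inter_preimage_eq_mul]
  intro T sets hsets
  by_cases h1 : true ∈ T <;> by_cases h2 : false ∈ T
  · have : T = {true, false} := by ext b; cases b <;> simp [h1, h2]
    subst this
    rw [Finset.set_biInter_insert, Finset.set_biInter_singleton, Finset.prod_pair (by simp)]
    exact h.measure_inter_preimage_eq_mul _ _ (hsets true h1) (hsets false h2)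
  · have : T = {true} := by ext b; cases b <;> simp [h1, h2]
    subst this; simp
  · have : T = {false} := by ext b; cases b <;> simp [h1, h2]
    subst this; simp
  · have : T = ∅ := by ext b; cases b <;> simp [h1, h2]
    subst this; simp

/-- A Brownian motion coincides a.s. with a noise having only continuous paths. -/
theorem IsBrownian.exists_noise {Ω : Type*} [MeasurableSpace Ω] {P : Measure Ω}
    [IsProbabilityMeasure P] {d : ℕ} {β : Fin d → ℝ≥0 → Ω → ℝ} (hβ : IsBrownian β P) :
    ∃ N : ℝ → Ω → E d, IsNoise P N ∧
      ∀ᵐ ω ∂P, ∀ s, N s ω = WithLp.toLp 2 (fun i => β i s.toNNReal ω) := by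
  obtain ⟨γ, hγm, hγc, hγ0, hγβ⟩ := exists_measurable_continuous_version
    (fun i t => (hβ.isBrownianReal i).aemeasurable t) (fun i => (hβ.isBrownianReal i).cont)
    (fun i => (hβ.isBrownianReal i).eval_zero_ae_eq_zero)
  have hγB : ∀ i, IsPreBrownianReal (γ i) P := fun i =>
    (hβ.isBrownianReal i).toIsPreBrownianReal.congr fun t => by
      filter_upwards [hγβ] with ω hω; exact (hω i t).symm
  have hγI : iIndepFun (fun (i : Fin d) (ω : Ω) (t : ℝ≥0) => γ i t ω) P := by
    refine (iIndepFun_congr fun i => ?_).1 hβ.indep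
    filter_upwards [hγβ] with ω hω
    ext t; exact (hω i t).symm
  refine ⟨fun s ω => WithLp.toLp 2 (fun i => γ i s.toNNReal ω), ⟨fun ω => ?_, fun s ω hs => ?_,
    fun s => ?_, fun s h hs hh => ?_, fun s h hs hh => ?_⟩, ?_⟩
  · refine (PiLp.continuous_toLp 2 _).comp (continuous_pi fun i => ?_)
    exact (hγc i ω).comp continuous_real_toNNReal
  · ext i; simp [Real.toNNReal_of_nonpos hs, hγ0]
  · exact (WithLp.measurable_toLp 2 _).comp (measurable_pi_lambda _ fun i => hγm i _)
  · -- the coordinates of an increment are independent centred normals of variance `h`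
    have hinc : iIndepFun (fun i ω => γ i (s + h).toNNReal ω - γ i s.toNNReal ω) P := by
      have := hγI.comp (fun _ (g : ℝ≥0 → ℝ) => g (s + h).toNNReal - g s.toNNReal)
        (fun _ => by fun_prop)
      exact this
    have hmeas : ∀ i, Measurable fun ω => γ i (s + h).toNNReal ω - γ i s.toNNReal ω := fun i =>
      (hγm i _).sub (hγm i _)
    have h1 := (iIndepFun_iff_map_fun_eq_pi_map fun i => (hmeas i).aemeasurable).1 hinc
    have h2 : ∀ i, P.map (fun ω => γ i (s + h).toNNReal ω - γ i s.toNNReal ω)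
        = (gaussianReal 0 1).map (fun x => √h * x) := fun i => by
      have e1 := ((hγB i).hasLaw_sub (s + h).toNNReal s.toNNReal).map_eq
      rw [gaussianReal_map_const_mul]
      refine e1.trans ?_
      congr 1
      · simp
      · ext
        change dist (((s + h).toNNReal : ℝ≥0) : ℝ) ((s.toNNReal : ℝ≥0) : ℝ) = (√h) ^ 2 * 1
        rw [mul_one, Real.coe_toNNReal _ (by linarith), Real.coe_toNNReal _ hs, Real.dist_eq,
          Real.sq_sqrt hh]
        simp [abs_of_nonneg hh]
    have h3 : (fun ω => (WithLp.toLp 2 (fun i => γ i (s + h).toNNReal ω) : E d)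
        - WithLp.toLp 2 (fun i => γ i s.toNNReal ω))
        = fun ω => (WithLp.toLp 2 (fun i => γ i (s + h).toNNReal ω - γ i s.toNNReal ω) : E d) := by
      ext ω i; simp
    have hm1 : Measurable fun ω i => γ i (s + h).toNNReal ω - γ i s.toNNReal ω :=
      measurable_pi_lambda _ hmeas
    have hpi : (Measure.pi fun _ : Fin d => (gaussianReal 0 1).map (fun x => √h * x))
        = (Measure.pi fun _ : Fin d => gaussianReal 0 1).map (fun x i => √h * x i) := by
      have : ∀ _i : Fin d, SigmaFinite ((gaussianReal 0 1).map (fun x => √h * x)) := fun _ => by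
        have : IsProbabilityMeasure ((gaussianReal 0 1).map (fun x : ℝ => √h * x)) :=
          Measure.isProbabilityMeasure_map (by fun_prop)
        infer_instance
      exact (Measure.pi_map_pi (fun _ => by fun_prop)).symm
    rw [h3, ← map_pi_eq_stdGaussian]
    refine (Measure.map_map (WithLp.measurable_toLp 2 _) hm1).symm.trans ?_
    rw [h1, funext h2, hpi, Measure.map_map (WithLp.measurable_toLp 2 _) (by fun_prop),
      Measure.map_map (by fun_prop) (WithLp.measurable_toLp 2 _)]
    rfl
  · -- increments after time `s` and paths up to time `s`, of all coordinates, form an independent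
    -- family; group the former and the latter
    let X : Fin d → Bool → Ω → (ℝ≥0 → ℝ) := fun i b => match b with
      | true => fun ω t => γ i (s.toNNReal + t) ω - γ i s.toNNReal ω
      | false => fun ω t => γ i (min t s.toNNReal) ω
    have hXm : ∀ i b, Measurable (X i b) := fun i b => match b with
      | true => measurable_pi_lambda _ fun t => (hγm i _).sub (hγm i _)
      | false => measurable_pi_lambda _ fun t => hγm i _
    have hX1 : iIndepFun (fun i ω b => X i b ω) P := by
      let G : (ℝ≥0 → ℝ) → Bool → ℝ≥0 → ℝ := fun g b => match b with
        | true => fun t => g (s.toNNReal + t) - g s.toNNReal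
        | false => fun t => g (min t s.toNNReal)
      have hG : Measurable G := measurable_pi_lambda _ fun b => match b with
        | true => measurable_pi_lambda _ fun t => by fun_prop
        | false => measurable_pi_lambda _ fun t => by fun_prop
      have := hγI.comp (fun _ => G) (fun _ => hG)
      convert this using 1
      ext i ω b t
      cases b <;> rfl
    have hX2 : ∀ i, iIndepFun (X i) P := fun i => iIndepFun_bool (by
      have h1 := (hγB i).indepFun_shift s.toNNReal
      exact h1.comp (φ := id) (ψ := fun (g : Iic s.toNNReal → ℝ) t =>
        g ⟨min t s.toNNReal, mem_Iic.2 (min_le_right _ _)⟩) measurable_id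
        (measurable_pi_lambda _ fun t => measurable_pi_apply _))
    have hX := iIndepFun_uncurry hXm hX1 hX2
    have hI := hX.indepFun_finset (Finset.univ.image fun i => ⟨i, true⟩)
      (Finset.univ.image fun i => ⟨i, false⟩) (by
        rw [Finset.disjoint_left]
        intro p hp hq
        simp only [Finset.mem_image] at hp hq
        obtain ⟨i, -, rfl⟩ := hp
        obtain ⟨j, -, h⟩ := hq
        simp at h) (fun p => hXm _ _)
    have hI2 := hI.comp
      (φ := fun g => (WithLp.toLp 2 (fun i => g ⟨⟨i, true⟩, by simp⟩ h.toNNReal) : E d))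
      (ψ := fun g (r : Iic s) => (WithLp.toLp 2 (fun i => g ⟨⟨i, false⟩, by simp⟩
        (r : ℝ).toNNReal) : E d))
      ((WithLp.measurable_toLp 2 _).comp (measurable_pi_lambda _ fun i =>
        (measurable_pi_apply _).comp (measurable_pi_apply _)))
      (measurable_pi_lambda _ fun r => (WithLp.measurable_toLp 2 _).comp
        (measurable_pi_lambda _ fun i => (measurable_pi_apply _).comp (measurable_pi_apply _)))
    convert hI2 using 1
    · ext ω i
      simp [X, Real.toNNReal_add hs hh]
    · ext ω r i
      have : min (r : ℝ).toNNReal s.toNNReal = (r : ℝ).toNNReal :=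
        min_eq_left (Real.toNNReal_le_toNNReal r.2)
      simp [X, this]
  · filter_upwards [hγβ] with ω hω s
    ext i; simp [hω]

/-! ### Picard iteration -/

/-- Banach's fixed point theorem for a weighted supremum distance on a set of functions. -/
lemma exists_fixedPoint_weighted {ι F : Type*} [NormedAddCommGroup F] [CompleteSpace F] {w : ι → ℝ}
    {S : Set (ι → F)} {Φ : (ι → F) → ι → F} (hΦ : MapsTo Φ S S)
    (hS : ∀ (f : ℕ → ι → F) (g : ι → F) (C : ℝ), (∀ n, f n ∈ S) →
      (∀ n i, ‖f n i - g i‖ ≤ C * (1 / 2) ^ n * w i) → g ∈ S)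
    (hc : ∀ f ∈ S, ∀ g ∈ S, ∀ N : ℝ, 0 ≤ N → (∀ i, ‖f i - g i‖ ≤ N * w i) →
      ∀ i, ‖Φ f i - Φ g i‖ ≤ N / 2 * w i)
    {f₀ : ι → F} (hf₀ : f₀ ∈ S) {C₀ : ℝ} (hC₀ : 0 ≤ C₀) (h₀ : ∀ i, ‖Φ f₀ i - f₀ i‖ ≤ C₀ * w i) :
    ∃ f ∈ S, Φ f = f := by
  have hmem : ∀ n, Φ^[n] f₀ ∈ S := fun n => hΦ.iterate n hf₀
  have hstep : ∀ n i, ‖Φ^[n + 1] f₀ i - Φ^[n] f₀ i‖ ≤ C₀ * (1 / 2) ^ n * w i := by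
    intro n
    induction n with
    | zero => simpa using h₀
    | succ n ih =>
      intro i
      have := hc _ (hmem (n + 1)) _ (hmem n) (C₀ * (1 / 2) ^ n) (by positivity) ih i
      rw [Function.iterate_succ_apply' Φ (n + 1), Function.iterate_succ_apply' Φ n] at *
      refine this.trans (le_of_eq ?_)
      rw [pow_succ]; ring
  have hstep' : ∀ i n, dist (Φ^[n] f₀ i) (Φ^[n + 1] f₀ i) ≤ C₀ * w i * (1 / 2) ^ n := fun i n => by
    rw [dist_comm, dist_eq_norm]; refine (hstep n i).trans (le_of_eq (by ring))
  have hlim : ∀ i, ∃ x, Tendsto (fun n => Φ^[n] f₀ i) atTop (𝓝 x) := fun i =>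
    cauchySeq_tendsto_of_complete (cauchySeq_of_le_geometric (1 / 2) _ (by norm_num) (hstep' i))
  choose g hg using hlim
  have hfg : ∀ n i, ‖Φ^[n] f₀ i - g i‖ ≤ 2 * C₀ * (1 / 2) ^ n * w i := fun n i => by
    rw [← dist_eq_norm]
    refine (dist_le_of_le_geometric_of_tendsto (1 / 2) _ (by norm_num) (hstep' i) (hg i) n).trans
      (le_of_eq ?_)
    ring
  have hgS : g ∈ S := hS _ g _ hmem hfg
  refine ⟨g, hgS, funext fun i => ?_⟩
  have h1 : ∀ n, ‖Φ^[n + 1] f₀ i - Φ g i‖ ≤ C₀ * w i * (1 / 2) ^ n := fun n => by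
    have := hc _ (hmem n) g hgS (2 * C₀ * (1 / 2) ^ n) (by positivity) (hfg n) i
    rw [Function.iterate_succ_apply' Φ n]
    refine this.trans (le_of_eq (by ring))
  have h2 : Tendsto (fun n => Φ^[n + 1] f₀ i) atTop (𝓝 (Φ g i)) := by
    rw [tendsto_iff_norm_sub_tendsto_zero]
    refine squeeze_zero (fun _ => norm_nonneg _) h1 ?_
    simpa using (tendsto_pow_atTop_nhds_zero_of_lt_one (r := (1 / 2 : ℝ)) (by norm_num)
      (by norm_num)).const_mul (C₀ * w i)
  exact tendsto_nhds_unique h2 ((tendsto_add_atTop_iff_nat 1).2 (hg i))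

/-! ### Stochastic flows -/

/-- The information up to time `s`: the starting point and the past of the noise. -/
abbrev past {Ω : Type*} {d : ℕ} (N : ℝ → Ω → E d) (s : ℝ) : MeasurableSpace (Torus d × Ω) :=
  MeasurableSpace.comap (fun p => (p.1, fun r : Iic s => N r p.2)) inferInstance

/-- A coefficient which is bounded, Lipschitz in space and measure, and continuous in time. -/
structure IsLipCoeff {d : ℕ} (M L : ℝ) (g : ℝ → Torus d → PT d → E d) : Prop where
  bound : ∀ s x m, ‖g s x m‖ ≤ M
  lip : ∀ s x x' m m', ‖g s x m - g s x' m'‖ ≤ L * (dist x x' + d1 m m')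
  cont : ∀ x m, Continuous fun s => g s x m

/-- The process `X`, indexed by the starting point and by `Ω`, solves
`dX_s = g(s, X_s) ds + κ dN_s` for every path, and is adapted. -/
structure IsFlow {Ω : Type*} {d : ℕ} (N : ℝ → Ω → E d) (κ : ℝ)
    (g : ℝ → Torus d → E d) (X : ℝ → Torus d × Ω → Torus d) : Prop where
  cont : ∀ p, Continuous fun s => X s p
  adapted : ∀ s, Measurable[past N s] (X s)
  eq : ∀ s, 0 ≤ s → ∀ p, X s p = p.1 + proj ((∫ r in (0 : ℝ)..s, g r (X r p)) + κ • N s p.2)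

section flow
variable {Ω : Type*} [MeasurableSpace Ω] {d : ℕ} {P : Measure Ω} [IsProbabilityMeasure P]
  {N : ℝ → Ω → E d}

omit [MeasurableSpace Ω] in
lemma past_mono {r s : ℝ} (h : r ≤ s) : past N r ≤ past N s := by
  have : (fun p : Torus d × Ω => (p.1, fun q : Iic r => N q p.2))
      = (fun z : Torus d × (Iic s → E d) => (z.1, fun q : Iic r => z.2 ⟨q, q.2.trans h⟩))
        ∘ fun p => (p.1, fun q : Iic s => N q p.2) := rfl
  rw [past, this, ← MeasurableSpace.comap_comp]
  refine MeasurableSpace.comap_mono (Measurable.comap_le ?_)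
  exact measurable_fst.prodMk (measurable_pi_lambda _ fun q =>
    (measurable_pi_apply _).comp measurable_snd)

lemma past_le (hN : ∀ s, Measurable (N s)) (s : ℝ) :
    past N s ≤ (inferInstance : MeasurableSpace (Torus d × Ω)) := by
  refine Measurable.comap_le ?_
  exact measurable_fst.prodMk (measurable_pi_lambda _ fun q => (hN q).comp measurable_snd)

omit [MeasurableSpace Ω] in
lemma measurable_fst_past (s : ℝ) : Measurable[past N s] fun p : Torus d × Ω => p.1 :=
  (measurable_fst (α := Torus d) (β := Iic s → E d)).comp
    (comap_measurable fun p : Torus d × Ω => (p.1, fun r : Iic s => N r p.2))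

omit [MeasurableSpace Ω] in
lemma measurable_noise_past {r s : ℝ} (h : r ≤ s) :
    Measurable[past N s] fun p : Torus d × Ω => N r p.2 :=
  ((measurable_pi_apply (⟨r, h⟩ : Iic s)).comp measurable_snd).comp
    (comap_measurable fun p : Torus d × Ω => (p.1, fun r : Iic s => N r p.2))

lemma measurable_setIntegral {α : Type*} {mα : MeasurableSpace α} {F : ℝ → α → E d} (u : ℝ)
    (hc : ∀ p, Continuous fun r => F r p) (hm : ∀ r, Measurable (F r)) :
    Measurable fun p => ∫ r in Ioc 0 u, F r p :=
  (StronglyMeasurable.integral_prod_left (μ := volume.restrict (Ioc 0 u))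
    (stronglyMeasurable_uncurry_of_continuous_of_stronglyMeasurable (u := F) hc
      fun r => (hm r).stronglyMeasurable)).measurable

lemma measurable_of_tendsto_pointwise {α : Type*} {mα : MeasurableSpace α} {f : ℕ → α → E d}
    {g : α → E d} (hf : ∀ n, Measurable (f n)) (h : ∀ p, Tendsto (fun n => f n p) atTop (𝓝 (g p))) :
    Measurable g :=
  measurable_of_tendsto_metrizable hf (tendsto_pi_nhds.2 h)

lemma IsLipCoeff.continuous_right {M L : ℝ} {g : ℝ → Torus d → PT d → E d} (hg : IsLipCoeff M L g)
    (s : ℝ) (m : PT d) : Continuous fun x => g s x m :=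
  continuous_of_dist_le (C := L) fun x x' => by simpa using hg.lip s x x' m m

lemma IsLipCoeff.continuous_uncurry {M L : ℝ} {g : ℝ → Torus d → PT d → E d}
    (hg : IsLipCoeff M L g) {m : ℝ → PT d}
    (hm : ∀ r₀, Tendsto (fun r => d1 (m r) (m r₀)) (𝓝 r₀) (𝓝 0)) :
    Continuous fun z : ℝ × ℝ × Torus d => g z.1 z.2.2 (m z.2.1) := by
  refine continuous_iff_continuousAt.2 fun z₀ => ?_
  have h1 : Tendsto (fun z : ℝ × ℝ × Torus d => g z.1 z.2.2 (m z.2.1) - g z.1 z₀.2.2 (m z₀.2.1))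
      (𝓝 z₀) (𝓝 0) := by
    refine squeeze_zero_norm (fun r => hg.lip _ _ _ _ _) ?_
    have h2 : Tendsto (fun z : ℝ × ℝ × Torus d => dist z.2.2 z₀.2.2) (𝓝 z₀) (𝓝 0) :=
      tendsto_iff_dist_tendsto_zero.1 ((continuous_snd.comp continuous_snd).tendsto z₀)
    have h3 : Tendsto (fun z : ℝ × ℝ × Torus d => d1 (m z.2.1) (m z₀.2.1)) (𝓝 z₀) (𝓝 0) :=
      (hm z₀.2.1).comp ((continuous_fst.comp continuous_snd).tendsto z₀)
    simpa using (h2.add h3).const_mul L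
  have h2 := h1.add (((hg.cont z₀.2.2 (m z₀.2.1)).comp continuous_fst).tendsto z₀)
  simpa [ContinuousAt] using h2

lemma IsLipCoeff.continuous_comp {M L : ℝ} {g : ℝ → Torus d → PT d → E d} (hg : IsLipCoeff M L g)
    {x : ℝ → Torus d} (hx : Continuous x) {m : ℝ → PT d}
    (hm : ∀ r₀, Tendsto (fun r => d1 (m r) (m r₀)) (𝓝 r₀) (𝓝 0)) :
    Continuous fun r => g r (x r) (m r) :=
  (hg.continuous_uncurry hm).comp (continuous_id.prodMk (continuous_id.prodMk hx))

lemma tendsto_integral_dist {Ω' : Type*} [MeasurableSpace Ω'] {Q : Measure Ω'}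
    [IsProbabilityMeasure Q] {X : ℝ → Ω' → Torus d} (hX : ∀ s, Measurable (X s))
    (hc : ∀ p, Continuous fun s => X s p) (r₀ : ℝ) :
    Tendsto (fun r => ∫ p, dist (X r p) (X r₀ p) ∂Q) (𝓝 r₀) (𝓝 0) := by
  have := tendsto_integral_filter_of_dominated_convergence (μ := Q)
    (F := fun r p => dist (X r p) (X r₀ p)) (f := fun _ => 0) (l := 𝓝 r₀) (fun _ => √d)
    (Eventually.of_forall fun r => ((hX r).dist (hX r₀)).aestronglyMeasurable)
    (Eventually.of_forall fun r => Eventually.of_forall fun p => by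
      rw [Real.norm_of_nonneg dist_nonneg]; exact dist_torus_le _ _)
    (integrable_const _)
    (Eventually.of_forall fun p => tendsto_iff_dist_tendsto_zero.1 ((hc p).tendsto r₀))
  simpa using this

/-- Continuity in time of the laws of a continuous process, for the Monge–Kantorovich distance. -/
lemma tendsto_d1_lawOf {Ω' : Type*} [MeasurableSpace Ω'] {Q : Measure Ω'} [IsProbabilityMeasure Q]
    {X : ℝ → Ω' → Torus d} (hX : ∀ s, Measurable (X s)) (hc : ∀ p, Continuous fun s => X s p)
    (r₀ : ℝ) : Tendsto (fun r => d1 (lawOf Q (X r)) (lawOf Q (X r₀))) (𝓝 r₀) (𝓝 0) :=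
  squeeze_zero (fun _ => d1_nonneg _ _)
    (fun r => d1_lawOf_le_integral (hX r).aemeasurable (hX r₀).aemeasurable)
    (tendsto_integral_dist hX hc r₀)

lemma integral_exp_le {lam : ℝ} (hlam : 0 < lam) (s : ℝ) :
    ∫ r in (0 : ℝ)..s, Real.exp (lam * r) ≤ Real.exp (lam * s) / lam := by
  have : ∫ r in (0 : ℝ)..s, Real.exp (lam * r) = (Real.exp (lam * s) - 1) / lam := by
    rw [intervalIntegral.integral_comp_mul_left (fun x => Real.exp x) hlam.ne', integral_exp]
    simp; field_simp
  rw [this]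
  gcongr
  linarith

/-- Existence for McKean–Vlasov stochastic differential equations with additive noise. -/
theorem exists_flow_lawOf (hN : IsNoise P N) (κ : ℝ) {M L : ℝ} (hM : 0 ≤ M) (hL : 0 ≤ L)
    {g : ℝ → Torus d → PT d → E d} (hg : IsLipCoeff M L g) (ν : PT d) :
    ∃ X : ℝ → Torus d × Ω → Torus d,
      IsFlow N κ (fun r x => g r x (lawOf ((ν : Measure (Torus d)).prod P) (X r))) X := by
  set Q : Measure (Torus d × Ω) := (ν : Measure (Torus d)).prod P with hQ
  -- The noise is additive, so the unknown is the displacement `f` due to the drift, extended by its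
  -- initial value to negative times; the fixed point is found among adapted processes with
  -- `M`-Lipschitz paths.
  let pos : (ℝ × (Torus d × Ω) → E d) → ℝ → Torus d × Ω → Torus d :=
    fun f s p => p.1 + proj (f (s, p) + κ • N s p.2)
  let Φ : (ℝ × (Torus d × Ω) → E d) → ℝ × (Torus d × Ω) → E d := fun f z =>
    ∫ r in (0 : ℝ)..max z.1 0, g r (pos f r z.2) (lawOf Q (pos f r))
  let S : Set (ℝ × (Torus d × Ω) → E d) := {f | (∀ p s s', ‖f (s, p) - f (s', p)‖ ≤ M * |s - s'|) ∧
    ∀ s, Measurable[past N (max s 0)] fun p => f (s, p)}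
  -- the weight `e^{lam s}` makes the Picard map a contraction of ratio `2 L / lam ≤ 1 / 2`
  set lam : ℝ := 4 * L + 1 with hlam
  have hlam0 : 0 < lam := by positivity
  have hposm' : ∀ f ∈ S, ∀ s, Measurable[past N (max s 0)] (pos f s) := fun f hf s => by
    have h1 := hf.2 s
    have h2 : Measurable[past N (max s 0)] fun p : Torus d × Ω => κ • N s p.2 :=
      (measurable_noise_past (le_max_left s 0)).const_smul κ
    exact (measurable_fst_past _).add (measurable_proj.comp (h1.add h2))
  have hposm : ∀ f ∈ S, ∀ s, Measurable (pos f s) := fun f hf s =>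
    (hposm' f hf s).mono (past_le hN.meas _) le_rfl
  have hposc : ∀ f ∈ S, ∀ p, Continuous fun s => pos f s p := fun f hf p => by
    have h1 : Continuous fun s => f (s, p) := by
      have : LipschitzWith (Real.toNNReal M) fun s => f (s, p) :=
        LipschitzWith.of_dist_le_mul fun s s' => by
          rw [dist_eq_norm, Real.dist_eq, Real.coe_toNNReal _ hM]; exact hf.1 p s s'
      exact this.continuous
    have h2 := hN.cont p.2
    exact continuous_const.add (continuous_proj.comp (h1.add (h2.const_smul κ)))
  have hgc : ∀ f ∈ S, ∀ p, Continuous fun r => g r (pos f r p) (lawOf Q (pos f r)) := fun f hf p =>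
    hg.continuous_comp (hposc f hf p) (tendsto_d1_lawOf (hposm f hf) (hposc f hf))
  have hΦS : MapsTo Φ S S := by
    intro f hf
    refine ⟨fun p s s' => ?_, fun s => ?_⟩
    · simp only [Φ]
      rw [intervalIntegral.integral_interval_sub_left ((hgc f hf p).intervalIntegrable _ _)
        ((hgc f hf p).intervalIntegrable _ _)]
      refine (intervalIntegral.norm_integral_le_of_norm_le_const fun r _ => hg.bound _ _ _).trans ?_
      exact mul_le_mul_of_nonneg_left (abs_max_sub_max_le_abs s s' 0) hM
    · -- measurability of the time integral with respect to the past
      have hs0 : 0 ≤ max s 0 := le_max_right _ _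
      set u : ℝ := max s 0
      have hmu : max u 0 = u := max_eq_left hs0
      have h2 := measurable_setIntegral (mα := past N u) u
        (F := fun r p => g r (pos f (min r u) p) (lawOf Q (pos f r)))
        (fun p => hg.continuous_comp ((hposc f hf p).comp (continuous_id.min continuous_const))
          (tendsto_d1_lawOf (Q := Q) (hposm f hf) (hposc f hf)))
        (fun r => (hg.continuous_right r _).measurable.comp ((hposm' f hf (min r u)).mono
          (past_mono (N := N) (max_le (min_le_right r u) hs0)) le_rfl))
      have h3 : (fun p => Φ f (s, p)) = fun p : Torus d × Ω => ∫ r in Ioc 0 u,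
          g r (pos f (min r u) p) (lawOf Q (pos f r)) := by
        ext1 p
        simp only [Φ]
        rw [intervalIntegral.integral_of_le hs0]
        refine setIntegral_congr_fun measurableSet_Ioc fun r hr => ?_
        simp only [min_eq_left hr.2]
      rw [h3]
      exact h2
  obtain ⟨f, hfS, hf⟩ : ∃ f ∈ S, Φ f = f := by
    refine exists_fixedPoint_weighted (w := fun z => Real.exp (lam * max z.1 0))
      hΦS ?_ ?_ (f₀ := fun _ => 0) ?_ (C₀ := M / lam) (by positivity) ?_
    · rintro h f C hh hC
      have hlim : ∀ i, Tendsto (fun n => h n i) atTop (𝓝 (f i)) := fun i => by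
        rw [tendsto_iff_norm_sub_tendsto_zero]
        refine squeeze_zero (fun _ => norm_nonneg _) (fun n => hC n i) ?_
        have := ((tendsto_pow_atTop_nhds_zero_of_lt_one (r := (1 / 2 : ℝ)) (by norm_num)
          (by norm_num)).const_mul C).mul_const (Real.exp (lam * max i.1 0))
        simpa using this
      refine ⟨fun p s s' => ?_, fun s => ?_⟩
      · exact le_of_tendsto' ((hlim (s, p)).sub (hlim (s', p))).norm fun n => (hh n).1 p s s'
      · exact measurable_of_tendsto_pointwise (mα := past N (max s 0)) (fun n => (hh n).2 s)
          fun p => hlim (s, p)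
    · intro f hf h hh C hC0 hC z
      simp only [Φ]
      rw [← intervalIntegral.integral_sub ((hgc f hf z.2).intervalIntegrable _ _)
        ((hgc h hh z.2).intervalIntegrable _ _)]
      have hd : ∀ r p, dist (pos f r p) (pos h r p) ≤ C * Real.exp (lam * max r 0) := fun r p => by
        refine (dist_add_proj_le _ _ _ _).trans ?_
        rw [dist_self, zero_add, add_sub_add_right_eq_sub]
        exact hC (r, p)
      have hle : ∀ r, 0 ≤ r → ‖g r (pos f r z.2) (lawOf Q (pos f r))
          - g r (pos h r z.2) (lawOf Q (pos h r))‖ ≤ 2 * L * C * Real.exp (lam * r) := by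
        intro r hr
        refine (hg.lip _ _ _ _ _).trans ?_
        have h1 := hd r z.2
        have h2 := d1_lawOf_le (Q := Q) (hposm f hf r).aemeasurable (hposm h hh r).aemeasurable
          (Eventually.of_forall (hd r))
        rw [max_eq_left hr] at h1 h2
        nlinarith
      have hs0 : 0 ≤ max z.1 0 := le_max_right _ _
      refine (intervalIntegral.norm_integral_le_of_norm_le (g := fun r =>
        2 * L * C * Real.exp (lam * r)) hs0 ?_ ?_).trans ?_
      · exact Eventually.of_forall fun r hr => hle r hr.1.le
      · exact Continuous.intervalIntegrable (by fun_prop) _ _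
      · rw [intervalIntegral.integral_const_mul]
        have h1 := mul_le_mul_of_nonneg_left (integral_exp_le hlam0 (max z.1 0))
          (by positivity : 0 ≤ 2 * L * C)
        refine h1.trans ?_
        rw [← mul_div_assoc, div_le_iff₀ hlam0, hlam]
        have := Real.exp_pos ((4 * L + 1) * max z.1 0)
        nlinarith [mul_nonneg hC0 this.le]
    · refine ⟨fun p s s' => ?_, fun s => measurable_const⟩
      simp only [sub_self, norm_zero]; positivity
    · intro z
      have hs0 : 0 ≤ max z.1 0 := le_max_right _ _
      simp only [Φ, sub_zero]
      refine (intervalIntegral.norm_integral_le_of_norm_le_const fun r _ => hg.bound _ _ _).trans ?_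
      rw [sub_zero, abs_of_nonneg hs0, div_mul_eq_mul_div, le_div_iff₀ hlam0]
      have := Real.add_one_le_exp (lam * max z.1 0)
      nlinarith
  refine ⟨fun s => pos f (max s 0), fun p => (hposc f hfS p).comp (continuous_id.max
    continuous_const), fun s => ?_, fun s hs p => ?_⟩
  · rcases le_total 0 s with hs | hs
    · have := hposm' f hfS s
      rw [max_eq_left hs] at this
      simpa only [max_eq_left hs] using this
    · have h1 : pos f (max s 0) = fun p => p.1 := by
        ext1 p
        rw [max_eq_right hs]
        have : f (0, p) = 0 := by rw [← hf]; simp [Φ]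
        simp [pos, this, hN.zero 0 p.2 le_rfl]
      rw [h1]
      exact measurable_fst_past s
  · have h1 : f (s, p) = ∫ r in (0 : ℝ)..s, g r (pos f r p) (lawOf Q (pos f r)) := by
      conv_lhs => rw [← hf]
      simp [Φ, max_eq_left hs]
    simp only [max_eq_left hs]
    change p.1 + proj (f (s, p) + κ • N s p.2) = _
    rw [h1]
    congr 3
    refine intervalIntegral.integral_congr fun r hr => ?_
    rw [uIcc_of_le hs] at hr
    simp only [max_eq_left hr.1, hQ]

end flow

/-! ### The law of a stochastic flow solves a Fokker–Planck equation -/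

section ito
variable {Ω : Type*} [MeasurableSpace Ω] {d : ℕ} {P : Measure Ω} [IsProbabilityMeasure P]
  {N : ℝ → Ω → E d}

/-- Freezing one of two independent variables. -/
lemma integral_indepFun {β γ : Type*} [MeasurableSpace β] [MeasurableSpace γ] {U : Ω → β}
    {V : Ω → γ} (h : IndepFun U V P) (hU : Measurable U) (hV : Measurable V) {f : β × γ → ℝ}
    (hf : Measurable f) {C : ℝ} (hC : ∀ z, |f z| ≤ C) :
    ∫ ω, f (U ω, V ω) ∂P = ∫ ω, ∫ u, f (u, V ω) ∂(P.map U) ∂P := by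
  have hpU := Measure.isProbabilityMeasure_map (μ := P) hU.aemeasurable
  have hpV := Measure.isProbabilityMeasure_map (μ := P) hV.aemeasurable
  have h1 := (indepFun_iff_map_prod_eq_prod_map_map hU.aemeasurable hV.aemeasurable).1 h
  have hi : Integrable f ((P.map U).prod (P.map V)) :=
    Integrable.of_bound hf.aestronglyMeasurable C (Eventually.of_forall hC)
  rw [← integral_map (φ := fun ω => (U ω, V ω)) (hU.prodMk hV).aemeasurable
    hf.aestronglyMeasurable, h1, integral_prod_symm _ hi]
  rw [integral_map hV.aemeasurable]
  exact hf.stronglyMeasurable.integral_prod_left'.aestronglyMeasurable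

/-- Averaging out an increment of the noise amounts to an application of the heat semigroup. -/
lemma integral_add_increment (hN : IsNoise P N) (κ : ℝ) (ν : PT d) {s h : ℝ} (hs : 0 ≤ s)
    (hh : 0 ≤ h) {Y : Torus d × Ω → Torus d} (hY : Measurable[past N s] Y) {φ : Torus d → ℝ}
    (hφ : IsSmooth φ) :
    ∫ p, φ (Y p + proj (κ • (N (s + h) p.2 - N s p.2))) ∂(ν : Measure (Torus d)).prod P =
      ∫ p, torusHeat (κ * √h) φ (Y p) ∂(ν : Measure (Torus d)).prod P := by
  obtain ⟨G, hG, rfl⟩ := hY.exists_eq_measurable_comp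
  have hφc := hφ.continuous
  obtain ⟨C, hC⟩ := (isCompact_range hφc).isBounded.exists_norm_le
  have hC' : ∀ x, |φ x| ≤ C := fun x => hC _ ⟨x, rfl⟩
  have hpath : Measurable fun ω (r : Iic s) => N r ω := measurable_pi_lambda _ fun r => hN.meas r
  have hinc : Measurable fun ω => N (s + h) ω - N s ω := (hN.meas _).sub (hN.meas _)
  have hYm : Measurable fun p : Torus d × Ω => G (p.1, fun r : Iic s => N r p.2) :=
    hG.comp (measurable_fst.prodMk (hpath.comp measurable_snd))
  rw [integral_prod, integral_prod]
  · congr 1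
    ext1 y
    have h1 := integral_indepFun (hN.indep s h hs hh) hinc hpath
      (f := fun z => φ (G (y, z.2) + proj (κ • z.1))) (C := C)
      (hφc.measurable.comp ((hG.comp (measurable_const.prodMk measurable_snd)).add
        (measurable_proj.comp (measurable_fst.const_smul κ)))) (fun z => hC' _)
    refine h1.trans ?_
    congr 1
    ext1 ω
    rw [hN.law s h hs hh, integral_map (by fun_prop)]
    · simp only [torusHeat, smul_smul, Function.comp]
    · have : Continuous fun u : E d => φ (G (y, fun r : Iic s => N r ω) + proj (κ • u)) := by
        fun_prop
      exact this.aestronglyMeasurable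
  · exact integrable_comp_torus hYm.aemeasurable (hφ.torusHeat _).continuous
  · exact integrable_comp_torus (hYm.add (measurable_proj.comp
      ((hinc.comp measurable_snd).const_smul κ))).aemeasurable hφc

variable {κ : ℝ} {g : ℝ → Torus d → E d} {X : ℝ → Torus d × Ω → Torus d}

omit [IsProbabilityMeasure P] in
lemma IsFlow.measurable (hN : IsNoise P N) (hX : IsFlow N κ g X) (s : ℝ) : Measurable (X s) :=
  (hX.adapted s).mono (past_le hN.meas s) le_rfl

/-- Generator of a stochastic flow, in integrated form. -/
lemma IsFlow.hasDerivWithinAt_integral (hN : IsNoise P N) (hX : IsFlow N κ g X) (hκ : 0 ≤ κ)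
    (hg : Continuous (Function.uncurry g)) {M : ℝ} (hM : ∀ r x, ‖g r x‖ ≤ M) (ν : PT d)
    {φ : Torus d → ℝ} (hφ : IsSmooth φ) {s : ℝ} (hs : 0 ≤ s) :
    HasDerivWithinAt (fun s => ∫ p, φ (X s p) ∂(ν : Measure (Torus d)).prod P)
      (∫ p, (inner ℝ (g s (X s p)) (torusGradient φ (X s p)) +
        κ ^ 2 / 2 * torusLaplacian φ (X s p)) ∂(ν : Measure (Torus d)).prod P) (Ioi s) s := by
  set Q : Measure (Torus d × Ω) := (ν : Measure (Torus d)).prod P with hQ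
  have hM0 : 0 ≤ M := (norm_nonneg _).trans (hM 0 0)
  have hXm := hX.measurable hN
  have hφc := hφ.continuous
  have hgφ : Continuous fun x => inner ℝ (g s x) (torusGradient φ x) := by
    have := hφ.continuous_torusGradient
    have h2 : Continuous (g s) := hg.comp (by fun_prop : Continuous fun x => (s, x))
    exact h2.inner this
  obtain ⟨Cg, hCg0, hCg⟩ := hφ.exists_torusGradient_bound
  obtain ⟨Ct, hCt0, hCt⟩ := hφ.exists_taylor_one
  obtain ⟨Ch, hCh0, hCh⟩ := exists_abs_torusHeat_sub_le hφ
  have hgXc : ∀ p, Continuous fun r => g r (X r p) := fun p =>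
    hg.comp (continuous_id.prodMk (hX.cont p))
  -- position after following only the noise, and the displacement due to the drift
  let Y : ℝ → Torus d × Ω → Torus d := fun r p => X s p + proj (κ • (N r p.2 - N s p.2))
  let D : ℝ → Torus d × Ω → E d := fun r p => ∫ q in s..r, g q (X q p)
  have hYm : ∀ r, Measurable (Y r) := fun r => (hXm s).add (measurable_proj.comp
    ((((hN.meas r).comp measurable_snd).sub ((hN.meas s).comp measurable_snd)).const_smul κ))
  have hXY : ∀ r, s < r → ∀ p, X r p = Y r p + proj (D r p) := fun r hr p => by
    simp only [Y, D]
    rw [hX.eq r (hs.trans hr.le) p, hX.eq s hs p,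
      ← intervalIntegral.integral_add_adjacent_intervals ((hgXc p).intervalIntegrable 0 s)
        ((hgXc p).intervalIntegrable s r), add_assoc, add_assoc, ← proj_add, add_assoc, ← proj_add]
    congr 2
    rw [smul_sub]; abel
  have hDle : ∀ r, s < r → ∀ p, ‖D r p‖ ≤ M * (r - s) := fun r hr p => by
    have := intervalIntegral.norm_integral_le_of_norm_le_const (a := s) (b := r)
      (f := fun q => g q (X q p)) fun q _ => hM q _
    rwa [abs_of_pos (sub_pos.2 hr)] at this
  rw [hasDerivWithinAt_iff_tendsto_slope' (by simp)]
  -- the drift: first order Taylor expansion around `Y`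
  have hpart1 : Tendsto (fun r => ∫ p, (r - s)⁻¹ * (φ (X r p) - φ (Y r p)) ∂Q) (𝓝[>] s)
      (𝓝 (∫ p, inner ℝ (g s (X s p)) (torusGradient φ (X s p)) ∂Q)) := by
    refine tendsto_integral_filter_of_dominated_convergence
      (fun _ => Cg * M + Ct * M ^ 2) ?_ ?_ (integrable_const _) ?_
    · exact Eventually.of_forall fun r => (((hφc.measurable.comp (hXm r)).sub
        (hφc.measurable.comp (hYm r))).const_mul _).aestronglyMeasurable
    · have h1 : Ioo s (s + 1) ∈ 𝓝[>] s := Ioo_mem_nhdsGT (by linarith)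
      filter_upwards [h1] with r hr
      refine Eventually.of_forall fun p => ?_
      have hpos : 0 < r - s := sub_pos.2 hr.1
      rw [norm_mul, norm_inv, Real.norm_of_nonneg hpos.le, inv_mul_le_iff₀ hpos, hXY r hr.1 p]
      have h2 := hCt (Y r p) (D r p)
      have h3 := hDle r hr.1 p
      have h4 : |inner ℝ (torusGradient φ (Y r p)) (D r p)| ≤ Cg * (M * (r - s)) :=
        (abs_real_inner_le_norm _ _).trans (mul_le_mul (hCg _) h3 (norm_nonneg _) hCg0)
      have h5 : Ct * ‖D r p‖ ^ 2 ≤ Ct * (M * (r - s)) ^ 2 := by gcongr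
      have h6 : (r - s) ^ 2 ≤ r - s := by nlinarith [hr.2]
      rw [Real.norm_eq_abs]
      have h7 : Ct * (M * (r - s)) ^ 2 ≤ Ct * M ^ 2 * (r - s) := by
        rw [mul_pow, ← mul_assoc]; gcongr
      have h8 : φ (Y r p + proj (D r p)) - φ (Y r p) = (φ (Y r p + proj (D r p)) - φ (Y r p) -
        inner ℝ (torusGradient φ (Y r p)) (D r p)) + inner ℝ (torusGradient φ (Y r p)) (D r p) := by
          ring
      rw [h8]
      refine (abs_add_le _ _).trans ?_
      linarith
    · refine Eventually.of_forall fun p => ?_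
      have hD : Tendsto (fun r => (r - s)⁻¹ • D r p) (𝓝[>] s) (𝓝 (g s (X s p))) := by
        have h1 : HasDerivAt (fun r => D r p) (g s (X s p)) s :=
          intervalIntegral.integral_hasDerivAt_right ((hgXc p).intervalIntegrable _ _)
            ((hgXc p).stronglyMeasurableAtFilter _ _) (hgXc p).continuousAt
        have h2 := (hasDerivWithinAt_iff_tendsto_slope' (s := Ioi s) (by simp)).1
          h1.hasDerivWithinAt
        refine h2.congr fun r => ?_
        simp [slope, D]
      have hYc : Tendsto (fun r => Y r p) (𝓝[>] s) (𝓝 (X s p)) := by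
        have : Continuous fun r => Y r p := by
          have := hN.cont p.2
          simp only [Y]; fun_prop
        have h2 := this.tendsto s
        simp only [Y, sub_self, smul_zero, proj_zero, add_zero] at h2
        exact h2.mono_left nhdsWithin_le_nhds
      have h1 := (hφ.continuous_torusGradient.tendsto _).comp hYc
      have h2 := h1.inner (𝕜 := ℝ) hD
      have h3 : Tendsto (fun r => (r - s)⁻¹ * (φ (X r p) - φ (Y r p) -
          inner ℝ (torusGradient φ (Y r p)) (D r p))) (𝓝[>] s) (𝓝 0) := by
        refine squeeze_zero_norm' (a := fun r => Ct * M ^ 2 * (r - s)) ?_ ?_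
        · filter_upwards [self_mem_nhdsWithin] with r hr
          have hr : s < r := hr
          have hpos : 0 < r - s := sub_pos.2 hr
          rw [norm_mul, norm_inv, Real.norm_of_nonneg hpos.le, inv_mul_le_iff₀ hpos, hXY r hr p]
          refine (hCt (Y r p) (D r p)).trans ?_
          have := hDle r hr p
          calc Ct * ‖D r p‖ ^ 2 ≤ Ct * (M * (r - s)) ^ 2 := by gcongr
            _ = _ := by ring
        · have : Continuous fun r => Ct * M ^ 2 * (r - s) := by fun_prop
          have h2 := this.tendsto s
          simp only [sub_self, mul_zero] at h2
          exact h2.mono_left nhdsWithin_le_nhds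
      have h4 := h3.add h2
      rw [zero_add, real_inner_comm] at h4
      refine h4.congr fun r => ?_
      simp only [Function.comp, inner_smul_right]
      ring
  -- the noise: its increment is averaged out by the heat semigroup
  have hpart2 : Tendsto (fun r => (r - s)⁻¹ * ∫ p, (φ (Y r p) - φ (X s p)) ∂Q) (𝓝[>] s)
      (𝓝 (∫ p, κ ^ 2 / 2 * torusLaplacian φ (X s p) ∂Q)) := by
    rw [tendsto_iff_norm_sub_tendsto_zero]
    refine squeeze_zero' (g := fun r => Ch * κ ^ 3 * √(r - s))
      (Eventually.of_forall fun _ => norm_nonneg _) ?_ ?_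
    · filter_upwards [self_mem_nhdsWithin] with r hr
      have hr : s < r := hr
      have hpos : 0 < r - s := sub_pos.2 hr
      have hint : ∫ p, φ (Y r p) ∂Q = ∫ p, torusHeat (κ * √(r - s)) φ (X s p) ∂Q := by
        have := integral_add_increment hN κ ν hs hpos.le (hX.adapted s) hφ
        rwa [add_sub_cancel] at this
      have hi1 := integrable_comp_torus (Q := Q) (hXm s).aemeasurable
        (hφ.torusHeat (κ * √(r - s))).continuous
      have hi2 := integrable_comp_torus (Q := Q) (hXm s).aemeasurable hφc
      have hi3 := (integrable_comp_torus (Q := Q) (hXm s).aemeasurable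
        hφ.continuous_torusLaplacian).const_mul (κ ^ 2 / 2)
      have e : (r - s)⁻¹ * ∫ p, (φ (Y r p) - φ (X s p)) ∂Q -
          ∫ p, κ ^ 2 / 2 * torusLaplacian φ (X s p) ∂Q = (r - s)⁻¹ *
          ∫ p, (torusHeat (κ * √(r - s)) φ (X s p) - φ (X s p) -
            (r - s) * (κ ^ 2 / 2 * torusLaplacian φ (X s p))) ∂Q := by
        rw [integral_sub (integrable_comp_torus (hYm r).aemeasurable hφc) hi2, hint,
          integral_sub (f := fun p => torusHeat (κ * √(r - s)) φ (X s p) - φ (X s p))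
            (hi1.sub hi2) (hi3.const_mul _), integral_sub hi1 hi2, integral_const_mul (r - s)]
        field_simp
      rw [e, norm_mul, norm_inv, Real.norm_of_nonneg hpos.le, inv_mul_le_iff₀ hpos]
      refine (norm_integral_le_of_norm_le_const (C := Ch * (κ * √(r - s)) ^ 3)
        (Eventually.of_forall fun p => ?_)).trans (le_of_eq ?_)
      · have h1 := hCh (κ * √(r - s)) 0 (κ * √(r - s)) (X s p) (by positivity) (by ring)
        rw [torusHeat_zero, mul_pow, Real.sq_sqrt hpos.le] at h1
        rw [Real.norm_eq_abs]
        refine le_trans (le_of_eq ?_) h1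
        congr 1
        ring
      · simp only [probReal_univ, mul_one]
        rw [mul_pow, pow_succ (√(r - s)) 2, Real.sq_sqrt hpos.le]
        ring
    · have : Continuous fun r => Ch * κ ^ 3 * √(r - s) := by fun_prop
      have h2 := this.tendsto s
      simp only [sub_self, Real.sqrt_zero, mul_zero] at h2
      exact h2.mono_left nhdsWithin_le_nhds
  have hsum := hpart1.add hpart2
  rw [← integral_add (integrable_comp_torus (hXm s).aemeasurable hgφ)
    ((integrable_comp_torus (hXm s).aemeasurable hφ.continuous_torusLaplacian).const_mul _)] at hsum
  refine hsum.congr fun r => ?_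
  have hiX := integrable_comp_torus (Q := Q) (hXm r).aemeasurable hφc
  have hiY := integrable_comp_torus (Q := Q) (hYm r).aemeasurable hφc
  have hiS := integrable_comp_torus (Q := Q) (hXm s).aemeasurable hφc
  rw [integral_const_mul, integral_sub hiX hiY, integral_sub hiY hiS, slope_def_field]
  field_simp
  ring

/-- The law of a stochastic flow solves the associated Fokker–Planck equation. -/
theorem IsFlow.isFokkerPlanckSolution (hN : IsNoise P N) (hX : IsFlow N κ g X) (hκ : 0 ≤ κ)
    (hg : Continuous (Function.uncurry g)) {M : ℝ} (hM : ∀ r x, ‖g r x‖ ≤ M) (ν : PT d)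
    {t : ℝ} (ht : 0 ≤ t) {F : ℝ → Torus d → PT d → E d} {m : ℝ → PT d}
    (hm : ∀ r, m r = lawOf ((ν : Measure (Torus d)).prod P) (X r))
    (hF : ∀ r ∈ Icc 0 t, ∀ y, F (t - r) y (m r) = g r y) :
    IsFokkerPlanckSolution (κ ^ 2 / 2) F t ν m := by
  set Q : Measure (Torus d × Ω) := (ν : Measure (Torus d)).prod P with hQ
  have hXm := hX.measurable hN
  have hgr : ∀ r, Continuous (g r) := fun r =>
    hg.comp (by fun_prop : Continuous fun x => (r, x))
  have hpair : ∀ φ, IsSmooth φ → ∀ r, Continuous fun y => inner ℝ (g r y) (torusGradient φ y) :=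
    fun φ hφ r => (hgr r).inner hφ.continuous_torusGradient
  have hcont : ∀ f : ℝ → Torus d → ℝ, Continuous (Function.uncurry f) → (∃ C, ∀ r x, |f r x| ≤ C) →
      Continuous fun r => ∫ y, f r y ∂(m r : Measure (Torus d)) := fun f hf ⟨C, hC⟩ => by
    have hfr : ∀ r, Continuous (f r) := fun r =>
      hf.comp (by fun_prop : Continuous fun x => (r, x))
    simp_rw [hm, integral_lawOf (hXm _).aemeasurable (hfr _)]
    refine continuous_of_dominated (bound := fun _ => C) (fun r => ?_)
      (fun r => Eventually.of_forall fun p => hC r _) (integrable_const _)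
      (Eventually.of_forall fun p => hf.comp (continuous_id.prodMk (hX.cont p)))
    exact ((hfr r).measurable.comp (hXm r)).aestronglyMeasurable
  have hpairc : ∀ φ, IsSmooth φ → Continuous fun r =>
      ∫ y, inner ℝ (g r y) (torusGradient φ y) ∂(m r : Measure (Torus d)) := fun φ hφ => by
    refine hcont (fun r y => inner ℝ (g r y) (torusGradient φ y))
      (hg.inner (hφ.continuous_torusGradient.comp continuous_snd)) ?_
    obtain ⟨C, hC0, hC⟩ := hφ.exists_torusGradient_bound
    exact ⟨M * C, fun r x => (abs_real_inner_le_norm _ _).trans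
      (mul_le_mul (hM _ _) (hC _) (norm_nonneg _) ((norm_nonneg _).trans (hM 0 0)))⟩
  have hlapc : ∀ φ, IsSmooth φ → Continuous fun r =>
      ∫ y, torusLaplacian φ y ∂(m r : Measure (Torus d)) := fun φ hφ => by
    refine hcont (fun _ y => torusLaplacian φ y)
      (hφ.continuous_torusLaplacian.comp continuous_snd) ?_
    obtain ⟨C, hC⟩ := (isCompact_range hφ.continuous_torusLaplacian).isBounded.exists_norm_le
    exact ⟨C, fun r x => hC _ ⟨x, rfl⟩⟩
  have hφm : ∀ φ, IsSmooth φ → Continuous fun r => ∫ y, φ y ∂(m r : Measure (Torus d)) :=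
    fun φ hφ => by
    refine hcont (fun _ y => φ y) (hφ.continuous.comp continuous_snd) ?_
    obtain ⟨C, hC⟩ := (isCompact_range hφ.continuous).isBounded.exists_norm_le
    exact ⟨C, fun r x => hC _ ⟨x, rfl⟩⟩
  have hinit : m 0 = ν := by
    have h0 : X 0 = Prod.fst := by
      ext1 p
      rw [hX.eq 0 le_rfl p]
      simp [hN.zero 0 p.2 le_rfl]
    refine Subtype.ext ?_
    change (m 0 : Measure (Torus d)) = (ν : Measure (Torus d))
    rw [hm, coe_lawOf (hXm 0).aemeasurable, h0, Measure.map_fst_prod]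
    simp
  refine ⟨?_, hinit, ?_, fun φ hφ => ?_, fun φ hφ s hs => ?_⟩
  · refine Continuous.continuousOn (continuous_iff_continuousAt.2 fun r₀ => tendsto_of_d1 ?_)
    simp_rw [hm]
    exact tendsto_d1_lawOf hXm hX.cont r₀
  · refine (ae_restrict_mem measurableSet_Ioc).mono fun r hr => ?_
    simp_rw [hF r ⟨hr.1.le, hr.2⟩]
    exact integrable_torus (hgr r) _
  · refine ((hpairc φ hφ).intervalIntegrable 0 t).congr_ae ?_
    refine (ae_restrict_mem measurableSet_uIoc).mono fun r hr => ?_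
    rw [uIoc_of_le ht] at hr
    simp_rw [hF r ⟨hr.1.le, hr.2⟩]
  · have hder : ∀ r ∈ Ioo 0 s, HasDerivWithinAt (fun r => ∫ y, φ y ∂(m r : Measure (Torus d)))
        ((∫ y, inner ℝ (g r y) (torusGradient φ y) ∂(m r : Measure (Torus d))) +
          κ ^ 2 / 2 * ∫ y, torusLaplacian φ y ∂(m r : Measure (Torus d))) (Ioi r) r := by
      intro r hr
      have := hX.hasDerivWithinAt_integral hN hκ hg hM ν hφ hr.1.le
      rw [integral_add (integrable_comp_torus (hXm r).aemeasurable (hpair φ hφ r))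
        ((integrable_comp_torus (hXm r).aemeasurable hφ.continuous_torusLaplacian).const_mul _),
        integral_const_mul] at this
      simp_rw [hm, integral_lawOf (hXm _).aemeasurable (hpair φ hφ r),
        integral_lawOf (hXm _).aemeasurable hφ.continuous,
        integral_lawOf (hXm _).aemeasurable hφ.continuous_torusLaplacian]
      exact this
    have h1 := intervalIntegral.integral_eq_sub_of_hasDeriv_right_of_le hs.1
      (hφm φ hφ).continuousOn hder (((hpairc φ hφ).add
        ((hlapc φ hφ).const_mul _)).intervalIntegrable 0 s)
    rw [hinit] at h1
    rw [eq_add_of_sub_eq' h1.symm]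
    congr 1
    refine intervalIntegral.integral_congr fun r hr => ?_
    rw [uIcc_of_le hs.1] at hr
    simp_rw [hF r ⟨hr.1, hr.2.trans hs.2⟩]

end ito

/-! ### Solutions of the characteristic system -/

/-- `f` is `K`-Lipschitz in space and measure. -/
def LipXM {d : ℕ} (K : ℝ) (f : Torus d → PT d → E d) : Prop :=
  ∀ x x' m m', ‖f x m - f x' m'‖ ≤ K * (dist x x' + d1 m m')

section Lip
variable {d : ℕ} {f : Torus d → PT d → E d}

lemma lipXM_of_Lip_le {C : ℝ≥0} (h : Lip f ≤ C) : LipXM C f := by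
  have hx : ∀ x x' m, ‖f x m - f x' m‖ ≤ C * dist x x' := fun x x' m => by
    rcases (dist_nonneg (x := x) (y := x')).eq_or_lt with h0 | h0
    · rw [dist_eq_zero.1 h0.symm]; simp
    · have h1 : ENNReal.ofReal (‖f x m - f x' m‖ / dist x x') ≤ C := by
        refine le_trans ?_ (le_self_add.trans h)
        exact le_iSup_of_le x (le_iSup_of_le x' (le_iSup_of_le m le_rfl))
      rw [ENNReal.ofReal_le_iff_le_toReal ENNReal.coe_ne_top, ENNReal.coe_toReal,
        div_le_iff₀ h0] at h1
      exact h1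
  have hm : ∀ x m m', ‖f x m - f x m'‖ ≤ C * d1 m m' := fun x m m' => by
    rcases (d1_nonneg m m').eq_or_lt with h0 | h0
    · rw [eq_of_d1_eq_zero h0.symm]; simp
    · have h1 : ENNReal.ofReal (‖f x m - f x m'‖ / d1 m m') ≤ C := by
        refine le_trans ?_ (le_add_self.trans h)
        exact le_iSup_of_le x (le_iSup_of_le m (le_iSup_of_le m' le_rfl))
      rw [ENNReal.ofReal_le_iff_le_toReal ENNReal.coe_ne_top, ENNReal.coe_toReal,
        div_le_iff₀ h0] at h1
      exact h1
  intro x x' m m'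
  calc ‖f x m - f x' m'‖ = ‖(f x m - f x' m) + (f x' m - f x' m')‖ := by congr 1; abel
    _ ≤ C * dist x x' + C * d1 m m' := (norm_add_le _ _).trans (add_le_add (hx _ _ _) (hm _ _ _))
    _ = _ := by ring

/-- The factor `2` appears because `Lip` is the sum of the Lipschitz constants in space and in
measure. -/
lemma LipXM.Lip_le {K : ℝ} (hK : 0 ≤ K) (h : LipXM K f) : Lip f ≤ ((2 * K).toNNReal : ℝ≥0) := by
  have e : (((2 * K).toNNReal : ℝ≥0) : ℝ≥0∞) = ENNReal.ofReal K + ENNReal.ofReal K := by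
    rw [← ENNReal.ofReal_add hK hK, ← two_mul]; rfl
  rw [e, Lip]
  refine add_le_add (iSup_le fun x => iSup_le fun y => iSup_le fun m => ?_)
    (iSup_le fun x => iSup_le fun m => iSup_le fun m' => ?_)
  · refine ENNReal.ofReal_le_ofReal (div_le_of_le_mul₀ dist_nonneg hK ?_)
    simpa using h x y m m
  · refine ENNReal.ofReal_le_ofReal (div_le_of_le_mul₀ (d1_nonneg _ _) hK ?_)
    simpa using h x x m m'

lemma LipXM.continuous {K : ℝ} (h : LipXM K f) (m : PT d) : Continuous fun x => f x m :=
  continuous_of_dist_le (C := K) fun x x' => by simpa using h x x' m m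

lemma LipXM.mono {K K' : ℝ} (h : LipXM K f) (hK : K ≤ K') : LipXM K' f := fun x x' m m' =>
  (h x x' m m').trans (mul_le_mul_of_nonneg_right hK (add_nonneg dist_nonneg (d1_nonneg _ _)))

instance : Nonempty (PT d) := ⟨⟨Measure.dirac 0, inferInstance⟩⟩

lemma LipXM.exists_bound {K : ℝ} (h : LipXM K f) : ∃ M, 0 ≤ M ∧ ∀ x m, ‖f x m‖ ≤ M := by
  obtain ⟨m₀⟩ : Nonempty (PT d) := inferInstance
  refine ⟨‖f 0 m₀‖ + |K| * (√d + 2 * √d), by positivity, fun x m => ?_⟩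
  have h1 := h x 0 m m₀
  have h2 : K * (dist x 0 + d1 m m₀) ≤ |K| * (√d + 2 * √d) :=
    mul_le_mul (le_abs_self K) (add_le_add (dist_torus_le _ _) (d1_le_two_sqrt _ _))
      (add_nonneg dist_nonneg (d1_nonneg _ _)) (abs_nonneg _)
  linarith [norm_le_norm_add_norm_sub' (f x m) (f 0 m₀)]

end Lip

/-- `G` is `L`-Lipschitz in all its variables and grows at most linearly in the second one. -/
structure IsCoeff {d : ℕ} (L : ℝ) (G : Torus d → E d → PT d → E d) : Prop where
  lip : ∀ x x' p p' m m', ‖G x p m - G x' p' m'‖ ≤ L * (dist x x' + ‖p - p'‖ + d1 m m')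
  growth : ∀ x p m, ‖G x p m‖ ≤ L * (1 + ‖p‖)

lemma IsLipschitzXPM.exists_isCoeff {d : ℕ} {G : Torus d → E d → PT d → E d}
    (h : IsLipschitzXPM G) : ∃ L₀, ∀ L, L₀ ≤ L → IsCoeff L fun x p m => -G x p m := by
  obtain ⟨C, hC⟩ := h
  obtain ⟨m₀⟩ : Nonempty (PT d) := inferInstance
  refine ⟨‖G 0 0 m₀‖ + |C| * (1 + 3 * √d), fun L hL => ⟨fun x x' p p' m m' => ?_, fun x p m => ?_⟩⟩
  · rw [neg_sub_neg, norm_sub_rev]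
    refine (hC x x' p p' m m').trans ?_
    refine mul_le_mul_of_nonneg_right ?_
      (add_nonneg (add_nonneg dist_nonneg (norm_nonneg _)) (d1_nonneg _ _))
    have h1 : 0 ≤ |C| * (3 * √d) := by positivity
    linarith [le_abs_self C, norm_nonneg (G 0 0 m₀)]
  · rw [norm_neg]
    have h1 := hC x 0 p 0 m m₀
    rw [sub_zero] at h1
    have h2 : C * (dist x 0 + ‖p‖ + d1 m m₀) ≤ |C| * (√d + ‖p‖ + 2 * √d) :=
      mul_le_mul (le_abs_self C) (add_le_add (add_le_add (dist_torus_le _ _) le_rfl)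
        (d1_le_two_sqrt _ _)) (add_nonneg (add_nonneg dist_nonneg (norm_nonneg _)) (d1_nonneg _ _))
        (abs_nonneg _)
    have h3 := norm_le_norm_add_norm_sub' (G x p m) (G 0 0 m₀)
    have h4 : (‖G 0 0 m₀‖ + |C| * (1 + 3 * √d)) * (1 + ‖p‖) ≤ L * (1 + ‖p‖) :=
      mul_le_mul_of_nonneg_right hL (by positivity)
    have h5 : 0 ≤ |C| * (3 * √d) * ‖p‖ := by positivity
    have h6 : 0 ≤ ‖G 0 0 m₀‖ * ‖p‖ := by positivity
    nlinarith [abs_nonneg C]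

/-- The coefficients `b` of the stochastic differential equation, `F` of the Fokker–Planck equation
and `A` of the running payoff, together with the two diffusivities. -/
structure Coeffs (d : ℕ) where
  b : Torus d → E d → PT d → E d
  F : Torus d → E d → PT d → E d
  A : Torus d → E d → PT d → E d
  σ : ℝ
  σ' : ℝ

/-- All coefficients are `L`-Lipschitz and both diffusivities are positive. -/
structure Coeffs.IsLip {d : ℕ} (c : Coeffs d) (L : ℝ) : Prop where
  nonneg : 0 ≤ L
  b : IsCoeff L c.b
  F : IsCoeff L c.F
  A : IsCoeff L c.A
  σ_pos : 0 < c.σ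
  σ'_pos : 0 < c.σ'

/-- `(X, m)` solves the characteristic system of `V` on `[0, t]` from `(x, μ)`, and the payoff with
terminal datum `V₀` is integrable. -/
structure IsChar {Ω : Type*} [MeasurableSpace Ω] {d : ℕ} (P : Measure Ω)
    (β : Fin d → ℝ≥0 → Ω → ℝ) (c : Coeffs d) (V₀ : Torus d → PT d → E d)
    (V : ℝ → Torus d → PT d → E d) (t : ℝ) (x : Torus d) (μ : PT d) (X : ℝ → Ω → Torus d)
    (m : ℝ → PT d) : Prop where
  fp : IsFokkerPlanckSolution c.σ' (fun s y ν => c.F y (V s y ν) ν) t μ m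
  sde : IsSDESolution P β c.σ (fun s y ν => c.b y (V s y ν) ν) t x m X
  int : Integrable (fun z : ℝ × Ω => c.A (X z.1 z.2) (V (t - z.1) (X z.1 z.2) (m z.1)) (m z.1))
    ((volume.restrict (Ioc 0 t)).prod P)
  int₀ : Integrable (fun ω => V₀ (X t ω) (m t)) P

/-- The expected payoff along `(X, m)`. -/
def payoff {Ω : Type*} [MeasurableSpace Ω] {d : ℕ} (P : Measure Ω) (c : Coeffs d)
    (V₀ : Torus d → PT d → E d) (V : ℝ → Torus d → PT d → E d) (t : ℝ) (X : ℝ → Ω → Torus d)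
    (m : ℝ → PT d) : E d :=
  ∫ ω, ((∫ s in (0 : ℝ)..t, c.A (X s ω) (V (t - s) (X s ω) (m s)) (m s)) + V₀ (X t ω) (m t)) ∂P

/-- Stability of integral equations on the torus driven by a common additive noise `n`, which
cancels in the difference. The term `D * e^{lam r}` stands for the distance of the measures on
which the two drifts depend. -/
lemma path_stability {d : ℕ} {x₁ x₂ : Torus d} {n u₁ u₂ : ℝ → E d} {X₁ X₂ : ℝ → Torus d}
    {S L D lam : ℝ} {e : ℝ → ℝ} (hL : 0 ≤ L) (hD : 0 ≤ D) (hlam0 : 0 < lam) (hlam : 4 * L ≤ lam)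
    (hec : Continuous e) (he0 : ∀ r, 0 ≤ e r)
    (h₁ : ∀ s ∈ Icc 0 S, X₁ s = x₁ + proj ((∫ r in (0 : ℝ)..s, u₁ r) + n s))
    (h₂ : ∀ s ∈ Icc 0 S, X₂ s = x₂ + proj ((∫ r in (0 : ℝ)..s, u₂ r) + n s))
    (hi₁ : IntervalIntegrable u₁ volume 0 S) (hi₂ : IntervalIntegrable u₂ volume 0 S)
    (hu : ∀ r ∈ Icc 0 S, ‖u₁ r - u₂ r‖ ≤ e r + L * (dist (X₁ r) (X₂ r) + D * Real.exp (lam * r))) :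
    ∀ s ∈ Icc 0 S, dist (X₁ s) (X₂ s) ≤
      2 * (dist x₁ x₂ + (∫ r in (0 : ℝ)..S, e r) + D / 4) * Real.exp (lam * s) := by
  intro s₀ hs₀
  have hS : 0 ≤ S := hs₀.1.trans hs₀.2
  have hI : 0 ≤ ∫ q in (0 : ℝ)..S, e q := intervalIntegral.integral_nonneg hS fun q _ => he0 q
  refine le_of_weighted_improvement (u := fun _ : Unit => fun r => dist (X₁ r) (X₂ r)) (C := √d)
    (by positivity) hlam0.le (fun _ r _ => dist_torus_le _ _) ?_ () s₀ hs₀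
  intro N hN hu' _ s hs
  replace hu' := hu' ()
  have hsub : uIcc 0 s ⊆ uIcc 0 S := by
    rw [uIcc_of_le hs.1, uIcc_of_le hS]; exact Icc_subset_Icc_right hs.2
  rw [h₁ s hs, h₂ s hs]
  refine (dist_add_proj_le _ _ _ _).trans ?_
  rw [add_sub_add_right_eq_sub, ← intervalIntegral.integral_sub (hi₁.mono_set hsub)
    (hi₂.mono_set hsub)]
  have h3 : ‖∫ r in (0 : ℝ)..s, (u₁ r - u₂ r)‖ ≤
      ∫ r in (0 : ℝ)..s, (e r + L * (N + D) * Real.exp (lam * r)) := by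
    refine intervalIntegral.norm_integral_le_of_norm_le hs.1 (Eventually.of_forall fun r hr => ?_)
      (Continuous.intervalIntegrable (by fun_prop) _ _)
    have hr' : r ∈ Icc 0 S := ⟨hr.1.le, hr.2.trans hs.2⟩
    refine (hu r hr').trans ?_
    have := mul_le_mul_of_nonneg_left (hu' r hr') hL
    linarith
  rw [intervalIntegral.integral_add (hec.intervalIntegrable _ _)
    (Continuous.intervalIntegrable (by fun_prop) _ _), intervalIntegral.integral_const_mul] at h3
  have e2 : (∫ q in (0 : ℝ)..s, e q) ≤ ∫ q in (0 : ℝ)..S, e q :=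
    intervalIntegral.integral_mono_interval le_rfl hs.1 hs.2
      (Eventually.of_forall he0) (hec.intervalIntegrable _ _)
  have e3 : 1 ≤ Real.exp (lam * s) := Real.one_le_exp (mul_nonneg hlam0.le hs.1)
  have e4 : L * (N + D) * ∫ r in (0 : ℝ)..s, Real.exp (lam * r) ≤
      (N + D) / 4 * Real.exp (lam * s) := by
    calc L * (N + D) * ∫ r in (0 : ℝ)..s, Real.exp (lam * r)
        ≤ L * (N + D) * (Real.exp (lam * s) / lam) :=
          mul_le_mul_of_nonneg_left (integral_exp_le hlam0 s) (by positivity)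
      _ = (L / lam) * ((N + D) * Real.exp (lam * s)) := by ring
      _ ≤ (1 / 4) * ((N + D) * Real.exp (lam * s)) := by
          refine mul_le_mul_of_nonneg_right ?_ (by positivity)
          rw [div_le_iff₀ hlam0]; linarith
      _ = _ := by ring
  have e5 : 0 ≤ N * Real.exp (lam * s) := by positivity
  have e6 : dist x₁ x₂ + (∫ q in (0 : ℝ)..S, e q) ≤
      (dist x₁ x₂ + ∫ q in (0 : ℝ)..S, e q) * Real.exp (lam * s) :=
    le_mul_of_one_le_right (by positivity) e3
  nlinarith

section stability
variable {Ω : Type*} [MeasurableSpace Ω] {d : ℕ} {P : Measure Ω} [IsProbabilityMeasure P]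
  {β : Fin d → ℝ≥0 → Ω → ℝ} {c : Coeffs d} {L : ℝ} {V₀ : Torus d → PT d → E d}

lemma IsCoeff.norm_sub_le {G : Torus d → E d → PT d → E d} (hG : IsCoeff L G) (hL : 0 ≤ L)
    {x x' : Torus d} {p p' : E d} {m m' : PT d} {e k : ℝ}
    (h : ‖p - p'‖ ≤ e + k * (dist x x' + d1 m m')) :
    ‖G x p m - G x' p' m'‖ ≤ L * e + L * (1 + k) * (dist x x' + d1 m m') := by
  refine (hG.lip _ _ _ _ _ _).trans ?_
  have := mul_le_mul_of_nonneg_left h hL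
  linarith

lemma IsCoeff.continuous {G : Torus d → E d → PT d → E d} (hG : IsCoeff L G) (m : PT d) :
    Continuous fun z : Torus d × E d => G z.1 z.2 m := by
  have : LipschitzWith (2 * L).toNNReal fun z : Torus d × E d => G z.1 z.2 m :=
    LipschitzWith.of_dist_le_mul fun z z' => by
      have hL : 0 ≤ L := by
        have := (norm_nonneg _).trans (hG.growth 0 0 m); simpa using this
      rw [dist_eq_norm, Real.coe_toNNReal _ (by positivity)]
      refine (hG.lip _ _ _ _ _ _).trans ?_
      rw [d1_self, add_zero, Prod.dist_eq, ← dist_eq_norm]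
      have h1 := le_max_left (dist z.1 z'.1) (dist z.2 z'.2)
      have h2 := le_max_right (dist z.1 z'.1) (dist z.2 z'.2)
      nlinarith
  exact this.continuous

lemma IsChar.integral_add {V : ℝ → Torus d → PT d → E d} {t : ℝ} {x : Torus d} {μ : PT d}
    {X : ℝ → Ω → Torus d} {m : ℝ → PT d} (h : IsChar P β c V₀ V t x μ X m) (ht : 0 ≤ t) :
    (∀ᵐ ω ∂P, IntervalIntegrable (fun s => c.A (X s ω) (V (t - s) (X s ω) (m s)) (m s))
      volume 0 t) ∧
    Integrable (fun ω => ∫ s in (0 : ℝ)..t, c.A (X s ω) (V (t - s) (X s ω) (m s)) (m s)) P := by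
  constructor
  · filter_upwards [h.int.prod_left_ae] with ω hω
    rw [intervalIntegrable_iff, uIoc_of_le ht]
    exact hω
  · have := h.int.integral_prod_right
    simp_rw [intervalIntegral.integral_of_le ht]
    exact this

/-- Stability of the expected payoff along the characteristics, with respect to the starting
position and measure and to the field. Only the second field needs to be Lipschitz. The
Fokker–Planck equation controls the distance of the measures, then the pathwise equation controls
the distance of the positions. -/
theorem exists_payoff_stability (hc : c.IsLip L) {M k K₀ : ℝ} (hM : 0 ≤ M) (hk : 0 ≤ k)
    (hK₀ : 0 ≤ K₀) : ∃ lam : ℝ, 0 < lam ∧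
    ∀ {t : ℝ} {V₁ V₂ : ℝ → Torus d → PT d → E d} {V₀ : Torus d → PT d → E d} {e : ℝ → ℝ}
      {x₁ x₂ : Torus d} {μ₁ μ₂ : PT d} {X₁ X₂ : ℝ → Ω → Torus d} {m₁ m₂ : ℝ → PT d},
    0 ≤ t → IsChar P β c V₀ V₁ t x₁ μ₁ X₁ m₁ → IsChar P β c V₀ V₂ t x₂ μ₂ X₂ m₂ →
    LipXM K₀ V₀ → Continuous e → (∀ s, 0 ≤ e s) →
    (∀ s ∈ Icc 0 t, ∀ y ν, ‖V₁ s y ν - V₂ s y ν‖ ≤ e s) →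
    (∀ s ∈ Icc 0 t, ∀ ν, Continuous fun y => V₁ s y ν) →
    (∀ s ∈ Icc 0 t, ∀ y ν, ‖V₂ s y ν‖ ≤ M) → (∀ s ∈ Icc 0 t, LipXM k (V₂ s)) →
    ‖payoff P c V₀ V₁ t X₁ m₁ - payoff P c V₀ V₂ t X₂ m₂‖ ≤
      L * (∫ r in (0 : ℝ)..t, e (t - r)) + (L * (1 + k) * t + K₀) *
        (5 * (dist x₁ x₂ + d1 μ₁ μ₂ + L * ∫ r in (0 : ℝ)..t, e (t - r)) * Real.exp (lam * t)) := by
  have hL := hc.nonneg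
  have hL' : 0 ≤ L * (1 + k) := by positivity
  obtain ⟨lam₀, hlam₀, hstab⟩ := exists_fokkerPlanck_stability d hc.σ'_pos
    (M := L * (1 + M)) (L := L * (1 + k)) (by positivity) hL'
  set lam : ℝ := max lam₀ (4 * (L * (1 + k))) with hlam
  have hlam0 : 0 < lam := hlam₀.trans_le (le_max_left _ _)
  refine ⟨lam, hlam0, ?_⟩
  intro t V₁ V₂ V₀ e x₁ x₂ μ₁ μ₂ X₁ X₂ m₁ m₂ ht h₁ h₂ hV₀ hec he0 he hV₁ hV₂ hV₂k
  have hmem : ∀ r ∈ Icc 0 t, t - r ∈ Icc 0 t := fun r hr =>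
    ⟨by linarith [hr.2], by linarith [hr.1]⟩
  have hec' : Continuous fun r => L * e (t - r) := by fun_prop
  have hEeq : ∫ r in (0 : ℝ)..t, L * e (t - r) = L * ∫ r in (0 : ℝ)..t, e (t - r) :=
    intervalIntegral.integral_const_mul _ _
  set I : ℝ := L * ∫ r in (0 : ℝ)..t, e (t - r) with hI
  have hI0 : 0 ≤ I := by
    rw [← hEeq]
    exact intervalIntegral.integral_nonneg ht fun q _ => mul_nonneg hL (he0 _)
  have hdiff : ∀ r ∈ Icc 0 t, ∀ y y' ν ν', ‖V₁ (t - r) y ν - V₂ (t - r) y' ν'‖ ≤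
      e (t - r) + k * (dist y y' + d1 ν ν') := fun r hr y y' ν ν' =>
    (norm_sub_le_norm_sub_add_norm_sub _ (V₂ (t - r) y ν) _).trans
      (add_le_add (he _ (hmem r hr) _ _) (hV₂k _ (hmem r hr) _ _ _ _))
  have hFP := hstab lam (le_max_left _ _) h₁.fp h₂.fp le_rfl le_rfl hec'
    (fun r => mul_nonneg hL (he0 _))
    (fun q hq => (hc.F.continuous _).comp (continuous_id.prodMk (hV₁ _ (hmem q hq) _)))
    (fun q hq y => by
      have := hc.F.norm_sub_le hL (hdiff q hq y y (m₁ q) (m₂ q))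
      rwa [dist_self, zero_add] at this)
    (fun q hq y => (hc.F.growth _ _ _).trans (by
      have := hV₂ _ (hmem q hq) y (m₂ q)
      gcongr))
    (fun q hq y y' => by
      have := hc.F.norm_sub_le (x := y) (x' := y') (m := m₂ q) (m' := m₂ q) (e := 0) hL
        ((hV₂k _ (hmem q hq) y y' (m₂ q) (m₂ q)).trans (by rw [zero_add]))
      simpa using this)
  rw [hEeq] at hFP
  have hX : ∀ᵐ ω ∂P, ∀ s ∈ Icc 0 t, dist (X₁ s ω) (X₂ s ω) + d1 (m₁ s) (m₂ s) ≤
      5 * (dist x₁ x₂ + d1 μ₁ μ₂ + I) * Real.exp (lam * t) := by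
    filter_upwards [h₁.sde.equation, h₂.sde.equation, h₁.sde.integrable, h₂.sde.integrable]
      with ω e₁ e₂ i₁ i₂ s hs
    have := path_stability (D := 2 * (d1 μ₁ μ₂ + I)) (e := fun r => L * e (t - r)) hL'
      (by have := d1_nonneg μ₁ μ₂; positivity) hlam0 (le_max_right _ _) hec'
      (fun r => mul_nonneg hL (he0 _)) e₁ e₂ i₁ i₂ (fun r hr => by
        refine (hc.b.norm_sub_le hL (hdiff r hr _ _ _ _)).trans ?_
        have := hFP r hr
        gcongr) s hs
    rw [hEeq] at this
    have h3 := hFP s hs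
    have h4 : Real.exp (lam * s) ≤ Real.exp (lam * t) := by
      have := hs.2; gcongr
    have h5 := d1_nonneg μ₁ μ₂
    calc dist (X₁ s ω) (X₂ s ω) + d1 (m₁ s) (m₂ s)
        ≤ (2 * dist x₁ x₂ + 3 * d1 μ₁ μ₂ + 5 * I) * Real.exp (lam * s) := by linarith
      _ ≤ _ := by
        refine mul_le_mul ?_ h4 (Real.exp_pos _).le (by positivity)
        linarith [dist_nonneg (x := x₁) (y := x₂)]
  set R : ℝ := 5 * (dist x₁ x₂ + d1 μ₁ μ₂ + I) * Real.exp (lam * t) with hR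
  obtain ⟨j₁, i₁⟩ := h₁.integral_add ht
  obtain ⟨j₂, i₂⟩ := h₂.integral_add ht
  have i₁' : Integrable (fun ω => (∫ s in (0 : ℝ)..t, c.A (X₁ s ω) (V₁ (t - s) (X₁ s ω) (m₁ s))
    (m₁ s)) + V₀ (X₁ t ω) (m₁ t)) P := i₁.add h₁.int₀
  have i₂' : Integrable (fun ω => (∫ s in (0 : ℝ)..t, c.A (X₂ s ω) (V₂ (t - s) (X₂ s ω) (m₂ s))
    (m₂ s)) + V₀ (X₂ t ω) (m₂ t)) P := i₂.add h₂.int₀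
  rw [payoff, payoff, ← integral_sub i₁' i₂']
  have hbound : ∀ᵐ ω ∂P, ‖((∫ s in (0 : ℝ)..t, c.A (X₁ s ω) (V₁ (t - s) (X₁ s ω) (m₁ s)) (m₁ s))
      + V₀ (X₁ t ω) (m₁ t)) - ((∫ s in (0 : ℝ)..t, c.A (X₂ s ω) (V₂ (t - s) (X₂ s ω) (m₂ s)) (m₂ s))
      + V₀ (X₂ t ω) (m₂ t))‖ ≤ I + (L * (1 + k) * t + K₀) * R := by
    filter_upwards [j₁, j₂, hX] with ω a₁ a₂ hω
    rw [add_sub_add_comm, ← intervalIntegral.integral_sub a₁ a₂]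
    have h1 : ‖V₀ (X₁ t ω) (m₁ t) - V₀ (X₂ t ω) (m₂ t)‖ ≤ K₀ * R :=
      (hV₀ _ _ _ _).trans (mul_le_mul_of_nonneg_left (hω t ⟨ht, le_rfl⟩) hK₀)
    have h2 : ‖∫ s in (0 : ℝ)..t, (c.A (X₁ s ω) (V₁ (t - s) (X₁ s ω) (m₁ s)) (m₁ s) -
        c.A (X₂ s ω) (V₂ (t - s) (X₂ s ω) (m₂ s)) (m₂ s))‖ ≤
        ∫ s in (0 : ℝ)..t, (L * e (t - s) + L * (1 + k) * R) := by
      refine intervalIntegral.norm_integral_le_of_norm_le ht (Eventually.of_forall fun r hr => ?_)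
        ((hec'.add continuous_const).intervalIntegrable _ _)
      have hr' : r ∈ Icc 0 t := ⟨hr.1.le, hr.2⟩
      exact (hc.A.norm_sub_le hL (hdiff r hr' _ _ _ _)).trans
        (add_le_add le_rfl (mul_le_mul_of_nonneg_left (hω r hr') hL'))
    rw [intervalIntegral.integral_add (hec'.intervalIntegrable _ _)
      (continuous_const.intervalIntegrable _ _), hEeq, intervalIntegral.integral_const,
      sub_zero, smul_eq_mul] at h2
    refine (norm_add_le _ _).trans ?_
    linarith
  exact (norm_integral_le_of_norm_le_const hbound).trans (by simp)

end stability

/-! ### Construction of characteristics -/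

section construction
variable {Ω : Type*} [MeasurableSpace Ω] {d : ℕ} {P : Measure Ω} [IsProbabilityMeasure P]
  {β : Fin d → ℝ≥0 → Ω → ℝ} {N : ℝ → Ω → E d} {c : Coeffs d} {L M k : ℝ}
  {V : ℝ → Torus d → PT d → E d}

lemma IsCoeff.comp_isLipCoeff {G : Torus d → E d → PT d → E d} (hG : IsCoeff L G) (hL : 0 ≤ L)
    (hV : IsLipCoeff M k V) (t : ℝ) :
    IsLipCoeff (L * (1 + M)) (L * (1 + k)) fun r y ν => G y (V (t - r) y ν) ν where
  bound s x m := (hG.growth _ _ _).trans (by have := hV.bound (t - s) x m; gcongr)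
  lip s x x' m m' := by
    simpa using hG.norm_sub_le (e := 0) hL ((hV.lip (t - s) x x' m m').trans (zero_add _).ge)
  cont x m := (hG.continuous m).comp (continuous_const.prodMk
    ((hV.cont x m).comp (continuous_const.sub continuous_id)))

/-- A curve `m` of measures and a flow `Y`, defined for all times, solving the characteristic
system of `V` with time to go `t` from the initial measure `μ`. -/
structure IsFlowChar (N : ℝ → Ω → E d) (c : Coeffs d) (V : ℝ → Torus d → PT d → E d) (t : ℝ)
    (μ : PT d) (m : ℝ → PT d) (Y : ℝ → Torus d × Ω → Torus d) : Prop where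
  cont : ∀ r₀, Tendsto (fun r => d1 (m r) (m r₀)) (𝓝 r₀) (𝓝 0)
  fp : ∀ S, 0 ≤ S →
    IsFokkerPlanckSolution c.σ' (fun s y ν => c.F y (V (t - (S - s)) y ν) ν) S μ m
  flow : IsFlow N √(2 * c.σ) (fun r y => c.b y (V (t - r) y (m r)) (m r)) Y

/-- Coefficients evaluated along a continuous curve of measures are jointly continuous. -/
lemma continuous_coeff_along {G : Torus d → E d → PT d → E d} (hG : IsCoeff L G) (hL : 0 ≤ L)
    (hV : IsLipCoeff M k V) (t : ℝ) {m : ℝ → PT d}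
    (hm : ∀ r₀, Tendsto (fun r => d1 (m r) (m r₀)) (𝓝 r₀) (𝓝 0)) :
    Continuous (Function.uncurry fun r y => G y (V (t - r) y (m r)) (m r)) :=
  ((hG.comp_isLipCoeff hL hV t).continuous_uncurry hm).comp
    (continuous_fst.prodMk continuous_id)

/-- The curve of measures is the law of an auxiliary flow of diffusivity `σ'`, driven by the same
noise. Once it is known, the flow of diffusivity `σ` solves an equation with given drift. -/
theorem exists_isFlowChar (hc : c.IsLip L) (hN : IsNoise P N) (hV : IsLipCoeff M k V) (hM : 0 ≤ M)
    (hk : 0 ≤ k) (t : ℝ) (μ : PT d) : ∃ m Y, IsFlowChar N c V t μ m Y := by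
  have hL := hc.nonneg
  have hF := hc.F.comp_isLipCoeff hL hV t
  obtain ⟨X, hX⟩ := exists_flow_lawOf hN √(2 * c.σ') (by positivity) (by positivity) hF μ
  have hXm := hX.measurable hN
  set m : ℝ → PT d := fun r => lawOf ((μ : Measure (Torus d)).prod P) (X r) with hm
  have hmc : ∀ r₀, Tendsto (fun r => d1 (m r) (m r₀)) (𝓝 r₀) (𝓝 0) :=
    tendsto_d1_lawOf hXm hX.cont
  have hb : IsLipCoeff (L * (1 + M)) (L * (1 + k)) fun r y (_ : PT d) =>
      c.b y (V (t - r) y (m r)) (m r) :=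
    { bound := fun s x _ => (hc.b.comp_isLipCoeff hL hV t).bound s x (m s)
      lip := fun s x x' ν ν' => by
        refine ((hc.b.comp_isLipCoeff hL hV t).lip s x x' (m s) (m s)).trans ?_
        rw [d1_self]
        exact mul_le_mul_of_nonneg_left (add_le_add le_rfl (d1_nonneg ν ν')) (by positivity)
      cont := fun x _ => (continuous_coeff_along hc.b hL hV t hmc).comp
        (continuous_id.prodMk continuous_const) }
  obtain ⟨Y, hY⟩ := exists_flow_lawOf hN √(2 * c.σ) (by positivity) (by positivity) hb μ
  refine ⟨m, Y, hmc, fun S hS => ?_, hY⟩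
  have := hX.isFokkerPlanckSolution hN (Real.sqrt_nonneg _)
    (continuous_coeff_along hc.F hL hV t hmc) (fun r x => hF.bound r x (m r)) μ hS
    (F := fun s y ν => c.F y (V (t - (S - s)) y ν) ν) (m := m) (fun r => rfl)
    (fun r _ y => by simp only [sub_sub_cancel, hm])
  have e : √(2 * c.σ') ^ 2 / 2 = c.σ' := by
    rw [Real.sq_sqrt (by have := hc.σ'_pos; positivity)]; ring
  rwa [e] at this

omit [IsProbabilityMeasure P] in
lemma IsFlow.measurable_section {κ : ℝ} {g : ℝ → Torus d → E d} {X : ℝ → Torus d × Ω → Torus d}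
    (hN : IsNoise P N) (hX : IsFlow N κ g X) (s : ℝ) (x : Torus d) :
    Measurable fun ω => X s (x, ω) :=
  (hX.measurable hN s).comp measurable_prodMk_left

omit [IsProbabilityMeasure P] in
/-- Joint measurability in time and chance of a continuous function along a flow. -/
lemma IsFlow.stronglyMeasurable_comp {κ : ℝ} {g : ℝ → Torus d → E d}
    {X : ℝ → Torus d × Ω → Torus d} (hN : IsNoise P N) (hX : IsFlow N κ g X)
    {a : ℝ → Torus d → E d} (ha : Continuous (Function.uncurry a)) :
    StronglyMeasurable fun z : ℝ × (Torus d × Ω) => a z.1 (X z.1 z.2) := by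
  refine stronglyMeasurable_uncurry_of_continuous_of_stronglyMeasurable
    (u := fun s (p : Torus d × Ω) => a s (X s p))
    (fun p => ha.comp (continuous_id.prodMk (hX.cont p))) fun s => ?_
  have : Continuous (a s) := ha.comp (by fun_prop : Continuous fun x => (s, x))
  exact (this.measurable.comp (hX.measurable hN s)).stronglyMeasurable

lemma IsFlowChar.isChar (hc : c.IsLip L) (hN : IsNoise P N)
    (hNβ : ∀ᵐ ω ∂P, ∀ s, N s ω = WithLp.toLp 2 (fun i => β i s.toNNReal ω))
    (hV : IsLipCoeff M k V) {t : ℝ} {μ : PT d} {m : ℝ → PT d} {Y : ℝ → Torus d × Ω → Torus d}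
    (h : IsFlowChar N c V t μ m Y) (ht : 0 ≤ t) {V₀ : Torus d → PT d → E d} {K₀ : ℝ}
    (hV₀ : LipXM K₀ V₀) (x : Torus d) :
    IsChar P β c V₀ V t x μ (fun s ω => Y s (x, ω)) m where
  fp := by simpa only [sub_sub_cancel] using h.fp t ht
  sde :=
    { aemeasurable := fun s _ => (h.flow.measurable_section hN s x).aemeasurable
      integrable := Eventually.of_forall fun ω => Continuous.intervalIntegrable
        ((continuous_coeff_along hc.b hc.nonneg hV t h.cont).comp
          (continuous_id.prodMk (h.flow.cont (x, ω)))) _ _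
      equation := by
        filter_upwards [hNβ] with ω hω s hs
        rw [← hω s]
        exact h.flow.eq s hs.1 (x, ω) }
  int := by
    have h1 := (h.flow.stronglyMeasurable_comp hN
      (continuous_coeff_along hc.A hc.nonneg hV t h.cont)).comp_measurable
      (measurable_fst.prodMk (measurable_const.prodMk measurable_snd) :
        Measurable fun z : ℝ × Ω => (z.1, (x, z.2)))
    refine Integrable.of_bound h1.aestronglyMeasurable (L * (1 + M))
      (Eventually.of_forall fun z => ?_)
    exact (hc.A.comp_isLipCoeff hc.nonneg hV t).bound _ _ _
  int₀ := integrable_comp_torus (h.flow.measurable_section hN t x).aemeasurable (hV₀.continuous _)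

lemma norm_payoff_le (hc : c.IsLip L) {V₀ : Torus d → PT d → E d} {t : ℝ}
    {X : ℝ → Ω → Torus d} {m : ℝ → PT d} {M₀ : ℝ} {v : ℝ → ℝ} (ht : 0 ≤ t) (hv : Continuous v)
    (hV : ∀ s ∈ Icc 0 t, ∀ y ν, ‖V s y ν‖ ≤ v s) (hV₀ : ∀ y ν, ‖V₀ y ν‖ ≤ M₀) :
    ‖payoff P c V₀ V t X m‖ ≤ (∫ s in (0 : ℝ)..t, L * (1 + v (t - s))) + M₀ := by
  refine (norm_integral_le_of_norm_le_const (C := (∫ s in (0 : ℝ)..t, L * (1 + v (t - s))) + M₀)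
    (Eventually.of_forall fun ω => ?_)).trans (by simp)
  refine (norm_add_le _ _).trans (add_le_add ?_ (hV₀ _ _))
  refine intervalIntegral.norm_integral_le_of_norm_le ht (Eventually.of_forall fun r hr => ?_)
    (Continuous.intervalIntegrable (by fun_prop) _ _)
  refine (hc.A.growth _ _ _).trans ?_
  have := hV (t - r) ⟨by linarith [hr.2], by linarith [hr.1]⟩ (X r ω) (m r)
  have := hc.nonneg
  gcongr

/-- Continuity in time of the expected payoff. -/
lemma IsLipCoeff.continuousOn_payoff (hc : c.IsLip L) (hN : IsNoise P N)
    (hNβ : ∀ᵐ ω ∂P, ∀ s, N s ω = WithLp.toLp 2 (fun i => β i s.toNNReal ω))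
    (hV : IsLipCoeff M k V) (hM : 0 ≤ M) (hk : 0 ≤ k) {V₀ : Torus d → PT d → E d} {K₀ : ℝ}
    (hK₀ : 0 ≤ K₀) (hV₀ : LipXM K₀ V₀) {μ : PT d} {m : ℝ → ℝ → PT d}
    {Y : ℝ → ℝ → Torus d × Ω → Torus d} (h : ∀ t, IsFlowChar N c V t μ (m t) (Y t)) (x : Torus d) :
    ContinuousOn (fun t => payoff P c V₀ V t (fun s ω => Y t s (x, ω)) (m t)) (Ici 0) := by
  intro t ht
  have ht : 0 ≤ t := ht
  have hL := hc.nonneg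
  have hL' : 0 ≤ L * (1 + k) := by positivity
  obtain ⟨lam₀, hlam₀, hstab⟩ := exists_fokkerPlanck_stability d hc.σ'_pos
    (M := L * (1 + M)) (L := L * (1 + k)) (by positivity) hL'
  set lam : ℝ := max lam₀ (4 * (L * (1 + k))) with hlam
  have hlam0 : 0 < lam := hlam₀.trans_le (le_max_left _ _)
  set S : ℝ := t + 1 with hS
  have hS0 : 0 ≤ S := by positivity
  -- the distance of the characteristics is controlled by the variation in time of `V` along `m t`
  have key : ∀ ε, 0 ≤ ε → ∀ t', (∀ q ∈ Icc 0 S, ∀ y,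
      ‖V (t' - q) y (m t q) - V (t - q) y (m t q)‖ ≤ ε) → ∀ ω, ∀ s ∈ Icc 0 S,
      dist (Y t' s (x, ω)) (Y t s (x, ω)) + d1 (m t' s) (m t s) ≤
        5 * (L * ε * S) * Real.exp (lam * S) := by
    intro ε hε t' he ω s hs
    have hdiff : ∀ r ∈ Icc 0 S, ∀ y y',
        ‖V (t' - r) y (m t' r) - V (t - r) y' (m t r)‖ ≤
        ε + k * (dist y y' + d1 (m t' r) (m t r)) := fun r hr y y' => by
      refine (norm_sub_le_norm_sub_add_norm_sub _ (V (t' - r) y' (m t r)) _).trans ?_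
      rw [add_comm]
      exact add_le_add (he r hr _) (hV.lip _ _ _ _ _)
    have hFP := hstab lam (le_max_left _ _) ((h t').fp S hS0) ((h t).fp S hS0) (le_refl S)
      (le_refl S) (e := fun _ => L * ε) continuous_const (fun _ => by positivity)
      (fun q hq => ((hc.F.comp_isLipCoeff hL hV _).continuous_right _ _))
      (fun q hq y => by
        have := hc.F.norm_sub_le hL (hdiff q hq y y)
        rw [dist_self, zero_add] at this
        simpa only [sub_sub_cancel] using this)
      (fun q hq y => (hc.F.comp_isLipCoeff hL hV _).bound _ _ _)
      (fun q hq y y' => by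
        simpa using (hc.F.comp_isLipCoeff hL hV _).lip (S - (S - q)) y y' (m t q) (m t q))
    have hP := path_stability (D := 2 * (L * ε * S)) (e := fun r => L * ε) hL'
      (by positivity) hlam0 (le_max_right _ _) continuous_const (fun _ => by positivity)
      (fun s hs => (h t').flow.eq s hs.1 (x, ω)) (fun s hs => (h t).flow.eq s hs.1 (x, ω))
      (((continuous_coeff_along hc.b hL hV t' (h t').cont).comp
          (continuous_id.prodMk ((h t').flow.cont (x, ω)))).intervalIntegrable _ _)
      (((continuous_coeff_along hc.b hL hV t (h t).cont).comp
          (continuous_id.prodMk ((h t).flow.cont (x, ω)))).intervalIntegrable _ _) (fun r hr => by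
        refine (hc.b.norm_sub_le hL (hdiff r hr _ _)).trans ?_
        have := hFP r hr
        simp only [d1_self, intervalIntegral.integral_const, smul_eq_mul, sub_zero,
          zero_add] at this
        have e1 : 2 * (S * (L * ε)) = 2 * (L * ε * S) := by ring
        rw [e1] at this
        gcongr) s hs
    have h1 := hFP s hs
    simp only [dist_self, d1_self, intervalIntegral.integral_const, smul_eq_mul, sub_zero,
      zero_add] at h1 hP
    have h4 : Real.exp (lam * s) ≤ Real.exp (lam * S) := by
      have := hs.2; gcongr
    calc _ ≤ 5 * (L * ε * S) * Real.exp (lam * s) := by linarith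
      _ ≤ _ := by gcongr
  set R : ℝ → ℝ := fun ε => 5 * (L * ε * S) * Real.exp (lam * S) with hR
  -- the contribution of the change of the time horizon along the characteristics for time `t`
  let ρ : ℝ → ℝ := fun t' => L * (1 + M) * |t' - t| +
    K₀ * ((∫ ω, dist (Y t t' (x, ω)) (Y t t (x, ω)) ∂P) + d1 (m t t') (m t t))
  have hρ : Tendsto ρ (𝓝 t) (𝓝 0) := by
    have h1 : Tendsto (fun t' => L * (1 + M) * |t' - t|) (𝓝 t) (𝓝 0) := by
      have : Continuous fun t' => L * (1 + M) * |t' - t| := by fun_prop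
      simpa using this.tendsto t
    have h2 := tendsto_integral_dist (Q := P) (X := fun s ω => Y t s (x, ω))
      (fun s => (h t).flow.measurable_section hN s x) (fun ω => (h t).flow.cont (x, ω)) t
    have h3 := h1.add ((h2.add ((h t).cont t)).const_mul K₀)
    simpa using h3
  have hmain : ∀ ε, 0 ≤ ε → ∀ t' ∈ Icc 0 S, (∀ q ∈ Icc 0 S, ∀ y,
      ‖V (t' - q) y (m t q) - V (t - q) y (m t q)‖ ≤ ε) →
      ‖payoff P c V₀ V t' (fun s ω => Y t' s (x, ω)) (m t') -
        payoff P c V₀ V t (fun s ω => Y t s (x, ω)) (m t)‖ ≤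
      ((L * ε + L * (1 + k) * R ε) * S + K₀ * R ε) + ρ t' := by
    intro ε hε t' ht' he
    have hkey := key ε hε t' he
    have hchar := (h t).isChar hc hN hNβ hV ht hV₀ x
    have hchar' := (h t').isChar hc hN hNβ hV ht'.1 hV₀ x
    have i₁ := (hchar'.integral_add ht'.1).2.add hchar'.int₀
    have i₂ := (hchar.integral_add ht).2.add hchar.int₀
    have hs := integral_sub i₁ i₂
    simp only [Pi.add_apply] at hs
    rw [payoff, payoff, ← hs]
    have hdint : Integrable (fun ω => dist (Y t t' (x, ω)) (Y t t (x, ω))) P :=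
      Integrable.of_bound (((h t).flow.measurable_section hN t' x).dist
        ((h t).flow.measurable_section hN t x)).aestronglyMeasurable (√d)
        (Eventually.of_forall fun ω => by
          rw [Real.norm_of_nonneg dist_nonneg]; exact dist_torus_le _ _)
    have hle : ∀ ω, ‖((∫ s in (0 : ℝ)..t', c.A (Y t' s (x, ω)) (V (t' - s) (Y t' s (x, ω)) (m t' s))
        (m t' s)) + V₀ (Y t' t' (x, ω)) (m t' t')) - ((∫ s in (0 : ℝ)..t, c.A (Y t s (x, ω))
        (V (t - s) (Y t s (x, ω)) (m t s)) (m t s)) + V₀ (Y t t (x, ω)) (m t t))‖ ≤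
        ((L * ε + L * (1 + k) * R ε) * S + K₀ * R ε + L * (1 + M) * |t' - t| +
          K₀ * d1 (m t t') (m t t)) + K₀ * dist (Y t t' (x, ω)) (Y t t (x, ω)) := by
      intro ω
      have hA' : Continuous fun s => c.A (Y t' s (x, ω)) (V (t' - s) (Y t' s (x, ω)) (m t' s))
          (m t' s) := (continuous_coeff_along hc.A hL hV t' (h t').cont).comp
        (continuous_id.prodMk ((h t').flow.cont (x, ω)))
      have hA : Continuous fun s => c.A (Y t s (x, ω)) (V (t - s) (Y t s (x, ω)) (m t s))
          (m t s) := (continuous_coeff_along hc.A hL hV t (h t).cont).comp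
        (continuous_id.prodMk ((h t).flow.cont (x, ω)))
      have e1 : ‖(∫ s in (0 : ℝ)..t', c.A (Y t' s (x, ω)) (V (t' - s) (Y t' s (x, ω)) (m t' s))
          (m t' s)) - ∫ s in (0 : ℝ)..t', c.A (Y t s (x, ω))
          (V (t - s) (Y t s (x, ω)) (m t s)) (m t s)‖ ≤ (L * ε + L * (1 + k) * R ε) * S := by
        rw [← intervalIntegral.integral_sub (hA'.intervalIntegrable _ _)
          (hA.intervalIntegrable _ _)]
        refine (intervalIntegral.norm_integral_le_of_norm_le_const
          (C := L * ε + L * (1 + k) * R ε) fun r hr => ?_).trans ?_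
        · rw [uIoc_of_le ht'.1] at hr
          have hr' : r ∈ Icc 0 S := ⟨hr.1.le, hr.2.trans ht'.2⟩
          refine (hc.A.norm_sub_le hL (e := ε) (k := k) ?_).trans
            (add_le_add le_rfl (mul_le_mul_of_nonneg_left (hkey ω r hr') hL'))
          refine (norm_sub_le_norm_sub_add_norm_sub _
            (V (t' - r) (Y t r (x, ω)) (m t r)) _).trans ?_
          rw [add_comm]
          exact add_le_add (he r hr' _) (hV.lip _ _ _ _ _)
        · rw [sub_zero, abs_of_nonneg ht'.1]
          have := ht'.2
          have hR0 : 0 ≤ R ε := by positivity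
          gcongr
      have e2 : ‖(∫ s in (0 : ℝ)..t', c.A (Y t s (x, ω)) (V (t - s) (Y t s (x, ω)) (m t s)) (m t s))
          - ∫ s in (0 : ℝ)..t, c.A (Y t s (x, ω)) (V (t - s) (Y t s (x, ω)) (m t s)) (m t s)‖ ≤
          L * (1 + M) * |t' - t| := by
        rw [intervalIntegral.integral_interval_sub_left (hA.intervalIntegrable _ _)
          (hA.intervalIntegrable _ _)]
        exact intervalIntegral.norm_integral_le_of_norm_le_const fun r _ =>
          (hc.A.comp_isLipCoeff hL hV t).bound r _ (m t r)
      have e3 : ‖V₀ (Y t' t' (x, ω)) (m t' t') - V₀ (Y t t' (x, ω)) (m t t')‖ ≤ K₀ * R ε :=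
        (hV₀ _ _ _ _).trans (mul_le_mul_of_nonneg_left (hkey ω t' ht') hK₀)
      have e4 := hV₀ (Y t t' (x, ω)) (Y t t (x, ω)) (m t t') (m t t)
      have e5 := norm_sub_le_norm_sub_add_norm_sub
        (∫ s in (0 : ℝ)..t', c.A (Y t' s (x, ω)) (V (t' - s) (Y t' s (x, ω)) (m t' s)) (m t' s))
        (∫ s in (0 : ℝ)..t', c.A (Y t s (x, ω)) (V (t - s) (Y t s (x, ω)) (m t s)) (m t s))
        (∫ s in (0 : ℝ)..t, c.A (Y t s (x, ω)) (V (t - s) (Y t s (x, ω)) (m t s)) (m t s))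
      have e6 := norm_sub_le_norm_sub_add_norm_sub (V₀ (Y t' t' (x, ω)) (m t' t'))
        (V₀ (Y t t' (x, ω)) (m t t')) (V₀ (Y t t (x, ω)) (m t t))
      rw [add_sub_add_comm]
      refine (norm_add_le _ _).trans ?_
      linarith
    refine (norm_integral_le_of_norm_le ((integrable_const _).add (hdint.const_mul K₀))
      (Eventually.of_forall hle)).trans (le_of_eq ?_)
    have hs2 := integral_add (integrable_const (μ := P)
      ((L * ε + L * (1 + k) * R ε) * S + K₀ * R ε + L * (1 + M) * |t' - t| +
        K₀ * d1 (m t t') (m t t)))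
      (hdint.const_mul K₀)
    refine hs2.trans ?_
    rw [integral_const, integral_const_mul]
    simp only [probReal_univ, one_smul, ρ]
    ring
  -- uniform continuity in time of `V` along the curve `m t`
  have huc : ∀ ε, 0 < ε → ∀ᶠ t' in 𝓝 t, ∀ q ∈ Icc 0 S, ∀ y,
      ‖V (t' - q) y (m t q) - V (t - q) y (m t q)‖ ≤ ε := by
    intro ε hε
    have hc1 : Continuous ↿(fun (t' : ℝ) (z : Icc 0 S × Torus d) =>
        V (t' - z.1) z.2 (m t z.1)) := by
      have h1 := hV.continuous_uncurry (h t).cont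
      exact h1.comp (by fun_prop : Continuous fun w : ℝ × (Icc 0 S × Torus d) =>
        (w.1 - (w.2.1 : ℝ), ((w.2.1 : ℝ), w.2.2)))
    have h2 := Metric.tendstoUniformly_iff.1 (Continuous.tendstoUniformly _ hc1 t) ε hε
    filter_upwards [h2] with t' h3 q hq y
    have := h3 (⟨q, hq⟩, y)
    rw [dist_comm, dist_eq_norm] at this
    exact this.le
  rw [ContinuousWithinAt, tendsto_iff_norm_sub_tendsto_zero, Metric.tendsto_nhds]
  intro η hη
  set C : ℝ := (L + L * (1 + k) * R 1) * S + K₀ * R 1 with hC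
  have hR1 : 0 ≤ R 1 := by positivity
  have hC0 : 0 ≤ C := by positivity
  have hε : 0 < η / (2 * (C + 1)) := by positivity
  have h1 : ∀ᶠ t' in 𝓝[Ici 0] t, ρ t' < η / 2 :=
    (hρ.mono_left nhdsWithin_le_nhds).eventually (gt_mem_nhds (by positivity))
  have h2 : ∀ᶠ t' in 𝓝[Ici 0] t, t' < S :=
    nhdsWithin_le_nhds (gt_mem_nhds (by rw [hS]; linarith))
  filter_upwards [h1, h2, nhdsWithin_le_nhds (huc _ hε), self_mem_nhdsWithin] with t' a1 a2 a3 a4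
  have := hmain _ hε.le t' ⟨a4, a2.le⟩ a3
  rw [Real.dist_eq, sub_zero, abs_of_nonneg (norm_nonneg _)]
  have e1 : (L * (η / (2 * (C + 1))) + L * (1 + k) * R (η / (2 * (C + 1)))) * S +
      K₀ * R (η / (2 * (C + 1))) = C * (η / (2 * (C + 1))) := by
    simp only [hC, hR]; ring
  have e2 : C * (η / (2 * (C + 1))) ≤ η / 2 := by
    rw [mul_div_assoc', div_le_div_iff₀ (by positivity) (by positivity)]
    nlinarith
  linarith

end construction

/-! ### Representation formula: locality, short-time existence, uniqueness, bounds -/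

section representation
variable {Ω : Type*} [MeasurableSpace Ω] {d : ℕ} {P : Measure Ω} [IsProbabilityMeasure P]
  {β : Fin d → ℝ≥0 → Ω → ℝ} {N : ℝ → Ω → E d} {c : Coeffs d} {L : ℝ}
  {V₀ : Torus d → PT d → E d} {V W : ℝ → Torus d → PT d → E d}

lemma IsFokkerPlanckSolution.congr {σ' : ℝ} {F F' : ℝ → Torus d → PT d → E d} {t : ℝ} {μ : PT d}
    {m : ℝ → PT d} (h : IsFokkerPlanckSolution σ' F t μ m) (ht : 0 ≤ t)
    (hF : ∀ r ∈ Icc 0 t, ∀ y, F (t - r) y (m r) = F' (t - r) y (m r)) :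
    IsFokkerPlanckSolution σ' F' t μ m where
  continuousOn := h.continuousOn
  initial := h.initial
  integrable := by
    filter_upwards [h.integrable, ae_restrict_mem measurableSet_Ioc] with r hr hr'
    simpa only [hF r ⟨hr'.1.le, hr'.2⟩] using hr
  integrable_pairing φ hφ := by
    refine (h.integrable_pairing φ hφ).congr_ae ?_
    refine (ae_restrict_mem measurableSet_uIoc).mono fun r hr => ?_
    rw [uIoc_of_le ht] at hr
    simp only [hF r ⟨hr.1.le, hr.2⟩]
  weak φ hφ s hs := by
    rw [h.weak φ hφ s hs]
    congr 1
    refine intervalIntegral.integral_congr fun r hr => ?_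
    rw [uIcc_of_le hs.1] at hr
    simp only [hF r ⟨hr.1, hr.2.trans hs.2⟩]

omit [IsProbabilityMeasure P] in
/-- The characteristics up to time `t` only see the field on `[0, t]`. -/
lemma IsChar.congr {t : ℝ} {x : Torus d} {μ : PT d} {X : ℝ → Ω → Torus d} {m : ℝ → PT d}
    (h : IsChar P β c V₀ V t x μ X m) (ht : 0 ≤ t) (hVW : ∀ s ∈ Icc 0 t, V s = W s) :
    IsChar P β c V₀ W t x μ X m := by
  have hmem : ∀ r ∈ Icc 0 t, V (t - r) = W (t - r) := fun r hr =>
    hVW _ ⟨by linarith [hr.2], by linarith [hr.1]⟩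
  have hrw : ∀ (G : Torus d → E d → PT d → E d) (ω : Ω), ∀ r ∈ Icc 0 t,
      G (X r ω) (V (t - r) (X r ω) (m r)) (m r) = G (X r ω) (W (t - r) (X r ω) (m r)) (m r) :=
    fun G ω r hr => by rw [hmem r hr]
  refine ⟨h.fp.congr ht fun r hr y => by rw [hmem r hr], ⟨h.sde.aemeasurable, ?_, ?_⟩, ?_, h.int₀⟩
  · filter_upwards [h.sde.integrable] with ω hω
    refine hω.congr_ae ((ae_restrict_mem measurableSet_uIoc).mono fun r hr => ?_)
    rw [uIoc_of_le ht] at hr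
    exact hrw c.b ω r ⟨hr.1.le, hr.2⟩
  · filter_upwards [h.sde.equation] with ω hω s hs
    rw [hω s hs]
    congr 3
    refine intervalIntegral.integral_congr fun r hr => ?_
    rw [uIcc_of_le hs.1] at hr
    exact hrw c.b ω r ⟨hr.1, hr.2.trans hs.2⟩
  · refine h.int.congr ?_
    have h1 : ∀ᵐ z ∂((volume.restrict (Ioc 0 t)).prod P), z.1 ∈ Ioc 0 t :=
      Measure.quasiMeasurePreserving_fst.ae (ae_restrict_mem measurableSet_Ioc)
    filter_upwards [h1] with z hz
    exact hrw c.A z.2 z.1 ⟨hz.1.le, hz.2⟩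

omit [IsProbabilityMeasure P] in
lemma payoff_congr {t : ℝ} {X : ℝ → Ω → Torus d} {m : ℝ → PT d} (ht : 0 ≤ t)
    (hVW : ∀ s ∈ Icc 0 t, V s = W s) : payoff P c V₀ V t X m = payoff P c V₀ W t X m := by
  simp only [payoff]
  congr 1
  ext1 ω
  congr 1
  refine intervalIntegral.integral_congr fun r hr => ?_
  rw [uIcc_of_le ht] at hr
  simp only [hVW (t - r) ⟨by linarith [hr.2], by linarith [hr.1]⟩]

/-- The representation formula for `V` at `(t, x, μ)`. -/
def IsRep (P : Measure Ω) (β : Fin d → ℝ≥0 → Ω → ℝ) (c : Coeffs d) (V₀ : Torus d → PT d → E d)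
    (V : ℝ → Torus d → PT d → E d) (t : ℝ) (x : Torus d) (μ : PT d) : Prop :=
  ∃ X m, IsChar P β c V₀ V t x μ X m ∧ V t x μ = payoff P c V₀ V t X m

omit [IsProbabilityMeasure P] in
lemma IsRep.congr {t : ℝ} {x : Torus d} {μ : PT d} (h : IsRep P β c V₀ V t x μ) (ht : 0 ≤ t)
    (hVW : ∀ s ∈ Icc 0 t, V s = W s) : IsRep P β c V₀ W t x μ := by
  obtain ⟨X, m, h1, h2⟩ := h
  exact ⟨X, m, h1.congr ht hVW, by rw [← hVW t ⟨ht, le_rfl⟩, h2, payoff_congr ht hVW]⟩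

lemma IsRep.eq_initial (hN : IsNoise P N)
    (hNβ : ∀ᵐ ω ∂P, ∀ s, N s ω = WithLp.toLp 2 (fun i => β i s.toNNReal ω)) {x : Torus d} {μ : PT d}
    (h : IsRep P β c V₀ V 0 x μ) : V 0 x μ = V₀ x μ := by
  obtain ⟨X, m, h1, h2⟩ := h
  have h3 : ∀ᵐ ω ∂P, (∫ s in (0 : ℝ)..0, c.A (X s ω) (V (0 - s) (X s ω) (m s)) (m s)) +
      V₀ (X 0 ω) (m 0) = V₀ x μ := by
    filter_upwards [h1.sde.equation, hNβ] with ω hω hN'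
    have e := hω 0 ⟨le_rfl, le_rfl⟩
    rw [← hN' 0, hN.zero 0 ω le_rfl, smul_zero, intervalIntegral.integral_same, add_zero,
      proj_zero, add_zero] at e
    rw [intervalIntegral.integral_same, zero_add, e, h1.fp.initial]
  rw [h2, payoff, integral_congr_ae h3]
  simp

/-- A bounded Lipschitz field, defined for all times, which satisfies the representation formula
on the closed interval `[0, T]`. -/
structure IsRegular (P : Measure Ω) (β : Fin d → ℝ≥0 → Ω → ℝ) (c : Coeffs d) (M k T : ℝ)
    (V₀ : Torus d → PT d → E d) (V : ℝ → Torus d → PT d → E d) : Prop where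
  coeff : IsLipCoeff M k V
  rep : ∀ t ∈ Icc 0 T, ∀ x μ, IsRep P β c V₀ V t x μ

lemma IsLipCoeff.lipXM {M k : ℝ} (h : IsLipCoeff M k V) (t : ℝ) : LipXM k (V t) := h.lip t

/-- Short-time existence, on a time interval that depends only on bounds on the initial datum. -/
theorem exists_isRegular (hc : c.IsLip L) (hN : IsNoise P N)
    (hNβ : ∀ᵐ ω ∂P, ∀ s, N s ω = WithLp.toLp 2 (fun i => β i s.toNNReal ω)) {K₀ M₀ : ℝ}
    (hK₀ : 0 ≤ K₀) (hM₀ : 0 ≤ M₀) : ∃ δ k : ℝ, 0 < δ ∧ 0 ≤ k ∧ ∀ V₀ : Torus d → PT d → E d,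
      LipXM K₀ V₀ → (∀ x m, ‖V₀ x m‖ ≤ M₀) → ∃ V, IsRegular P β c (M₀ + 1) k δ V₀ V := by
  have hL := hc.nonneg
  -- for small times the payoff stability estimate has constant `(1 + K₀) * 5 * e ≤ k`
  set k : ℝ := 15 * (1 + K₀) with hk
  have hk0 : 0 ≤ k := by positivity
  have hM : 0 ≤ M₀ + 1 := by positivity
  obtain ⟨lam, hlam, hstab⟩ := exists_payoff_stability (P := P) (β := β) hc hM hk0 hK₀
  -- each of the rates that enter the estimates is at most `Q`, and the time step is `1 / Q`
  set Q : ℝ := L * (2 + M₀) + lam + L * (1 + k) + 2 * L * (1 + k) with hQ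
  have hQ0 : 0 < Q := by positivity
  have hδ : ∀ a t, a ≤ Q → 0 ≤ t → t ≤ 1 / Q → a * t ≤ 1 := fun a t ha ht0 ht => by
    calc a * t ≤ Q * (1 / Q) := mul_le_mul ha ht ht0 hQ0.le
      _ = 1 := by field_simp
  have hk1 : 0 ≤ L * (1 + k) := by positivity
  have hM1 : 0 ≤ L * (2 + M₀) := by positivity
  have ha1 : L * (2 + M₀) ≤ Q := by linarith
  have ha2 : lam ≤ Q := by linarith
  have ha3 : L * (1 + k) ≤ Q := by linarith
  have ha4 : 2 * L * (1 + k) ≤ Q := by linarith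
  have hexp : ∀ t, 0 ≤ t → t ≤ 1 / Q → Real.exp (lam * t) ≤ 3 := fun t ht0 ht => by
    have := Real.exp_le_exp.2 (hδ lam t ha2 ht0 ht)
    linarith [Real.exp_one_lt_d9]
  refine ⟨1 / Q, k, by positivity, hk0, fun V₀ hV₀ hV₀b => ?_⟩
  -- a choice of characteristics for every admissible field
  have hchar : ∀ f : ℝ × Torus d × PT d → E d, ∃ (m : PT d → ℝ → ℝ → PT d)
      (Y : PT d → ℝ → ℝ → Torus d × Ω → Torus d),
      IsLipCoeff (M₀ + 1) k (fun t x μ => f (t, x, μ)) →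
      ∀ μ t, IsFlowChar N c (fun t x μ => f (t, x, μ)) t μ (m μ t) (Y μ t) := fun f => by
    by_cases hf : IsLipCoeff (M₀ + 1) k (fun t x μ => f (t, x, μ))
    · choose m Y h using fun μ t => exists_isFlowChar hc hN hf hM hk0 t μ
      exact ⟨m, Y, fun _ => h⟩
    · exact ⟨fun _ _ _ => Classical.arbitrary _, fun _ _ _ _ => 0, fun h => absurd h hf⟩
  choose m Y hmY using hchar
  -- fields are extended to all times by their values at the ends of `[0, 1 / Q]`
  let clamp : ℝ → ℝ := fun t => max 0 (min t (1 / Q))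
  have hclamp : ∀ t, clamp t ∈ Icc 0 (1 / Q) := fun t =>
    ⟨le_max_left _ _, max_le (by positivity) (min_le_right _ _)⟩
  have hclampc : Continuous clamp := continuous_const.max (continuous_id.min continuous_const)
  let Φ : (ℝ × Torus d × PT d → E d) → ℝ × Torus d × PT d → E d := fun f z =>
    payoff P c V₀ (fun t x μ => f (t, x, μ)) (clamp z.1)
      (fun s ω => Y f z.2.2 (clamp z.1) s (z.2.1, ω)) (m f z.2.2 (clamp z.1))
  let S : Set (ℝ × Torus d × PT d → E d) :=
    {f | IsLipCoeff (M₀ + 1) k (fun t x μ => f (t, x, μ))}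
  have hIsChar : ∀ f ∈ S, ∀ t x μ, IsChar P β c V₀ (fun t x μ => f (t, x, μ)) (clamp t) x μ
      (fun s ω => Y f μ (clamp t) s (x, ω)) (m f μ (clamp t)) := fun f hf t x μ =>
    (hmY f hf μ (clamp t)).isChar hc hN hNβ hf (hclamp t).1 hV₀ x
  have hΦ : MapsTo Φ S S := by
    intro f hf
    have hf' : IsLipCoeff (M₀ + 1) k (fun t x μ => f (t, x, μ)) := hf
    refine ⟨fun t x μ => ?_, fun t x x' μ μ' => ?_, fun x μ => ?_⟩
    · have ht := hclamp t
      refine (norm_payoff_le hc ht.1 (v := fun _ => M₀ + 1) continuous_const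
        (fun s _ y ν => hf'.bound _ _ _) hV₀b).trans ?_
      have := hδ _ _ ha1 ht.1 ht.2
      rw [intervalIntegral.integral_const, smul_eq_mul, sub_zero]
      linarith
    · have ht := hclamp t
      have h1 := hstab (e := fun _ => 0) ht.1 (hIsChar f hf t x μ) (hIsChar f hf t x' μ') hV₀
        continuous_const (fun _ => le_rfl) (fun s _ y ν => by simp)
        (fun s _ ν => (hf'.lipXM s).continuous ν) (fun s _ y ν => hf'.bound _ _ _)
        (fun s _ => hf'.lipXM s)
      refine h1.trans ?_
      simp only [intervalIntegral.integral_zero, mul_zero, add_zero, zero_add]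
      have h2 := hδ _ _ ha3 ht.1 ht.2
      have h3 := hexp _ ht.1 ht.2
      have h4 : 0 ≤ dist x x' + d1 μ μ' := add_nonneg dist_nonneg (d1_nonneg _ _)
      calc (L * (1 + k) * clamp t + K₀) * (5 * (dist x x' + d1 μ μ') * Real.exp (lam * clamp t))
          ≤ (1 + K₀) * (5 * (dist x x' + d1 μ μ') * 3) := by gcongr
        _ = k * (dist x x' + d1 μ μ') := by rw [hk]; ring
    · have h1 := hf'.continuousOn_payoff hc hN hNβ hM hk0 hK₀ hV₀ (hmY f hf μ) x
      exact h1.comp_continuous hclampc fun t => (hclamp t).1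
  obtain ⟨f, hfS, hf⟩ : ∃ f ∈ S, Φ f = f := by
    refine exists_fixedPoint_weighted (w := fun _ => 1) hΦ ?_ ?_ (f₀ := fun _ => 0) ?_
      (C₀ := M₀ + 1) hM ?_
    · intro f g C hf hC
      have hlim : ∀ i, Tendsto (fun n => f n i) atTop (𝓝 (g i)) := fun i => by
        rw [tendsto_iff_norm_sub_tendsto_zero]
        refine squeeze_zero (fun _ => norm_nonneg _) (fun n => hC n i) ?_
        have := ((tendsto_pow_atTop_nhds_zero_of_lt_one (r := (1 / 2 : ℝ)) (by norm_num)
          (by norm_num)).const_mul C).mul_const 1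
        simpa using this
      refine ⟨fun t x μ => ?_, fun t x x' μ μ' => ?_, fun x μ => ?_⟩
      · exact le_of_tendsto' (hlim _).norm fun n => (hf n).bound t x μ
      · exact le_of_tendsto' ((hlim _).sub (hlim _)).norm fun n => (hf n).lip t x x' μ μ'
      · have hu : TendstoUniformly (fun n t => f n (t, x, μ)) (fun t => g (t, x, μ)) atTop := by
          rw [Metric.tendstoUniformly_iff]
          intro ε hε
          have h1 : Tendsto (fun n : ℕ => C * (1 / 2 : ℝ) ^ n * 1) atTop (𝓝 0) := by
            have := ((tendsto_pow_atTop_nhds_zero_of_lt_one (r := (1 / 2 : ℝ)) (by norm_num)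
              (by norm_num)).const_mul C).mul_const 1
            simpa using this
          filter_upwards [h1.eventually (gt_mem_nhds hε)] with n hn t
          rw [dist_comm, dist_eq_norm]
          exact (hC n _).trans_lt hn
        exact hu.continuous (Frequently.of_forall fun n => (hf n).cont x μ)
    · intro f hf g hg R hR hfg z
      have hf' : IsLipCoeff (M₀ + 1) k (fun t x μ => f (t, x, μ)) := hf
      have hg' : IsLipCoeff (M₀ + 1) k (fun t x μ => g (t, x, μ)) := hg
      have ht := hclamp z.1
      have h1 := hstab (e := fun _ => R) ht.1 (hIsChar f hf z.1 z.2.1 z.2.2)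
        (hIsChar g hg z.1 z.2.1 z.2.2) hV₀ continuous_const (fun _ => hR)
        (fun s _ y ν => by simpa using hfg (s, y, ν))
        (fun s _ ν => (hf'.lipXM s).continuous ν) (fun s _ y ν => hg'.bound _ _ _)
        (fun s _ => hg'.lipXM s)
      refine h1.trans ?_
      simp only [dist_self, d1_self, zero_add, intervalIntegral.integral_const, smul_eq_mul,
        sub_zero, mul_one]
      have h2 := hδ _ _ ha3 ht.1 ht.2
      have h3 := hexp _ ht.1 ht.2
      have h4 := hδ _ _ ha4 ht.1 ht.2
      have h5 := ht.1
      calc L * (clamp z.1 * R) + (L * (1 + k) * clamp z.1 + K₀) *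
            (5 * (L * (clamp z.1 * R)) * Real.exp (lam * clamp z.1))
          ≤ L * (clamp z.1 * R) + (1 + K₀) * (5 * (L * (clamp z.1 * R)) * 3) := by gcongr
        _ = (2 * L * (1 + k) * clamp z.1) * (R / 2) := by rw [hk]; ring
        _ ≤ 1 * (R / 2) := by gcongr
        _ = R / 2 := one_mul _
    · exact ⟨fun _ _ _ => by simpa using hM, fun _ x x' μ μ' => by
        have := d1_nonneg μ μ'
        simp only [sub_self, norm_zero]; positivity, fun _ _ => continuous_const⟩
    · intro z
      rw [mul_one, sub_zero]
      have h0 : (fun _ => 0 : ℝ × Torus d × PT d → E d) ∈ S :=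
        ⟨fun _ _ _ => by simpa using hM, fun _ x x' μ μ' => by
          have := d1_nonneg μ μ'
          simp only [sub_self, norm_zero]; positivity, fun _ _ => continuous_const⟩
      exact (hΦ h0).bound z.1 z.2.1 z.2.2
  refine ⟨fun t x μ => f (t, x, μ), hfS, fun t ht x μ => ?_⟩
  have e : clamp t = t := by
    simp only [clamp]; rw [min_eq_left ht.2, max_eq_right ht.1]
  have h1 := hIsChar f hfS t x μ
  rw [e] at h1
  refine ⟨_, _, h1, ?_⟩
  conv_lhs => rw [← hf]
  simp only [Φ, e]

/-- For a rate `lam ≥ 2 a` the convolution of `e^{lam r}` with the constant `a` gains a factor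
`1 / 2`, as `le_of_weighted_improvement` requires. -/
lemma integral_exp_sub_le {a b lam t : ℝ} (hlam : 0 < lam) (ha : 0 ≤ a) (hb : 0 ≤ b)
    (h : 2 * a ≤ lam) : a * ∫ r in (0 : ℝ)..t, b * Real.exp (lam * (t - r)) ≤
      b / 2 * Real.exp (lam * t) := by
  have h1 := intervalIntegral.integral_comp_sub_left (fun r => Real.exp (lam * r)) t
    (a := 0) (b := t)
  rw [sub_self, sub_zero] at h1
  rw [intervalIntegral.integral_const_mul, h1]
  calc a * (b * ∫ r in (0 : ℝ)..t, Real.exp (lam * r))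
      ≤ a * (b * (Real.exp (lam * t) / lam)) := by
        have := integral_exp_le hlam t; gcongr
    _ = a / lam * (b * Real.exp (lam * t)) := by ring
    _ ≤ 1 / 2 * (b * Real.exp (lam * t)) := by
        refine mul_le_mul_of_nonneg_right ?_ (by positivity)
        rw [div_le_iff₀ hlam]; linarith
    _ = _ := by ring

/-- Uniqueness: a bounded Lipschitz field satisfying the representation formula agrees with any
bounded continuous one. -/
theorem eqOn_of_isRep (hc : c.IsLip L) {T M k K₀ C : ℝ} (hM : 0 ≤ M) (hk : 0 ≤ k) (hK₀ : 0 ≤ K₀)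
    (hV₀ : LipXM K₀ V₀)
    (hV : ∀ t ∈ Icc 0 T, ∀ x μ, IsRep P β c V₀ V t x μ)
    (hVc : ∀ t ∈ Icc 0 T, ∀ ν, Continuous fun y => V t y ν)
    (hVC : ∀ t ∈ Icc 0 T, ∀ x μ, ‖V t x μ‖ ≤ C)
    (hW : ∀ t ∈ Icc 0 T, ∀ x μ, IsRep P β c V₀ W t x μ)
    (hWM : ∀ t ∈ Icc 0 T, ∀ x μ, ‖W t x μ‖ ≤ M) (hWk : ∀ t ∈ Icc 0 T, LipXM k (W t)) :
    ∀ t ∈ Icc 0 T, V t = W t := by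
  intro t₀ ht₀
  have hT : 0 ≤ T := ht₀.1.trans ht₀.2
  have hL := hc.nonneg
  obtain ⟨lam, hlam, hstab⟩ := exists_payoff_stability (P := P) (β := β) hc hM hk hK₀
  -- the contribution of the characteristics is at most `Q` times that of the payoff rate
  set Q : ℝ := (L * (1 + k) * T + K₀) * (5 * Real.exp (lam * T)) with hQ
  have hQ0 : 0 ≤ Q := by positivity
  set Λ : ℝ := 2 * (L * (1 + Q)) + 1 with hΛ
  have hΛ0 : 0 < Λ := by positivity
  have key := le_of_weighted_improvement
    (u := fun (z : Torus d × PT d) s => ‖V s z.1 z.2 - W s z.1 z.2‖)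
    (S := T) (lam := Λ) (a := 0) (C := C + M) le_rfl hΛ0.le
    (fun z r hr => (norm_sub_le _ _).trans (add_le_add (hVC r hr _ _) (hWM r hr _ _))) (by
      intro R hR hu z t ht
      obtain ⟨X₁, m₁, h₁, e₁⟩ := hV t ht z.1 z.2
      obtain ⟨X₂, m₂, h₂, e₂⟩ := hW t ht z.1 z.2
      have hsub : ∀ s ∈ Icc 0 t, s ∈ Icc 0 T := fun s hs => ⟨hs.1, hs.2.trans ht.2⟩
      have h3 := hstab (e := fun s => R * Real.exp (Λ * s)) ht.1 h₁ h₂ hV₀ (by fun_prop)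
        (fun s => by positivity) (fun s hs y ν => hu (y, ν) s (hsub s hs))
        (fun s hs => hVc s (hsub s hs)) (fun s hs => hWM s (hsub s hs))
        (fun s hs => hWk s (hsub s hs))
      rw [e₁, e₂]
      refine h3.trans ?_
      simp only [dist_self, d1_self, zero_add]
      set J := L * ∫ r in (0 : ℝ)..t, R * Real.exp (Λ * (t - r)) with hJ
      have hJ0 : 0 ≤ J := mul_nonneg hL (intervalIntegral.integral_nonneg ht.1 fun r _ => by
        positivity)
      have h4 := integral_exp_sub_le (a := L * (1 + Q)) (b := R) (t := t) hΛ0 (by positivity) hR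
        (by linarith)
      have h5 : (L * (1 + k) * t + K₀) * (5 * J * Real.exp (lam * t)) ≤ Q * J := by
        have := ht.2
        have := ht.1
        calc (L * (1 + k) * t + K₀) * (5 * J * Real.exp (lam * t))
            ≤ (L * (1 + k) * T + K₀) * (5 * J * Real.exp (lam * T)) := by gcongr
          _ = Q * J := by rw [hQ]; ring
      have h6 : L * (1 + Q) * (∫ r in (0 : ℝ)..t, R * Real.exp (Λ * (t - r))) = J + Q * J := by
        rw [hJ]; ring
      linarith)
  ext1 x; ext1 μ
  have := key (x, μ) t₀ ht₀
  rw [mul_zero, zero_mul] at this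
  exact sub_eq_zero.1 (norm_le_zero_iff.1 this)

/-- A bound on solutions that involves neither their Lipschitz constant nor the a priori bound `C`:
the running payoff grows at most linearly in the solution itself. -/
theorem norm_le_of_isRep (hc : c.IsLip L) {T M₀ C : ℝ} (hM₀ : 0 ≤ M₀) (hT : 0 ≤ T)
    (hV₀ : ∀ x μ, ‖V₀ x μ‖ ≤ M₀) (hV : ∀ t ∈ Icc 0 T, ∀ x μ, IsRep P β c V₀ V t x μ)
    (hVC : ∀ t ∈ Icc 0 T, ∀ x μ, ‖V t x μ‖ ≤ C) :
    ∀ t ∈ Icc 0 T, ∀ x μ, ‖V t x μ‖ ≤ 2 * (L * T + M₀) * Real.exp ((2 * L + 1) * T) := by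
  have hL := hc.nonneg
  have hΛ0 : 0 < 2 * L + 1 := by positivity
  have key := le_of_weighted_improvement (u := fun (z : Torus d × PT d) s => ‖V s z.1 z.2‖)
    (S := T) (lam := 2 * L + 1) (a := L * T + M₀) (C := C) (by positivity) hΛ0.le
    (fun z r hr => hVC r hr _ _) (by
      intro R hR hu z t ht
      obtain ⟨X₁, m₁, h₁, e₁⟩ := hV t ht z.1 z.2
      have hsub : ∀ s ∈ Icc 0 t, s ∈ Icc 0 T := fun s hs => ⟨hs.1, hs.2.trans ht.2⟩
      rw [e₁]
      refine (norm_payoff_le hc ht.1 (v := fun s => R * Real.exp ((2 * L + 1) * s)) (by fun_prop)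
        (fun s hs y ν => hu (y, ν) s (hsub s hs)) hV₀).trans ?_
      have h4 := integral_exp_sub_le (a := L) (b := R) (t := t) hΛ0 hL hR (by linarith)
      rw [intervalIntegral.integral_const_mul, intervalIntegral.integral_add
        (continuous_const.intervalIntegrable _ _)
        (Continuous.intervalIntegrable (by fun_prop) _ _), intervalIntegral.integral_const,
        smul_eq_mul, sub_zero, mul_one, mul_add]
      have h5 : L * t ≤ L * T := mul_le_mul_of_nonneg_left ht.2 hL
      have h6 : 1 ≤ Real.exp ((2 * L + 1) * t) := Real.one_le_exp (mul_nonneg hΛ0.le ht.1)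
      have h7 : L * T + M₀ ≤ (L * T + M₀) * Real.exp ((2 * L + 1) * t) :=
        le_mul_of_one_le_right (by positivity) h6
      linarith)
  intro t ht x μ
  refine (key (x, μ) t ht).trans ?_
  have := ht.2
  gcongr

/-- Local boundedness of solutions that are Lipschitz in space and measure and measurable in
time. The payoff rate at a reference point of space and measure is integrable in time, because it
is so along some characteristic and the two differ by at most a constant on a compact space; this
in turn bounds the payoff rate along every characteristic. -/
theorem exists_bound_of_isRep (hc : c.IsLip L) {T K : ℝ} (hT : 0 ≤ T) {K₀ : ℝ} (hV₀ : LipXM K₀ V₀)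
    (hV : ∀ t ∈ Icc 0 T, ∀ x μ, IsRep P β c V₀ V t x μ) (hVK : ∀ t ∈ Icc 0 T, LipXM K (V t))
    (hmeas : ∀ x μ, ∃ v : ℝ → E d, Measurable v ∧ ∀ t ∈ Icc 0 T, v t = V t x μ) :
    ∃ C, ∀ t ∈ Icc 0 T, ∀ x μ, ‖V t x μ‖ ≤ C := by
  have hL := hc.nonneg
  obtain ⟨μ₀⟩ : Nonempty (PT d) := inferInstance
  obtain ⟨v, hvm, hv⟩ := hmeas 0 μ₀
  obtain ⟨M₀, hM₀, hV₀b⟩ := hV₀.exists_bound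
  -- the payoff rate at the reference point `(0, μ₀)`
  set a : ℝ → ℝ := fun τ => ‖c.A 0 (v τ) μ₀‖ with ha
  have ham : Measurable a :=
    (((hc.A.continuous μ₀).comp (continuous_const.prodMk continuous_id)).measurable.comp hvm).norm
  set q : ℝ := L * (√d + |K| * (√d + 2 * √d) + 2 * √d) with hq
  have hcomp : ∀ τ ∈ Icc 0 T, ∀ y ν, ‖c.A y (V τ y ν) ν - c.A 0 (v τ) μ₀‖ ≤ q := by
    intro τ hτ y ν
    refine (hc.A.lip _ _ _ _ _ _).trans (mul_le_mul_of_nonneg_left ?_ hL)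
    rw [hv τ hτ]
    have h1 := hVK τ hτ y 0 ν μ₀
    have h2 : K * (dist y 0 + d1 ν μ₀) ≤ |K| * (√d + 2 * √d) :=
      mul_le_mul (le_abs_self K) (add_le_add (dist_torus_le _ _) (d1_le_two_sqrt _ _))
        (add_nonneg dist_nonneg (d1_nonneg _ _)) (abs_nonneg _)
    exact add_le_add (add_le_add (dist_torus_le _ _) (h1.trans h2)) (d1_le_two_sqrt _ _)
  have haint : IntervalIntegrable a volume 0 T := by
    obtain ⟨X, m, hX, -⟩ := hV T ⟨hT, le_rfl⟩ 0 μ₀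
    obtain ⟨ω, hω⟩ := (hX.integral_add hT).1.exists
    have h1 : IntervalIntegrable (fun r => a (T - r)) volume 0 T := by
      refine IntervalIntegrable.mono_fun' (g := fun r =>
        ‖c.A (X r ω) (V (T - r) (X r ω) (m r)) (m r)‖ + q)
        (hω.norm.add intervalIntegrable_const)
        (ham.comp (measurable_const.sub measurable_id)).aestronglyMeasurable ?_
      refine (ae_restrict_mem measurableSet_uIoc).mono fun r hr => ?_
      rw [uIoc_of_le hT] at hr
      have h2 := hcomp (T - r) ⟨by linarith [hr.2], by linarith [hr.1]⟩ (X r ω) (m r)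
      have h3 := norm_le_norm_add_norm_sub' (c.A 0 (v (T - r)) μ₀)
        (c.A (X r ω) (V (T - r) (X r ω) (m r)) (m r))
      rw [norm_sub_rev] at h3
      simp only [ha, norm_norm]
      linarith
    have h2 := h1.comp_sub_left T
    simp only [sub_sub_cancel, sub_zero, sub_self] at h2
    exact h2.symm
  refine ⟨(∫ r in (0 : ℝ)..T, a r) + q * T + M₀, fun t ht x μ => ?_⟩
  obtain ⟨X, m, hX, e⟩ := hV t ht x μ
  have hat : IntervalIntegrable a volume 0 t := haint.mono_set (by
    rw [uIcc_of_le ht.1, uIcc_of_le hT]; exact Icc_subset_Icc_right ht.2)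
  have hat' : IntervalIntegrable (fun r => a (t - r)) volume 0 t := by
    have := hat.comp_sub_left t
    simp only [sub_zero, sub_self] at this
    exact this.symm
  have hq0 : 0 ≤ q := by positivity
  rw [e, payoff]
  refine (norm_integral_le_of_norm_le_const (C := (∫ r in (0 : ℝ)..T, a r) + q * T + M₀)
    (Eventually.of_forall fun ω => ?_)).trans (by simp)
  refine (norm_add_le _ _).trans (add_le_add ?_ (hV₀b _ _))
  have h1 : ‖∫ s in (0 : ℝ)..t, c.A (X s ω) (V (t - s) (X s ω) (m s)) (m s)‖ ≤
      ∫ s in (0 : ℝ)..t, (a (t - s) + q) := by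
    refine intervalIntegral.norm_integral_le_of_norm_le ht.1 (Eventually.of_forall fun r hr => ?_)
      (hat'.add intervalIntegrable_const)
    have h2 := hcomp (t - r) ⟨by linarith [hr.2], by linarith [hr.1, ht.2]⟩ (X r ω) (m r)
    have h3 := norm_le_norm_add_norm_sub' (c.A (X r ω) (V (t - r) (X r ω) (m r)) (m r))
      (c.A 0 (v (t - r)) μ₀)
    simp only [ha]
    linarith
  rw [intervalIntegral.integral_add hat' intervalIntegrable_const,
    intervalIntegral.integral_comp_sub_left, sub_self, sub_zero, intervalIntegral.integral_const,
    smul_eq_mul, sub_zero] at h1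
  have h4 : ∫ r in (0 : ℝ)..t, a r ≤ ∫ r in (0 : ℝ)..T, a r :=
    intervalIntegral.integral_mono_interval le_rfl ht.1 ht.2
      (Eventually.of_forall fun _ => norm_nonneg _) haint
  have h5 : t * q ≤ q * T := by rw [mul_comm]; exact mul_le_mul_of_nonneg_left ht.2 hq0
  linarith

end representation

/-! ### Concatenation of solutions -/

section concat
variable {Ω : Type*} [MeasurableSpace Ω] {d : ℕ} {P : Measure Ω} [IsProbabilityMeasure P]
  {β : Fin d → ℝ≥0 → Ω → ℝ} {N : ℝ → Ω → E d} {c : Coeffs d} {L : ℝ}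
  {V₀ : Torus d → PT d → E d} {V W : ℝ → Torus d → PT d → E d}

/-- The Fokker–Planck equation restarted at time `h`. -/
lemma IsFokkerPlanckSolution.shift {σ' : ℝ} {F : ℝ → Torus d → PT d → E d} {t h : ℝ} {μ : PT d}
    {m : ℝ → PT d} (hm : IsFokkerPlanckSolution σ' F t μ m) (h0 : 0 ≤ h) (ht : h ≤ t) :
    IsFokkerPlanckSolution σ' F (t - h) (m h) (fun r => m (h + r)) where
  continuousOn := hm.continuousOn.comp (by fun_prop) fun r hr =>
    ⟨by linarith [hr.1], by linarith [hr.2]⟩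
  initial := by simp
  integrable := by
    have h1 := (ae_restrict_iff' measurableSet_Ioc).1 hm.integrable
    have h2 := (measurePreserving_add_left (volume : Measure ℝ) h).quasiMeasurePreserving.ae h1
    refine (ae_restrict_iff' measurableSet_Ioc).2 ?_
    filter_upwards [h2] with r hr hr'
    have := hr ⟨by linarith [hr'.1], by linarith [hr'.2]⟩
    rwa [← sub_sub] at this
  integrable_pairing φ hφ := by
    have h1 : IntervalIntegrable (fun r => ∫ y, inner ℝ (F (t - r) y (m r)) (torusGradient φ y)
        ∂(m r : Measure (Torus d))) volume h t := (hm.integrable_pairing φ hφ).mono_set (by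
      rw [uIcc_of_le ht, uIcc_of_le (h0.trans ht)]; exact Icc_subset_Icc_left h0)
    have h2 := h1.comp_add_left h
    simpa only [sub_self, sub_sub] using h2
  weak φ hφ s hs := by
    have hs' : h + s ≤ t := by linarith [hs.2]
    have h1 := hm.integral_sub hφ h0 (by linarith [hs.1] : h ≤ h + s) hs'
    have hsub : uIcc h (h + s) ⊆ uIcc 0 t := by
      rw [uIcc_of_le (by linarith [hs.1]), uIcc_of_le (h0.trans ht)]
      exact Icc_subset_Icc h0 hs'
    have hp := (hm.integrable_pairing φ hφ).mono_set hsub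
    have hl : IntervalIntegrable (fun q => σ' * ∫ y, torusLaplacian φ y ∂(m q : Measure (Torus d)))
        volume h (h + s) := by
      refine (ContinuousOn.intervalIntegrable ?_).const_mul _
      refine (hm.continuousOn_integral hφ.continuous_torusLaplacian).mono (hsub.trans ?_)
      rw [uIcc_of_le (h0.trans ht)]
    rw [← intervalIntegral.integral_const_mul, ← intervalIntegral.integral_add hp hl] at h1
    have h2 := intervalIntegral.integral_comp_add_left (a := 0) (b := s) (fun r =>
      (∫ y, inner ℝ (F (t - r) y (m r)) (torusGradient φ y) ∂(m r : Measure (Torus d))) +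
        σ' * ∫ y, torusLaplacian φ y ∂(m r : Measure (Torus d))) h
    rw [add_zero] at h2
    simp only [sub_sub]
    rw [h2]
    linarith

/-- The expectation of a payoff depends only on the laws of the process at fixed times. -/
lemma integral_payoff_eq_lawOf {Ω' : Type*} [MeasurableSpace Ω'] {Q : Measure Ω'}
    [IsProbabilityMeasure Q] {X : ℝ → Ω' → Torus d} (hX : ∀ s, Measurable (X s))
    (hXc : ∀ p, Continuous fun s => X s p) {a : ℝ → Torus d → E d}
    (ha : Continuous (Function.uncurry a)) {C : ℝ} (haC : ∀ s z, ‖a s z‖ ≤ C) {v : Torus d → E d}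
    (hv : Continuous v) {T : ℝ} (hT : 0 ≤ T) :
    ∫ p, ((∫ s in (0 : ℝ)..T, a s (X s p)) + v (X T p)) ∂Q =
      (∫ s in (0 : ℝ)..T, ∫ z, a s z ∂(lawOf Q (X s) : Measure (Torus d))) +
        ∫ z, v z ∂(lawOf Q (X T) : Measure (Torus d)) := by
  have har : ∀ s, Continuous (a s) := fun s => ha.comp (by fun_prop : Continuous fun x => (s, x))
  have hsm : StronglyMeasurable (Function.uncurry fun s p => a s (X s p)) :=
    stronglyMeasurable_uncurry_of_continuous_of_stronglyMeasurable
      (fun p => ha.comp (continuous_id.prodMk (hXc p)))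
      fun s => ((har s).measurable.comp (hX s)).stronglyMeasurable
  have hint : Integrable (Function.uncurry fun s p => a s (X s p))
      ((volume.restrict (Ioc 0 T)).prod Q) :=
    Integrable.of_bound hsm.aestronglyMeasurable C (Eventually.of_forall fun z => haC _ _)
  have h1 : Integrable (fun p => ∫ s in (0 : ℝ)..T, a s (X s p)) Q := by
    simp_rw [intervalIntegral.integral_of_le hT]
    exact hint.integral_prod_right
  rw [integral_add h1 (integrable_comp_torus (hX T).aemeasurable hv),
    integral_lawOf (hX T).aemeasurable hv]
  congr 1
  simp_rw [intervalIntegral.integral_of_le hT, integral_lawOf (hX _).aemeasurable (har _)]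
  exact (integral_integral_swap hint).symm

/-- A deterministic starting point as a random one with a Dirac law. -/
lemma integral_dirac_prod' (x : Torus d) {f : Torus d × Ω → E d}
    (hf : StronglyMeasurable f) :
    ∫ p, f p ∂(Measure.dirac x).prod P = ∫ ω, f (x, ω) ∂P := by
  rw [Measure.dirac_prod, integral_map measurable_prodMk_left.aemeasurable hf.aestronglyMeasurable]

/-- Markov property in law: a flow restarted at time `h` from its own law has the laws of the
original flow, since both solve the same Fokker–Planck equation from the same initial measure. -/
lemma IsFlow.lawOf_restart (hN : IsNoise P N) {κ : ℝ} (hκ : 0 < κ) {g : ℝ → Torus d → E d} {M k : ℝ}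
    (hk : 0 ≤ k) (hg : Continuous (Function.uncurry g)) (hgM : ∀ r x, ‖g r x‖ ≤ M)
    (hgk : ∀ r x x', ‖g r x - g r x'‖ ≤ k * dist x x') {Y Z : ℝ → Torus d × Ω → Torus d}
    (hY : IsFlow N κ g Y) {h : ℝ} (hh : 0 ≤ h) (hZ : IsFlow N κ (fun r => g (h + r)) Z) (ν ρ : PT d)
    (hρ : ρ = lawOf ((ν : Measure (Torus d)).prod P) (Y h)) {s : ℝ} (hs : 0 ≤ s) :
    lawOf ((ρ : Measure (Torus d)).prod P) (Z s) =
      lawOf ((ν : Measure (Torus d)).prod P) (Y (h + s)) := by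
  have hM0 : 0 ≤ M := (norm_nonneg _).trans (hgM 0 0)
  have hsh : Continuous (Function.uncurry fun r => g (h + r)) :=
    hg.comp (by fun_prop : Continuous fun z : ℝ × Torus d => (h + z.1, z.2))
  have h1 := (hY.isFokkerPlanckSolution hN hκ.le hg hgM ν (t := h + s) (by positivity)
    (F := fun r y _ => g (h + s - r) y) (fun r => rfl)
    (fun r _ y => by simp only [sub_sub_cancel])).shift hh (by linarith)
  have h2 := hZ.isFokkerPlanckSolution hN hκ.le hsh (fun r => hgM _) ρ (t := s) hs
    (F := fun r y _ => g (h + s - r) y) (fun r => rfl)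
    (fun r _ y => by congr 1; ring)
  obtain ⟨lam, -, hst⟩ := exists_fokkerPlanck_stability d (σ' := κ ^ 2 / 2) (by positivity) hM0 hk
  have h3 := hst lam le_rfl h2 h1 (S := s) le_rfl (by linarith) (e := fun _ => 0) continuous_const
    (fun _ => le_rfl) (fun q _ => hg.comp (by fun_prop :
      Continuous fun y : Torus d => (h + s - (s - q), y)))
    (fun q _ y => by
      have e : h + s - (s - q) = h + s - (h + s - h - q) := by ring
      rw [e, sub_self, norm_zero, zero_add]
      exact mul_nonneg hk (d1_nonneg _ _))
    (fun q _ y => hgM _ _) (fun q _ y y' => hgk _ _ _) s ⟨hs, le_rfl⟩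
  rw [hρ, d1_self, intervalIntegral.integral_zero, add_zero, mul_zero, zero_mul] at h3
  rw [← hρ] at h3
  exact eq_of_d1_eq_zero (le_antisymm h3 (d1_nonneg _ _))

/-- On a regular solution the representation formula holds along all characteristics. -/
lemma IsRep.eq_payoff (hc : c.IsLip L) {M k K₀ t : ℝ} (hM : 0 ≤ M) (hk : 0 ≤ k) (hK₀ : 0 ≤ K₀)
    (hV₀ : LipXM K₀ V₀) (ht : 0 ≤ t) (hV : IsLipCoeff M k V) {x : Torus d} {μ : PT d}
    (h : IsRep P β c V₀ V t x μ) {X : ℝ → Ω → Torus d} {m : ℝ → PT d}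
    (hX : IsChar P β c V₀ V t x μ X m) : V t x μ = payoff P c V₀ V t X m := by
  obtain ⟨X', m', h1, h2⟩ := h
  obtain ⟨lam, -, hst⟩ := exists_payoff_stability (P := P) (β := β) hc hM hk hK₀
  have h3 := hst (e := fun _ => 0) ht h1 hX hV₀ continuous_const (fun _ => le_rfl)
    (fun s _ y ν => by simp) (fun s _ ν => (hV.lipXM s).continuous ν)
    (fun s _ y ν => hV.bound _ _ _) (fun s _ => hV.lipXM s)
  simp only [dist_self, d1_self, intervalIntegral.integral_zero, mul_zero, zero_mul, add_zero] at h3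
  rw [h2]
  exact sub_eq_zero.1 (norm_le_zero_iff.1 h3)

lemma IsLipCoeff.comp_add {M k : ℝ} (hV : IsLipCoeff M k V) (t₀ : ℝ) :
    IsLipCoeff M k fun s => V (t₀ + s) :=
  ⟨fun _ => hV.bound _, fun _ => hV.lip _, fun x μ => (hV.cont x μ).comp (by fun_prop)⟩

/-- Dynamic programming: if `V` satisfies the representation formula at time `t₀` for the datum
`V₀`, and `V (t₀ + ·)` at time `h` for the datum `V t₀`, then `V` does at time `t₀ + h`. The payoff
after time `h` is computed from the laws of the flow, so that conditional expectations and the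
Markov property of the process itself are not needed. -/
theorem isRep_add (hc : c.IsLip L) (hN : IsNoise P N)
    (hNβ : ∀ᵐ ω ∂P, ∀ s, N s ω = WithLp.toLp 2 (fun i => β i s.toNNReal ω)) {M k K₀ t₀ h : ℝ}
    (hM : 0 ≤ M) (hk : 0 ≤ k) (hK₀ : 0 ≤ K₀) (hV₀ : LipXM K₀ V₀) (ht₀ : 0 ≤ t₀) (hh : 0 ≤ h)
    (hV : IsLipCoeff M k V) (h₁ : ∀ x μ, IsRep P β c V₀ V t₀ x μ)
    (h₂ : ∀ x μ, IsRep P β c (V t₀) (fun s => V (t₀ + s)) h x μ) (x : Torus d) (μ : PT d) :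
    IsRep P β c V₀ V (t₀ + h) x μ := by
  have hL := hc.nonneg
  have ht : 0 ≤ t₀ + h := by positivity
  obtain ⟨m, Y, hY⟩ := exists_isFlowChar hc hN hV hM hk (t₀ + h) μ
  refine ⟨_, m, hY.isChar hc hN hNβ hV ht hV₀ x, ?_⟩
  have eqtime : ∀ r, t₀ + (h - r) = t₀ + h - r := fun r => by ring
  have hY1 : IsFlowChar N c (fun s => V (t₀ + s)) h μ m Y := by
    refine ⟨hY.cont, fun S hS => ?_, ?_⟩
    · simpa only [eqtime] using hY.fp S hS
    · simpa only [eqtime] using hY.flow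
  -- restart at time `h`
  have hb := continuous_coeff_along hc.b hL hV (t₀ + h) hY.cont
  have hA := continuous_coeff_along hc.A hL hV (t₀ + h) hY.cont
  have hbs : IsLipCoeff (L * (1 + M)) (L * (1 + k)) fun r y (_ : PT d) =>
      c.b y (V (t₀ + h - (h + r)) y (m (h + r))) (m (h + r)) :=
    { bound := fun s x _ => (hc.b.comp_isLipCoeff hL hV (t₀ + h)).bound (h + s) x _
      lip := fun s x x' ν ν' => by
        refine ((hc.b.comp_isLipCoeff hL hV (t₀ + h)).lip (h + s) x x' _ _).trans ?_
        rw [d1_self]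
        exact mul_le_mul_of_nonneg_left (add_le_add le_rfl (d1_nonneg ν ν')) (by positivity)
      cont := fun x _ => hb.comp (by fun_prop : Continuous fun r : ℝ => (h + r, x)) }
  obtain ⟨Z, hZ⟩ := exists_flow_lawOf hN √(2 * c.σ) (by positivity) (by positivity) hbs μ
  have hZ1 : IsFlowChar N c V t₀ (m h) (fun r => m (h + r)) Z := by
    refine ⟨fun r₀ => ?_, fun S hS => ?_, ?_⟩
    · exact (hY.cont (h + r₀)).comp ((continuous_const.add continuous_id).tendsto r₀)
    · have h3 := (hY.fp (h + S) (by positivity)).shift hh (by linarith)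
      have e1 : h + S - h = S := by ring
      have e2 : ∀ s, t₀ + h - (h + S - s) = t₀ - (S - s) := fun s => by ring
      simpa only [e1, e2] using h3
    · have e2 : ∀ r, t₀ + h - (h + r) = t₀ - r := fun s => by ring
      simpa only [e2] using hZ
  set ν : PT d := ⟨Measure.dirac x, inferInstance⟩ with hν
  set ρ : PT d := lawOf ((ν : Measure (Torus d)).prod P) (Y h) with hρ
  have hYm := hY.flow.measurable hN
  have hZm := hZ.measurable hN
  let a : ℝ → Torus d → E d := fun s z => c.A z (V (t₀ - s) z (m (h + s))) (m (h + s))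
  have hac : Continuous (Function.uncurry a) := continuous_coeff_along hc.A hL hV t₀ hZ1.cont
  have haC : ∀ s z, ‖a s z‖ ≤ L * (1 + M) := fun s z =>
    (hc.A.comp_isLipCoeff hL hV t₀).bound _ _ _
  let v : Torus d → E d := fun z => V₀ z (m (h + t₀))
  have hvc : Continuous v := hV₀.continuous _
  have hlaw : ∀ s, 0 ≤ s → lawOf ((ρ : Measure (Torus d)).prod P) (Z s) =
      lawOf ((ν : Measure (Torus d)).prod P) (Y (h + s)) := fun s hs =>
    hY.flow.lawOf_restart hN (k := L * (1 + k)) (Real.sqrt_pos.2 (by have := hc.σ_pos; positivity))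
      (by positivity) hb (fun r z => (hc.b.comp_isLipCoeff hL hV (t₀ + h)).bound r z _)
      (fun r z z' => by
        simpa using (hc.b.comp_isLipCoeff hL hV (t₀ + h)).lip r z z' (m r) (m r)) hh hZ ν ρ hρ hs
  have hmeasX : ∀ {X : ℝ → Torus d × Ω → Torus d}, (∀ s, Measurable (X s)) →
      (∀ p, Continuous fun s => X s p) → StronglyMeasurable fun p =>
        (∫ s in (0 : ℝ)..t₀, a s (X s p)) + v (X t₀ p) := fun {X} hX hXc => by
    refine StronglyMeasurable.add ?_ (hvc.measurable.comp (hX t₀)).stronglyMeasurable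
    simp_rw [intervalIntegral.integral_of_le ht₀]
    exact (measurable_setIntegral t₀ (fun p => hac.comp (continuous_id.prodMk (hXc p)))
      fun s => (hac.comp (by fun_prop : Continuous fun x => (s, x))).measurable.comp
        (hX s)).stronglyMeasurable
  have hYsc : ∀ p, Continuous fun s => Y (h + s) p := fun p =>
    (hY.flow.cont p).comp (continuous_const.add continuous_id)
  -- the value at time `t₀`, averaged over the law of `Y h`
  have hW : ∀ y, V t₀ y (m h) =
      ∫ ω, ((∫ s in (0 : ℝ)..t₀, a s (Z s (y, ω))) + v (Z t₀ (y, ω))) ∂P :=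
    fun y => (h₁ y (m h)).eq_payoff hc hM hk hK₀ hV₀ ht₀ hV (hZ1.isChar hc hN hNβ hV ht₀ hV₀ y)
  have hmid : ∫ ω, V t₀ (Y h (x, ω)) (m h) ∂P =
      ∫ ω, ((∫ s in (0 : ℝ)..t₀, a s (Y (h + s) (x, ω))) + v (Y (h + t₀) (x, ω))) ∂P := by
    have hVc : Continuous fun y => V t₀ y (m h) := (hV.lipXM t₀).continuous _
    have i1 := integral_dirac_prod' (P := P) x (hVc.measurable.comp (hYm h)).stronglyMeasurable
    have i2 := integral_dirac_prod' (P := P) x (hmeasX (fun s => hYm (h + s)) hYsc)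
    have i3 := integral_lawOf (Q := (ν : Measure (Torus d)).prod P) (hYm h).aemeasurable hVc
    have i4 := integral_payoff_eq_lawOf (Q := (ν : Measure (Torus d)).prod P)
      (fun s => hYm (h + s)) hYsc hac haC hvc ht₀
    have i5 := integral_payoff_eq_lawOf (Q := (ρ : Measure (Torus d)).prod P)
      hZm hZ.cont hac haC hvc ht₀
    have hmZ := hmeasX hZm hZ.cont
    have i6 : Integrable (fun p => (∫ s in (0 : ℝ)..t₀, a s (Z s p)) + v (Z t₀ p))
        ((ρ : Measure (Torus d)).prod P) := by
      obtain ⟨C, hC⟩ := (isCompact_range hvc).isBounded.exists_norm_le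
      refine Integrable.of_bound hmZ.aestronglyMeasurable (L * (1 + M) * |t₀ - 0| + C)
        (Eventually.of_forall fun p => (norm_add_le _ _).trans (add_le_add
          (intervalIntegral.norm_integral_le_of_norm_le_const fun s _ => haC _ _) (hC _ ⟨_, rfl⟩)))
    have i7 := integral_prod _ i6
    refine i1.symm.trans (Eq.trans ?_ i2)
    refine i3.symm.trans (Eq.trans ?_ i4.symm)
    simp_rw [hW]
    refine i7.symm.trans ?_
    rw [i5, hlaw t₀ ht₀]
    congr 1
    refine intervalIntegral.integral_congr fun s hs => ?_
    rw [uIcc_of_le ht₀] at hs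
    simp only [hlaw s hs.1]
  have hK : LipXM k (V t₀) := hV.lipXM t₀
  have hchar1 := hY1.isChar hc hN hNβ (hV.comp_add t₀) hh hK x
  have hstart := (h₂ x μ).eq_payoff hc hM hk hk hK hh (hV.comp_add t₀) hchar1
  have hchar := hY.isChar hc hN hNβ hV ht hV₀ x
  have hAc : ∀ ω, Continuous fun s => c.A (Y s (x, ω)) (V (t₀ + h - s) (Y s (x, ω)) (m s)) (m s) :=
    fun ω => hA.comp (continuous_id.prodMk (hY.flow.cont (x, ω)))
  have hsplit : ∀ ω, (∫ s in (0 : ℝ)..(t₀ + h), c.A (Y s (x, ω)) (V (t₀ + h - s) (Y s (x, ω)) (m s))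
      (m s)) + V₀ (Y (t₀ + h) (x, ω)) (m (t₀ + h)) =
      (∫ s in (0 : ℝ)..h, c.A (Y s (x, ω)) (V (t₀ + (h - s)) (Y s (x, ω)) (m s)) (m s)) +
      ((∫ s in (0 : ℝ)..t₀, a s (Y (h + s) (x, ω))) + v (Y (h + t₀) (x, ω))) := fun ω => by
    have e1 := intervalIntegral.integral_comp_add_left (a := 0) (b := t₀) (fun s =>
      c.A (Y s (x, ω)) (V (t₀ + h - s) (Y s (x, ω)) (m s)) (m s)) h
    have e2 : ∀ r, t₀ + h - (h + r) = t₀ - r := fun s => by ring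
    simp only [e2, add_zero] at e1
    simp only [a, v, eqtime]
    rw [e1, ← add_assoc, add_comm h t₀, intervalIntegral.integral_add_adjacent_intervals
      ((hAc ω).intervalIntegrable _ _) ((hAc ω).intervalIntegrable _ _)]
  have hint2 : Integrable (fun ω => (∫ s in (0 : ℝ)..t₀, a s (Y (h + s) (x, ω))) +
      v (Y (h + t₀) (x, ω))) P := by
    obtain ⟨C, hC⟩ := (isCompact_range hvc).isBounded.exists_norm_le
    have hm2 := (hmeasX (fun s => hYm (h + s)) hYsc).comp_measurable
      (measurable_prodMk_left : Measurable (Prod.mk x : Ω → Torus d × Ω))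
    refine Integrable.of_bound hm2.aestronglyMeasurable (L * (1 + M) * |t₀ - 0| + C)
      (Eventually.of_forall fun p => (norm_add_le _ _).trans (add_le_add
        (intervalIntegral.norm_integral_le_of_norm_le_const fun s _ => haC _ _) (hC _ ⟨_, rfl⟩)))
  have hint1 := (hchar1.integral_add hh).2
  simp only [payoff] at hstart ⊢
  rw [hstart, integral_add hint1 hchar1.int₀]
  simp_rw [hsplit]
  rw [integral_add hint1 hint2, hmid]

/-- Concatenation of two regular solutions, the second one starting where the first one ends. -/
theorem IsRegular.concat (hc : c.IsLip L) (hN : IsNoise P N)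
    (hNβ : ∀ᵐ ω ∂P, ∀ s, N s ω = WithLp.toLp 2 (fun i => β i s.toNNReal ω))
    {M k M' k' K₀ t₀ δ : ℝ} (hk : 0 ≤ k) (hK₀ : 0 ≤ K₀) (ht₀ : 0 ≤ t₀)
    (hδ : 0 ≤ δ) (hV₀ : LipXM K₀ V₀) (hW : IsRegular P β c M k t₀ V₀ W)
    (hV : IsRegular P β c M' k' δ (W t₀) V) :
    ∃ U, IsRegular P β c (max M M') (max k k') (t₀ + δ) V₀ U := by
  have hV0 : V 0 = W t₀ := by
    ext1 x; ext1 μ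
    exact (hV.rep 0 ⟨le_rfl, hδ⟩ x μ).eq_initial hN hNβ
  set U : ℝ → Torus d → PT d → E d := fun t => if t ≤ t₀ then W t else V (t - t₀) with hU
  have hU1 : ∀ t ≤ t₀, U t = W t := fun t ht => if_pos ht
  have hU2 : ∀ s, 0 ≤ s → U (t₀ + s) = V s := fun s hs => by
    rcases hs.eq_or_lt with rfl | hs
    · rw [add_zero, hU1 t₀ le_rfl, hV0]
    · simp only [hU]; rw [if_neg (by linarith), add_sub_cancel_left]
  have hUc : IsLipCoeff (max M M') (max k k') U := by
    refine ⟨fun t x μ => ?_, fun t x x' μ μ' => ?_, fun x μ => ?_⟩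
    · by_cases h : t ≤ t₀
      · simp only [hU, if_pos h]; exact (hW.coeff.bound _ _ _).trans (le_max_left _ _)
      · simp only [hU, if_neg h]; exact (hV.coeff.bound _ _ _).trans (le_max_right _ _)
    · by_cases h : t ≤ t₀
      · simp only [hU, if_pos h]; exact ((hW.coeff.lipXM _).mono (le_max_left _ _)) _ _ _ _
      · simp only [hU, if_neg h]; exact ((hV.coeff.lipXM _).mono (le_max_right _ _)) _ _ _ _
    · have e : (fun t => U t x μ) = fun t => if t ≤ t₀ then W t x μ else V (t - t₀) x μ := by
        ext1 t
        by_cases h : t ≤ t₀ <;> simp [hU, h]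
      rw [e]
      refine Continuous.if_le (hW.coeff.cont x μ) ((hV.coeff.cont x μ).comp (by fun_prop))
        continuous_id continuous_const fun t ht => ?_
      have ht : t = t₀ := ht
      rw [ht, sub_self, hV0]
  have hM : 0 ≤ max M M' := (norm_nonneg _).trans (hUc.bound 0 0 (Classical.arbitrary _))
  have hrep1 : ∀ t ∈ Icc 0 t₀, ∀ x μ, IsRep P β c V₀ U t x μ := fun t ht x μ =>
    (hW.rep t ht x μ).congr ht.1 fun s hs => (hU1 s (hs.2.trans ht.2)).symm
  refine ⟨U, hUc, fun t ht x μ => ?_⟩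
  rcases le_total t t₀ with h | h
  · exact hrep1 t ⟨ht.1, h⟩ x μ
  · have e : t = t₀ + (t - t₀) := by ring
    rw [e]
    refine isRep_add hc hN hNβ hM (hk.trans (le_max_left _ _)) hK₀ hV₀ ht₀ (sub_nonneg.2 h) hUc
      (hrep1 t₀ ⟨ht₀, le_rfl⟩) (fun x μ => ?_) x μ
    rw [hU1 t₀ le_rfl]
    exact (hV.rep _ ⟨sub_nonneg.2 h, by linarith [ht.2]⟩ x μ).congr (sub_nonneg.2 h)
      fun s hs => (hU2 s hs.1).symm

end concat

/-! ### The maximal solution -/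

section maximal
variable {Ω : Type*} [MeasurableSpace Ω] {d : ℕ} {P : Measure Ω} [IsProbabilityMeasure P]
  {β : Fin d → ℝ≥0 → Ω → ℝ} {N : ℝ → Ω → E d} {c : Coeffs d} {L : ℝ}
  {V₀ : Torus d → PT d → E d} {V W : ℝ → Torus d → PT d → E d}

/-- Lipschitz solutions on `[0, T)`, in terms of the pointwise representation formula. -/
structure IsLipSol (P : Measure Ω) (β : Fin d → ℝ≥0 → Ω → ℝ) (c : Coeffs d)
    (V₀ : Torus d → PT d → E d) (T : EReal) (V : ℝ → Torus d → PT d → E d) : Prop where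
  measurable : ∀ x m, Measurable fun t : {t : ℝ // 0 ≤ t ∧ (t : EReal) < T} => V t x m
  lipschitz : ∀ t : ℝ, 0 ≤ t → (t : EReal) < T → ∃ C : ℝ≥0, ∀ s ∈ Icc 0 t, Lip (V s) ≤ C
  rep : ∀ t : ℝ, 0 ≤ t → (t : EReal) < T → ∀ x μ, IsRep P β c V₀ V t x μ

omit [IsProbabilityMeasure P] in
lemma isLipschitzSolution_iff {σ σ' : ℝ} {DxH DpH B : Torus d → E d → PT d → E d} {T : EReal} :
    IsLipschitzSolution P β σ σ' DxH DpH B V₀ T V ↔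
      IsLipSol P β ⟨fun x p m => -DpH x p m, fun x p m => -B x p m, fun x p m => -DxH x p m, σ, σ'⟩
        V₀ T V := by
  constructor
  · intro h
    refine ⟨h.measurable, h.lipschitz, fun t ht htT x μ => ?_⟩
    obtain ⟨X, m, h1, h2, h3, h4, h5⟩ := h.represented t ht htT x μ
    exact ⟨X, m, ⟨h1, h2, h3, h4⟩, h5⟩
  · intro h
    refine ⟨h.measurable, h.lipschitz, fun t ht htT x μ => ?_⟩
    obtain ⟨X, m, h1, h2⟩ := h.rep t ht htT x μ
    exact ⟨X, m, h1.fp, h1.sde, h1.int, h1.int₀, h2⟩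

omit [IsProbabilityMeasure P] in
lemma IsLipSol.mono {T T' : EReal} (h : IsLipSol P β c V₀ T V) (hT : T' ≤ T) :
    IsLipSol P β c V₀ T' V where
  measurable x m := by
    have : Measurable fun t : {t : ℝ // 0 ≤ t ∧ (t : EReal) < T'} =>
        (⟨t, t.2.1, t.2.2.trans_le hT⟩ : {t : ℝ // 0 ≤ t ∧ (t : EReal) < T}) :=
      measurable_subtype_coe.subtype_mk
    exact (h.measurable x m).comp this
  lipschitz t ht htT := h.lipschitz t ht (htT.trans_le hT)
  rep t ht htT := h.rep t ht (htT.trans_le hT)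

/-- A Lipschitz solution is bounded and Lipschitz, uniformly on compact time intervals. -/
lemma IsLipSol.exists_bounds (hc : c.IsLip L) {K₀ : ℝ} (hV₀ : LipXM K₀ V₀) {T : EReal}
    (h : IsLipSol P β c V₀ T V) {t : ℝ} (ht : 0 ≤ t) (htT : (t : EReal) < T) :
    ∃ K C : ℝ, 0 ≤ K ∧ 0 ≤ C ∧ (∀ s ∈ Icc 0 t, LipXM K (V s)) ∧
      ∀ s ∈ Icc 0 t, ∀ x μ, ‖V s x μ‖ ≤ C := by
  obtain ⟨K, hK⟩ := h.lipschitz t ht htT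
  have hlt : ∀ s ∈ Icc 0 t, (s : EReal) < T := fun s hs =>
    (EReal.coe_le_coe_iff.2 hs.2).trans_lt htT
  have hLip : ∀ s ∈ Icc 0 t, LipXM K (V s) := fun s hs => lipXM_of_Lip_le (hK s hs)
  obtain ⟨C, hC⟩ := exists_bound_of_isRep hc ht hV₀ (fun s hs => h.rep s hs.1 (hlt s hs)) hLip
    (fun x μ => by
      have hs : MeasurableSet {t : ℝ | 0 ≤ t ∧ (t : EReal) < T} :=
        (measurableSet_le measurable_const measurable_id).inter
          (measurableSet_lt measurable_coe_real_ereal measurable_const)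
      have hemb := MeasurableEmbedding.subtype_coe hs
      refine ⟨Function.extend Subtype.val
        (fun t : {t : ℝ // 0 ≤ t ∧ (t : EReal) < T} => V t x μ) 0,
        hemb.measurable_extend (h.measurable x μ) measurable_zero, fun s hs => ?_⟩
      exact Subtype.val_injective.extend_apply _ _
        (⟨s, hs.1, hlt s hs⟩ : {t : ℝ // 0 ≤ t ∧ (t : EReal) < T}))
  exact ⟨K, C, K.2, (norm_nonneg _).trans (hC 0 ⟨le_rfl, ht⟩ 0 (Classical.arbitrary _)), hLip, hC⟩

/-- A Lipschitz solution agrees with every regular solution. -/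
lemma IsLipSol.eq_of_isRegular (hc : c.IsLip L) {K₀ : ℝ} (hK₀ : 0 ≤ K₀) (hV₀ : LipXM K₀ V₀)
    {T : EReal} (h : IsLipSol P β c V₀ T V) {M k S : ℝ} (hk : 0 ≤ k)
    (hW : IsRegular P β c M k S V₀ W) {t : ℝ} (ht : t ∈ Icc 0 S) (htT : (t : EReal) < T) :
    V t = W t := by
  obtain ⟨K, C, -, -, h1, h2⟩ := h.exists_bounds hc hV₀ ht.1 htT
  have hM : 0 ≤ M := (norm_nonneg _).trans (hW.coeff.bound 0 0 (Classical.arbitrary _))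
  exact eqOn_of_isRep hc hM hk hK₀ hV₀
    (fun s hs => h.rep s hs.1 ((EReal.coe_le_coe_iff.2 hs.2).trans_lt htT))
    (fun s hs => (h1 s hs).continuous) h2 (fun s hs => hW.rep s ⟨hs.1, hs.2.trans ht.2⟩)
    (fun s _ => hW.coeff.bound s) (fun s _ => hW.coeff.lipXM s) t ⟨ht.1, le_rfl⟩

omit [IsProbabilityMeasure P] in
lemma IsRegular.mono {M k S S' : ℝ} (h : IsRegular P β c M k S V₀ V) (hS : S' ≤ S) :
    IsRegular P β c M k S' V₀ V :=
  ⟨h.coeff, fun t ht => h.rep t ⟨ht.1, ht.2.trans hS⟩⟩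

lemma IsRegular.eq_of_isRegular (hc : c.IsLip L) {K₀ : ℝ} (hK₀ : 0 ≤ K₀) (hV₀ : LipXM K₀ V₀)
    {M k S M' k' S' : ℝ} (hk : 0 ≤ k) (hV : IsRegular P β c M' k' S' V₀ V)
    (hW : IsRegular P β c M k S V₀ W) {t : ℝ} (ht : t ∈ Icc 0 S) (ht' : t ≤ S') : V t = W t := by
  have hM : 0 ≤ M := (norm_nonneg _).trans (hW.coeff.bound 0 0 (Classical.arbitrary _))
  exact eqOn_of_isRep hc hM hk hK₀ hV₀ (fun s hs => hV.rep s ⟨hs.1, hs.2.trans ht'⟩)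
    (fun s _ => (hV.coeff.lipXM s).continuous) (fun s _ => hV.coeff.bound s)
    (fun s hs => hW.rep s ⟨hs.1, hs.2.trans ht.2⟩)
    (fun s _ => hW.coeff.bound s) (fun s _ => hW.coeff.lipXM s) t ⟨ht.1, le_rfl⟩

/-- Existence, maximality and blow-up for the maximal Lipschitz solution. -/
theorem exists_maximal_isLipSol (hc : c.IsLip L) (hN : IsNoise P N)
    (hNβ : ∀ᵐ ω ∂P, ∀ s, N s ω = WithLp.toLp 2 (fun i => β i s.toNNReal ω)) {K₀ : ℝ}
    (hK₀ : 0 ≤ K₀) (hV₀ : LipXM K₀ V₀) :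
    ∃ (Tc : EReal) (W : ℝ → Torus d → PT d → E d), 0 < Tc ∧ IsLipSol P β c V₀ Tc W ∧
      (∀ (T : EReal) (V : ℝ → Torus d → PT d → E d), IsLipSol P β c V₀ T V →
        T ≤ Tc ∧ ∀ t : ℝ, 0 ≤ t → (t : EReal) < T → V t = W t) ∧
      ∀ τ : ℝ, Tc = (τ : EReal) → Tendsto (fun t : ℝ => Lip (W t)) (𝓝[<] τ) (𝓝 ⊤) := by
  classical
  have hL := hc.nonneg
  obtain ⟨M₀, hM₀, hV₀b⟩ := hV₀.exists_bound
  -- the horizons of regular solutions; `W t` is the value of any regular solution reaching `t`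
  let 𝒯 : Set ℝ := {T | 0 ≤ T ∧ ∃ M k V, 0 ≤ k ∧ IsRegular P β c M k T V₀ V}
  set Tc : EReal := sSup ((fun T : ℝ => (T : EReal)) '' 𝒯) with hTc
  have hmem : ∀ T ∈ 𝒯, (T : EReal) ≤ Tc := fun T hT => le_sSup ⟨T, hT, rfl⟩
  have hlt : ∀ t : ℝ, (t : EReal) < Tc → ∃ T ∈ 𝒯, t < T := fun t ht => by
    obtain ⟨_, ⟨T, hT, rfl⟩, h⟩ := lt_sSup_iff.1 ht
    exact ⟨T, hT, EReal.coe_lt_coe_iff.1 h⟩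
  let W : ℝ → Torus d → PT d → E d := fun t =>
    if h : t ∈ 𝒯 then h.2.choose_spec.choose_spec.choose t else 0
  have hW : ∀ {M k T V}, 0 ≤ k → IsRegular P β c M k T V₀ V → ∀ t ∈ Icc 0 T, W t = V t := by
    intro M k T V hk hV t ht
    have h : t ∈ 𝒯 := ⟨ht.1, M, k, V, hk, hV.mono ht.2⟩
    simp only [W]
    rw [dif_pos h]
    have h1 := h.2.choose_spec.choose_spec.choose_spec
    exact h1.2.eq_of_isRegular hc hK₀ hV₀ hk hV ht le_rfl
  -- `W` can be continued for a time depending only on bounds at the current time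
  have hext : ∀ K C : ℝ, 0 ≤ K → 0 ≤ C → ∃ δ : ℝ, 0 < δ ∧ ∀ t : ℝ, 0 ≤ t → (t : EReal) < Tc →
      LipXM K (W t) → (∀ x μ, ‖W t x μ‖ ≤ C) → ((t + δ : ℝ) : EReal) ≤ Tc := by
    intro K C hK hC
    obtain ⟨δ, k', hδ, hk', hshort⟩ := exists_isRegular hc hN hNβ hK hC
    refine ⟨δ, hδ, fun t ht htTc h1 h2 => ?_⟩
    obtain ⟨T, ⟨-, M, k, V, hk, hV⟩, htT⟩ := hlt t htTc
    have e := hW hk hV t ⟨ht, htT.le⟩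
    rw [e] at h1
    obtain ⟨U, hU⟩ := hshort (V t) h1 (by simpa only [e] using h2)
    obtain ⟨U', hU'⟩ := (hV.mono htT.le).concat hc hN hNβ hk hK₀ ht hδ.le hV₀ hU
    exact hmem _ ⟨by positivity, _, _, U', hk.trans (le_max_left _ _), hU'⟩
  have hpos : 0 < Tc := by
    obtain ⟨δ, k, hδ, hk, hshort⟩ := exists_isRegular hc hN hNβ hK₀ hM₀
    obtain ⟨V, hV⟩ := hshort V₀ hV₀ hV₀b
    exact (EReal.coe_pos.2 hδ).trans_le (hmem δ ⟨hδ.le, _, k, V, hk, hV⟩)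
  refine ⟨Tc, W, hpos, ⟨fun x m => ?_, fun t ht htTc => ?_, fun t ht htTc x μ => ?_⟩,
    fun T V hV => ?_, fun τ hτ => ?_⟩
  · refine Continuous.measurable (continuous_iff_continuousAt.2 fun t => ?_)
    obtain ⟨T, ⟨-, M, k, V, hk, hV⟩, htT⟩ := hlt t t.2.2
    have h1 : ContinuousAt (fun s : {t : ℝ // 0 ≤ t ∧ (t : EReal) < Tc} => V s x m) t :=
      ((hV.coeff.cont x m).comp continuous_subtype_val).continuousAt
    refine h1.congr ?_
    filter_upwards [(continuous_subtype_val.tendsto t).eventually (gt_mem_nhds htT)] with s hs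
    rw [hW hk hV s ⟨s.2.1, hs.le⟩]
  · obtain ⟨T, ⟨-, M, k, V, hk, hV⟩, htT⟩ := hlt t htTc
    refine ⟨(2 * k).toNNReal, fun s hs => ?_⟩
    rw [hW hk hV s ⟨hs.1, hs.2.trans htT.le⟩]
    exact (hV.coeff.lipXM s).Lip_le hk
  · obtain ⟨T, ⟨-, M, k, V, hk, hV⟩, htT⟩ := hlt t htTc
    exact (hV.rep t ⟨ht, htT.le⟩ x μ).congr ht fun s hs =>
      (hW hk hV s ⟨hs.1, hs.2.trans htT.le⟩).symm
  · have heq : ∀ t : ℝ, 0 ≤ t → (t : EReal) < T → (t : EReal) < Tc → V t = W t := by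
      intro t ht htT htTc
      obtain ⟨S, ⟨-, M, k, U, hk, hU⟩, htS⟩ := hlt t htTc
      rw [hW hk hU t ⟨ht, htS.le⟩]
      exact hV.eq_of_isRegular hc hK₀ hV₀ hk hU ⟨ht, htS.le⟩ htT
    have hle : T ≤ Tc := by
      by_contra! hcon
      have hTc0 : Tc ≠ ⊥ := (bot_lt_of_lt hpos).ne'
      have hTc1 : Tc ≠ ⊤ := (hcon.trans_le le_top).ne
      obtain ⟨τ, hτ⟩ : ∃ τ : ℝ, Tc = τ := ⟨Tc.toReal, (EReal.coe_toReal hTc1 hTc0).symm⟩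
      rw [hτ] at hcon
      have hτ0 : 0 < τ := by rw [hτ] at hpos; exact EReal.coe_pos.1 hpos
      obtain ⟨K, C, hK, hC, h1, h2⟩ := hV.exists_bounds hc hV₀ hτ0.le hcon
      obtain ⟨δ, hδ, hδ'⟩ := hext K C hK hC
      have ht1 : max 0 (τ - δ / 2) < τ := max_lt hτ0 (by linarith)
      have ht1' : ((max 0 (τ - δ / 2) : ℝ) : EReal) < Tc := by
        rw [hτ]; exact EReal.coe_lt_coe_iff.2 ht1
      have ht2 : max 0 (τ - δ / 2) ∈ Icc 0 τ := ⟨le_max_left _ _, ht1.le⟩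
      have e := heq _ ht2.1 ((EReal.coe_lt_coe_iff.2 ht1).trans hcon) ht1'
      have h3 := hδ' _ ht2.1 ht1' (e ▸ h1 _ ht2) (e ▸ h2 _ ht2)
      rw [hτ, EReal.coe_le_coe_iff] at h3
      linarith [le_max_right 0 (τ - δ / 2)]
    exact ⟨hle, fun t ht htT => heq t ht htT (htT.trans_le hle)⟩
  · rw [ENNReal.tendsto_nhds_top_iff_nnreal]
    intro K
    have hτ0 : 0 < τ := by rw [hτ] at hpos; exact EReal.coe_pos.1 hpos
    -- the sup bound is uniform up to `τ`, so a Lipschitz bound near `τ` would allow continuation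
    obtain ⟨δ, hδ, hδ'⟩ :=
      hext K (2 * (L * τ + M₀) * Real.exp ((2 * L + 1) * τ)) K.2 (by positivity)
    have h1 : Ioo (max 0 (τ - δ)) τ ∈ 𝓝[<] τ := Ioo_mem_nhdsLT (max_lt hτ0 (by linarith))
    filter_upwards [h1] with t ht
    by_contra! hcon
    have ht0 : 0 ≤ t := (le_max_left _ _).trans ht.1.le
    have htTc : (t : EReal) < Tc := by rw [hτ]; exact EReal.coe_lt_coe_iff.2 ht.2
    have hbd : ∀ x μ, ‖W t x μ‖ ≤ 2 * (L * τ + M₀) * Real.exp ((2 * L + 1) * τ) := by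
      intro x μ
      obtain ⟨T, ⟨-, M, k, V, hk, hV⟩, htT⟩ := hlt t htTc
      rw [hW hk hV t ⟨ht0, htT.le⟩]
      refine (norm_le_of_isRep hc hM₀ ht0 hV₀b (fun s hs => hV.rep s ⟨hs.1, hs.2.trans htT.le⟩)
        (fun s _ => hV.coeff.bound s) t ⟨ht0, le_rfl⟩ x μ).trans ?_
      have := ht.2.le
      gcongr
    have h3 := hδ' t ht0 htTc (lipXM_of_Lip_le hcon) hbd
    rw [hτ, EReal.coe_le_coe_iff] at h3
    linarith [le_max_right 0 (τ - δ), ht.1]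

end maximal

end MFG

end

theorem mainTheorem2 {Ω : Type*} [MeasurableSpace Ω] (P : Measure Ω) [IsProbabilityMeasure P]
    {d : ℕ} (β : Fin d → ℝ≥0 → Ω → ℝ) (hβ : MFG.IsBrownian β P)
    (σ σ' : ℝ) (hσ : 0 < σ) (hσ' : 0 < σ')
    (H : MFG.Torus d → MFG.E d → MFG.PT d → ℝ)
    (DxH DpH B : MFG.Torus d → MFG.E d → MFG.PT d → MFG.E d)
    (hDxH : ∀ x p m, MFG.HasTorusGradientAt (fun y => H y p m) (DxH x p m) x)
    (hDpH : ∀ x p m, HasGradientAt (fun q => H x q m) (DpH x p m) p)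
    (hDxH_lip : MFG.IsLipschitzXPM DxH) (hDpH_lip : MFG.IsLipschitzXPM DpH)
    (hB_lip : MFG.IsLipschitzXPM B)
    (U₀ : MFG.Torus d → MFG.PT d → ℝ) (DU₀ : MFG.Torus d → MFG.PT d → MFG.E d)
    (hDU₀ : ∀ x m, MFG.HasTorusGradientAt (fun y => U₀ y m) (DU₀ x m) x)
    (hDU₀_lip : MFG.IsLipschitzXM DU₀) :
    -- short-time existence and uniqueness
    (∃ T : ℝ, 0 < T ∧
      (∃ W, MFG.IsLipschitzSolution P β σ σ' DxH DpH B DU₀ T W) ∧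
      ∀ W W', MFG.IsLipschitzSolution P β σ σ' DxH DpH B DU₀ T W →
        MFG.IsLipschitzSolution P β σ σ' DxH DpH B DU₀ T W' →
        ∀ t : ℝ, 0 ≤ t → t < T → W t = W' t) ∧
    -- maximal solution and blow-up
    ∃ (Tc : EReal) (W : ℝ → MFG.Torus d → MFG.PT d → MFG.E d),
      0 < Tc ∧ MFG.IsLipschitzSolution P β σ σ' DxH DpH B DU₀ Tc W ∧
      (∀ (T : EReal) (V : ℝ → MFG.Torus d → MFG.PT d → MFG.E d),
        MFG.IsLipschitzSolution P β σ σ' DxH DpH B DU₀ T V →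
        T ≤ Tc ∧ ∀ t : ℝ, 0 ≤ t → (t : EReal) < T → V t = W t) ∧
      (∀ τ : ℝ, Tc = (τ : EReal) →
        Tendsto (fun t : ℝ => MFG.Lip (W t)) (𝓝[<] τ) (𝓝 ⊤)) := by
  obtain ⟨N, hN, hNβ⟩ := hβ.exists_noise
  obtain ⟨L₁, h₁⟩ := hDpH_lip.exists_isCoeff
  obtain ⟨L₂, h₂⟩ := hB_lip.exists_isCoeff
  obtain ⟨L₃, h₃⟩ := hDxH_lip.exists_isCoeff
  obtain ⟨K, hK⟩ := hDU₀_lip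
  have hc : MFG.Coeffs.IsLip ⟨fun x p m => -DpH x p m, fun x p m => -B x p m,
      fun x p m => -DxH x p m, σ, σ'⟩ (max 0 (max L₁ (max L₂ L₃))) :=
    { nonneg := le_max_left _ _
      b := h₁ _ (le_max_of_le_right (le_max_left _ _))
      F := h₂ _ (le_max_of_le_right (le_max_of_le_right (le_max_left _ _)))
      A := h₃ _ (le_max_of_le_right (le_max_of_le_right (le_max_right _ _)))
      σ_pos := hσ
      σ'_pos := hσ' }
  have hK' : MFG.LipXM (max K 0) DU₀ := MFG.LipXM.mono hK (le_max_left _ _)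
  obtain ⟨Tc, W, hTc, hW, hmax, hblow⟩ :=
    MFG.exists_maximal_isLipSol hc hN hNβ (le_max_right K 0) hK'
  simp only [MFG.isLipschitzSolution_iff]
  refine ⟨?_, Tc, W, hTc, hW, hmax, hblow⟩
  obtain ⟨T, hT0, hT⟩ := EReal.lt_iff_exists_real_btwn.1 hTc
  refine ⟨T, EReal.coe_pos.1 hT0, ⟨W, hW.mono hT.le⟩, fun V V' hV hV' t ht htT => ?_⟩
  rw [(hmax _ V hV).2 t ht (EReal.coe_lt_coe_iff.2 htT),
    (hmax _ V' hV').2 t ht (EReal.coe_lt_coe_iff.2 htT)]
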